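/- **Theorem 1.** Consider on the plane the quasi-linear system for $U=(\Lambda,u_0,f,g)^T$ $$f_x+g_y=0,\quad (f\Lambda)_x-(g\Lambda)_y=0,\quad (u_0)_x+2\Lambda_x-\tfrac12 g(f_y-g_x)=0,\quad -(u_0)_y+2\Lambda_y+\tfrac12 f(f_y-g_x)=0, \qquad (S)$$ written in matrix form as $A(U)U_x+B(U)U_y=0$ with $$A=\begin{pmatrix}0&0&1&0\\ f&0&\Lambda&0\\ 2&1&0&\frac g2\\ 0&0&0&-\frac f2\end{pmatrix},\qquad B=\begin{pmatrix}0&0&0&1\\ -g&0&0&-\Lambda\\ 0&0&-\frac g2&0\\ 2&-1&\frac f2&0\end{pmatrix},$$ and the evolution system $$\Lambda_t=(g\Lambda)_x+(f\Lambda)_y,\quad (u_0)_t=-2(g\Lambda)_x+g(u_0)_x+2(f\Lambda)_y+f(u_0)_y,\quad f_t=2(u_0)_y,\quad g_t=-2(u_0)_x. \qquad (E)$$ To $U$ with $\Lambda>0$ associate the metric $\Lambda(dx^2+dy^2)$, with $H=\frac{p_1^2+p_2^2}{2\Lambda}$, the magnetic form $\Omega\,dx\wedge dy$, $\Omega=\frac14(g_x-f_y)$,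 and the function $F=2(p_1^2-p_2^2)+2fp_1-2gp_2+u_0$. The magnetic Poisson bracket is $$\{F,H\}_{mg}=\sum_{i=1}^2\Big(\frac{\partial F}{\partial x^i}\frac{\partial H}{\partial p_i}-\frac{\partial F}{\partial p_i}\frac{\partial H}{\partial x^i}\Big)+\Omega\Big(\frac{\partial F}{\partial p_1}\frac{\partial H}{\partial p_2}-\frac{\partial F}{\partial p_2}\frac{\partial H}{\partial p_1}\Big).$$ 1. The system (S) is semi-Hamiltonian: near every $U$ with $\det A(U)\ne0$ at which $A^{-1}B$ has four distinct real eigenvalues, it can be written in Riemann invariants, $(r_j)_x+\lambda_j(r_j)_y=0$, and in conservation-law form, $(Q_j)_x+(R_j)_y=0$, $j=1,\dots,4$, where $(r_j)$ and $(Q_j)$ are smooth coordinate systems. It is not linearly degenerate: at some such $U$ the derivative of some eigenvalue of $A^{-1}B$ along one of its own eigenvectors is non-zero. 2. A $C^1$ function $U$ with $\Lambda>0$ solves (S) if and only if $\{F,H\}_{mg}=0$ on $\{H=\frac12\}$. 3. Let $\Lambda_1,\Lambda_2:\mathbb R\to\mathbb R$ be real-analytic, positive, $1$-periodic and non-constant,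 and let $U_0=(\Lambda_1(x)+\Lambda_2(y),\,2\Lambda_2(y)-2\Lambda_1(x),\,0,\,0)^T$ (a Liouville metric with zero magnetic field). Then there are $\varepsilon>0$ and a real-analytic solution $U(x,y,t)$, $(x,y)\in\mathbb R^2$, $|t|<\varepsilon$, of (E) with $U|_{t=0}=U_0$. It is unique: every real-analytic solution of this Cauchy problem on $\mathbb R^2\times(-\delta,\delta)$, $0<\delta\le\varepsilon$, coincides with $U$ there. It has the following properties. * For all $|t|<\varepsilon$, $U(\cdot,\cdot,t)$ is $1$-periodic in $x$ and in $y$, has $\Lambda>0$ and solves (S). Consequently $\Lambda(dx^2+dy^2)$ is a real-analytic Riemannian metric on the torus $\mathbb R^2/\mathbb Z^2$, $\Omega$ is a real-analytic magnetic field on the torus, and $F$ is a first integral of the magnetic geodesic flow on $\{H=\frac12\}$. The function $F$ has degree two in the momenta, with real-analytic periodic coefficients; its quadratic part is not proportional to $H$; and $F$ and $H$ are functionally independent almost everywhere on $\{H=\frac12\}$. * For $0<|t|<\varepsilon$ the metric is not a Liouville metric, that is, in no global smooth coordinates $(u,v)$ on the universal cover $\mathbb R^2$ does it have the form $(h_1(u)+h_2(v))(du^2+dv^2)$;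 and $\Omega\not\equiv0$. * As $t\to0$, $\Lambda(\cdot,\cdot,t)\to\Lambda_1(x)+\Lambda_2(y)$ and $\Omega(\cdot,\cdot,t)\to0$ in every $C^k$ norm on the torus. In particular there are real-analytic Riemannian metrics on the $2$-torus, arbitrarily close to Liouville metrics but not Liouville, and non-zero analytic magnetic fields, whose magnetic geodesic flow on $\{H=\frac12\}$ has a first integral quadratic in momenta. -/

import Mathlib

open scoped Matrix ContDiff Topology

noncomputable section

/-- The coordinate plane, the universal cover of the torus `ℝ² / ℤ²`. Functions on the torus are
the functions on the plane that are 1-periodic in both variables. -/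
abbrev Plane := Fin 2 → ℝ

/-- Points `(x, p)` of the cotangent bundle of the plane. -/
abbrev Phase := Plane × Plane

/-- Values `U = (Λ, u₀, f, g)` of the unknowns of the quasi-linear system. -/
abbrev State := Fin 4 → ℝ

/-- 1-periodic in `x` and in `y`. -/
def DoublyPeriodic {E : Type*} (u : Plane → E) : Prop :=
  ∀ (q : Plane) (i : Fin 2), u (q + Pi.single i 1) = u q

/-- Partial derivative with respect to the `i`-th coordinate. -/
def pd {n : ℕ} {E : Type*} [NormedAddCommGroup E] [NormedSpace ℝ E] (i : Fin n)
    (u : (Fin n → ℝ) → E) (q : Fin n → ℝ) : E :=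
  fderiv ℝ u q (Pi.single i 1)

/-- Jacobian matrix. -/
def jac {n : ℕ} (r : (Fin n → ℝ) → (Fin n → ℝ)) (q : Fin n → ℝ) : Matrix (Fin n) (Fin n) ℝ :=
  Matrix.of fun i j => pd j r q i

/-! ### Metrics, magnetic geodesic flows and their integrals -/

/-- A real-analytic Riemannian metric on the torus, `G q` being the matrix `(g_ij)` at `q`. -/
def IsAnalyticTorusMetric (G : Plane → Matrix (Fin 2) (Fin 2) ℝ) : Prop :=
  (∀ i j, AnalyticOnNhd ℝ (fun q => G q i j) Set.univ) ∧ DoublyPeriodic G ∧ ∀ q, (G q).PosDef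

/-- The metric `Λ (dx² + dy²)`. -/
def conformalMetric (L : Plane → ℝ) (q : Plane) : Matrix (Fin 2) (Fin 2) ℝ :=
  L q • (1 : Matrix (Fin 2) (Fin 2) ℝ)

/-- In some global coordinates `(u, v)` the metric is `(h₁(u) + h₂(v)) (du² + dv²)`. The
coordinates are those of the universal cover; they are not required to be adapted to the lattice
`ℤ²`. -/
def IsLiouvilleMetric (G : Plane → Matrix (Fin 2) (Fin 2) ℝ) : Prop :=
  ∃ (ψ : Plane ≃ Plane) (h₁ h₂ : ℝ → ℝ), ContDiff ℝ ∞ ψ ∧ ContDiff ℝ ∞ ψ.symm ∧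
    ∀ w : Plane, (jac ψ w)ᵀ * G (ψ w) * jac ψ w =
      (h₁ (w 0) + h₂ (w 1)) • (1 : Matrix (Fin 2) (Fin 2) ℝ)

/-- `H = ½ g^{ij} p_i p_j`. -/
def hamiltonian (G : Plane → Matrix (Fin 2) (Fin 2) ℝ) (z : Phase) : ℝ :=
  (1 / 2) * (z.2 ⬝ᵥ ((G z.1)⁻¹ *ᵥ z.2))

/-- `∂F/∂xⁱ` on phase space. -/
def dpos (i : Fin 2) (F : Phase → ℝ) (z : Phase) : ℝ := fderiv ℝ F z (Pi.single i 1, 0)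

/-- `∂F/∂p_i` on phase space. -/
def dmom (i : Fin 2) (F : Phase → ℝ) (z : Phase) : ℝ := fderiv ℝ F z (0, Pi.single i 1)

/-- The Poisson bracket twisted by the magnetic form `Ω dx ∧ dy`. -/
def magBracket (Om : Plane → ℝ) (F H : Phase → ℝ) (z : Phase) : ℝ :=
  (∑ i : Fin 2, (dpos i F z * dmom i H z - dmom i F z * dpos i H z))
    + Om z.1 * (dmom 0 F z * dmom 1 H z - dmom 1 F z * dmom 0 H z)

/-- `F` is constant along the magnetic geodesic flow on the energy level `{H = ½}`. -/
def IsConservedOnLevel (G : Plane → Matrix (Fin 2) (Fin 2) ℝ) (Om : Plane → ℝ)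
    (F : Phase → ℝ) : Prop :=
  ∀ z : Phase, hamiltonian G z = 1 / 2 → magBracket Om F (hamiltonian G) z = 0

/-- `F` and `H` are functionally independent almost everywhere on `{H = ½}`; this three-dimensional
manifold is parametrized by the base point `w.1` and the angle `w.2` of the momentum. -/
def IsIndependentOnLevel (G : Plane → Matrix (Fin 2) (Fin 2) ℝ) (F : Phase → ℝ) : Prop :=
  ∀ᵐ w : Plane × ℝ, ∀ r : ℝ, 0 < r →
    hamiltonian G (w.1, r • ![Real.cos w.2, Real.sin w.2]) = 1 / 2 →
    LinearIndependent ℝ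
      ![fderiv ℝ (hamiltonian G) (w.1, r • ![Real.cos w.2, Real.sin w.2]),
        fderiv ℝ F (w.1, r • ![Real.cos w.2, Real.sin w.2])]

/-- `F` is a polynomial of degree two in the momenta, with real-analytic coefficients on the torus.
The last condition says that the degree remains two on `{H = ½}`: the quadratic part is not a
multiple of `H`. -/
def IsQuadraticInMomenta (G : Plane → Matrix (Fin 2) (Fin 2) ℝ) (F : Phase → ℝ) : Prop :=
  ∃ (a : Plane → Matrix (Fin 2) (Fin 2) ℝ) (b : Plane → Plane) (c : Plane → ℝ),
    (∀ i j, AnalyticOnNhd ℝ (fun q => a q i j) Set.univ) ∧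
    AnalyticOnNhd ℝ b Set.univ ∧ AnalyticOnNhd ℝ c Set.univ ∧
    DoublyPeriodic a ∧ DoublyPeriodic b ∧ DoublyPeriodic c ∧
    (∀ q, (a q).IsSymm) ∧
    (∀ z : Phase, F z = z.2 ⬝ᵥ (a z.1 *ᵥ z.2) + b z.1 ⬝ᵥ z.2 + c z.1) ∧
    ∃ q, ∀ s : ℝ, a q ≠ s • (G q)⁻¹

/-- `F` is a first integral, quadratic in momenta, of the magnetic geodesic flow on `{H = ½}`. -/
def IsQuadraticIntegralOnLevel (G : Plane → Matrix (Fin 2) (Fin 2) ℝ) (Om : Plane → ℝ)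
    (F : Phase → ℝ) : Prop :=
  IsQuadraticInMomenta G F ∧ IsConservedOnLevel G Om F ∧ IsIndependentOnLevel G F

/-- `u` and `v` are `δ`-close in the `C^k` norm. -/
def CkClose (k : ℕ) (δ : ℝ) (u v : Plane → ℝ) : Prop :=
  ∀ j ≤ k, ∀ q, ‖iteratedFDeriv ℝ j (fun q' => u q' - v q') q‖ ≤ δ

/-! ### Quasi-linear systems `A(U) U_x + B(U) U_y = 0` -/

section Quasilinear

variable {n : ℕ}

/-- `U` is a solution of `A(U) U_x + B(U) U_y = 0` on the plane. -/
def SolvesSystem (A B : (Fin n → ℝ) → Matrix (Fin n) (Fin n) ℝ) (U : Plane → Fin n → ℝ) : Prop :=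
  ∀ q, A (U q) *ᵥ pd 0 U q + B (U q) *ᵥ pd 1 U q = 0

/-- Strict hyperbolicity at the value `U`: the matrix `A⁻¹ B` makes sense and has `n` distinct real
eigenvalues. -/
def IsStrictlyHyperbolicAt (A B : (Fin n → ℝ) → Matrix (Fin n) (Fin n) ℝ) (U : Fin n → ℝ) : Prop :=
  (A U).det ≠ 0 ∧ ∃ lam : Fin n → ℝ, Function.Injective lam ∧
    ∀ i, (B U - lam i • A U).det = 0

/-- Near `U₀` there are functions `r₁, …, r_n` of `U`, forming a coordinate system, in which
the system reads `(r_j)_x + λ_j (r_j)_y = 0` with distinct real `λ_j`. -/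
def HasRiemannInvariantsNear (A B : (Fin n → ℝ) → Matrix (Fin n) (Fin n) ℝ)
    (U₀ : Fin n → ℝ) : Prop :=
  ∃ N : Set (Fin n → ℝ), IsOpen N ∧ U₀ ∈ N ∧
    ∃ (r : (Fin n → ℝ) → Fin n → ℝ) (lam : (Fin n → ℝ) → Fin n → ℝ), ContDiffOn ℝ ∞ r N ∧
      ∀ U ∈ N, (A U).det ≠ 0 ∧ (jac r U).det ≠ 0 ∧ Function.Injective (lam U) ∧
        jac r U * ((A U)⁻¹ * B U) = Matrix.diagonal (lam U) * jac r U

/-- Near `U₀` there are functions `Q₁, …, Q_n` of `U`, forming a coordinate system, and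
`R₁, …, R_n` such that the system reads `(Q_j)_x + (R_j)_y = 0`. -/
def HasConservationFormNear (A B : (Fin n → ℝ) → Matrix (Fin n) (Fin n) ℝ)
    (U₀ : Fin n → ℝ) : Prop :=
  ∃ N : Set (Fin n → ℝ), IsOpen N ∧ U₀ ∈ N ∧
    ∃ (Q R : (Fin n → ℝ) → Fin n → ℝ), ContDiffOn ℝ ∞ Q N ∧ ContDiffOn ℝ ∞ R N ∧
      ∀ U ∈ N, (A U).det ≠ 0 ∧ (jac Q U).det ≠ 0 ∧
        jac R U = jac Q U * ((A U)⁻¹ * B U)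

/-- Semi-Hamiltonian (rich): in the hyperbolic region the system can be written both in Riemann
invariants and in the form of conservation laws. -/
def IsSemiHamiltonian (A B : (Fin n → ℝ) → Matrix (Fin n) (Fin n) ℝ) : Prop :=
  ∀ U, IsStrictlyHyperbolicAt A B U →
    HasRiemannInvariantsNear A B U ∧ HasConservationFormNear A B U

/-- Linear degeneracy: in the hyperbolic region every eigenvalue `λ` of `A⁻¹ B` is stationary in the
direction of its own eigenvectors (in Riemann invariants, `∂λ_i/∂r_i = 0`). -/
def IsLinearlyDegenerate (A B : (Fin n → ℝ) → Matrix (Fin n) (Fin n) ℝ) : Prop :=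
  ∀ U, IsStrictlyHyperbolicAt A B U →
    ∀ lam : (Fin n → ℝ) → ℝ, ContDiffAt ℝ ∞ lam U →
      (∀ᶠ W in 𝓝 U, (B W - lam W • A W).det = 0) →
      ∀ v : Fin n → ℝ, B U *ᵥ v = lam U • (A U *ᵥ v) → fderiv ℝ lam U v = 0

end Quasilinear

/-! ### The system of the problem, with `U = (Λ, u₀, f, g)` -/

/-- The matrix `A(U)`. -/
def magA (U : State) : Matrix (Fin 4) (Fin 4) ℝ :=
  !![0, 0, 1, 0;
     U 2, 0, U 0, 0;
     2, 1, 0, U 3 / 2;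
     0, 0, 0, -(U 2 / 2)]

/-- The matrix `B(U)`. -/
def magB (U : State) : Matrix (Fin 4) (Fin 4) ℝ :=
  !![0, 0, 0, 1;
     -U 3, 0, 0, -U 0;
     0, 0, -(U 3 / 2), 0;
     2, -1, U 2 / 2, 0]

/-- The matrix `A₁(U)` of the symmetry `U_t = A₁(U) U_x + B₁(U) U_y`. -/
def symA (U : State) : Matrix (Fin 4) (Fin 4) ℝ :=
  !![U 3, 0, 0, U 0;
     -(2 * U 3), U 3, 0, -(2 * U 0);
     0, 0, 0, 0;
     0, -2, 0, 0]

/-- The matrix `B₁(U)` of the symmetry. -/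
def symB (U : State) : Matrix (Fin 4) (Fin 4) ℝ :=
  !![U 2, 0, U 0, 0;
     2 * U 2, U 2, 2 * U 0, 0;
     0, 2, 0, 0;
     0, 0, 0, 0]

/-- The conformal factor `Λ` of the metric given by `U`. -/
def confFactor (U : Plane → State) (q : Plane) : ℝ := U q 0

/-- The magnetic field `Ω = ¼ (g_x - f_y)`. -/
def magField (U : Plane → State) (q : Plane) : ℝ :=
  (1 / 4) * (pd 0 (fun q' => U q' 3) q - pd 1 (fun q' => U q' 2) q)

/-- `F = 2 (p₁² - p₂²) + 2 f p₁ - 2 g p₂ + u₀`. On `{H = ½}`, where `p = √Λ (cos φ, sin φ)`,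
this is `∑ a_k exp (i k φ)` with `a_{-k} = conj a_k`, `a₂ = Λ`, `a₁ = √Λ (f + i g)`,
`a₀ = u₀`. -/
def magIntegral (U : Plane → State) (z : Phase) : ℝ :=
  2 * (z.2 0 ^ 2 - z.2 1 ^ 2) + 2 * U z.1 2 * z.2 0 - 2 * U z.1 3 * z.2 1 + U z.1 1

/-- The state of the Liouville metric `(Λ₁(x) + Λ₂(y)) (dx² + dy²)` without magnetic field. -/
def liouvilleState (L₁ L₂ : ℝ → ℝ) (q : Plane) : State :=
  ![L₁ (q 0) + L₂ (q 1), 2 * L₂ (q 1) - 2 * L₁ (q 0), 0, 0]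

/-- `U` is a real-analytic solution of `U_t = A₁(U) U_x + B₁(U) U_y` for `|t| < ε`, defined on the
whole plane, with initial value `U₀`. -/
def IsSymmetryFlow (ε : ℝ) (U₀ : Plane → State) (U : ℝ → Plane → State) : Prop :=
  AnalyticOnNhd ℝ (fun z : ℝ × Plane => U z.1 z.2) {z | |z.1| < ε} ∧
  U 0 = U₀ ∧
  ∀ t, |t| < ε → ∀ q, deriv (fun s => U s q) t =
    symA (U t q) *ᵥ pd 0 (U t) q + symB (U t q) *ᵥ pd 1 (U t) q

end

/-!
On the circle `p = √Λ (cos φ, sin φ)` the bracket `{F, H}` is a trigonometric polynomial in `φ`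
whose coefficients are combinations of the four equations, which gives the correspondence between
solutions and integrals. On that circle `F` becomes a function of the state and `φ`; its critical
values in `φ` are Riemann invariants, and the eigenvalues of the system are the slopes `tan φ` at
the critical points.

The evolution system is quadratic, `U_t = B(U, DU) + L(DU)`. The analytic periodic initial value
satisfies Cauchy estimates uniformly on the plane, so the method of majorants bounds the Taylor
coefficients in `t` uniformly in space and sums them for `|t| < ε`, together with all derivatives.
Along the evolution the left-hand sides of the quasi-linear system satisfy a linear homogeneous
evolution equation, and they vanish at `t = 0`; all their Taylor coefficients in `t` then vanish.

At a Liouville metric `(g_x - f_y)_t = 4 (L₁'' - L₂'')` and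
`Λ_{xytt} = 4 (L₁''' L₂' + L₁' L₂''')`, and by separation of variables and periodicity neither
vanishes identically. On the other hand, isothermal coordinates on the whole plane are affine images
of each other, because an injective entire function is affine; hence the conformal factor of a
Liouville metric satisfies a homogeneous second-order equation with constant coefficients. Together
with periodicity this forces `Λ_{xy} = 0`, or else a zero of `Λ_{xx}` on every vertical line, which
is impossible close to a Liouville metric with `L₁'' ≠ 0` on one of these lines.
-/

/-! ### The Cauchy–Kovalevskaya theorem -/

section Majorant

open Finset.HasAntidiagonal

lemma sum_antidiagonal_inv_sq_le (N : ℕ) :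
    ∑ x ∈ antidiagonal N, (((x.1 : ℝ) + 1) ^ 2)⁻¹ ≤ 2 := by
  have h := sum_Ioo_inv_sq_le (α := ℝ) 0 (N + 2)
  rw [show Finset.Ioo 0 (N + 2) = Finset.Ico 1 (N + 2) from rfl, Finset.sum_Ico_eq_sum_range] at h
  rw [Finset.Nat.sum_antidiagonal_eq_sum_range_succ_mk]
  refine le_of_eq_of_le (Finset.sum_congr rfl fun i _ => ?_) (h.trans_eq (by norm_num))
  push_cast
  ring

lemma sum_antidiagonal_inv_sq_snd_le (N : ℕ) :
    ∑ x ∈ antidiagonal N, (((x.2 : ℝ) + 1) ^ 2)⁻¹ ≤ 2 := by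
  rw [← Finset.Nat.sum_antidiagonal_swap]
  exact sum_antidiagonal_inv_sq_le N

lemma div_mul_sq_le_inv_add {a b : ℝ} (ha : 0 ≤ a) (hb : 0 ≤ b) :
    (b + 1) / ((a + 1) ^ 2 * (b + 2) ^ 2) ≤
      (a + b + 3)⁻¹ * (3 / 2 * ((a + 1) ^ 2)⁻¹ + 1 / 2 * ((b + 1) ^ 2)⁻¹) := by
  have partialFractions : (b + 2) / ((a + 1) ^ 2 * (b + 2) ^ 2) =
      (a + b + 3)⁻¹ * (((a + 1) ^ 2)⁻¹ + (a + 1)⁻¹ * (b + 2)⁻¹) := by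
    field_simp; ring
  have amgm : (a + 1)⁻¹ * (b + 2)⁻¹ ≤ 1 / 2 * ((a + 1) ^ 2)⁻¹ + 1 / 2 * ((b + 1) ^ 2)⁻¹ := by
    have h : (b + 2)⁻¹ ≤ (b + 1)⁻¹ := by gcongr; norm_num
    have := mul_le_mul_of_nonneg_left h (show 0 ≤ (a + 1)⁻¹ by positivity)
    rw [← inv_pow, ← inv_pow]
    linarith [two_mul_le_add_sq (a + 1)⁻¹ (b + 1)⁻¹]
  calc (b + 1) / ((a + 1) ^ 2 * (b + 2) ^ 2)
      ≤ (b + 2) / ((a + 1) ^ 2 * (b + 2) ^ 2) := by gcongr; norm_num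
    _ = (a + b + 3)⁻¹ * (((a + 1) ^ 2)⁻¹ + (a + 1)⁻¹ * (b + 2)⁻¹) := partialFractions
    _ ≤ _ := by
        refine mul_le_mul_of_nonneg_left ?_ (by positivity)
        linarith

lemma sum_antidiagonal_div_mul_sq_le (N : ℕ) :
    ∑ x ∈ antidiagonal N, ((x.2 : ℝ) + 1) / (((x.1 : ℝ) + 1) ^ 2 * ((x.2 : ℝ) + 2) ^ 2) ≤
      6 * (((N : ℝ) + 1) / ((N : ℝ) + 2) ^ 2) := by
  calc ∑ x ∈ antidiagonal N, ((x.2 : ℝ) + 1) / (((x.1 : ℝ) + 1) ^ 2 * ((x.2 : ℝ) + 2) ^ 2)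
      ≤ ∑ x ∈ antidiagonal N, ((N : ℝ) + 3)⁻¹ *
          (3 / 2 * (((x.1 : ℝ) + 1) ^ 2)⁻¹ + 1 / 2 * (((x.2 : ℝ) + 1) ^ 2)⁻¹) := by
        refine Finset.sum_le_sum fun x hx => ?_
        rw [← mem_antidiagonal.1 hx, Nat.cast_add]
        exact div_mul_sq_le_inv_add x.1.cast_nonneg x.2.cast_nonneg
    _ = ((N : ℝ) + 3)⁻¹ * (3 / 2 * ∑ x ∈ antidiagonal N, (((x.1 : ℝ) + 1) ^ 2)⁻¹ +
          1 / 2 * ∑ x ∈ antidiagonal N, (((x.2 : ℝ) + 1) ^ 2)⁻¹) := by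
        rw [← Finset.mul_sum, Finset.sum_add_distrib, ← Finset.mul_sum, ← Finset.mul_sum]
    _ ≤ ((N : ℝ) + 3)⁻¹ * (3 / 2 * 2 + 1 / 2 * 2) := by
        gcongr
        · exact sum_antidiagonal_inv_sq_le N
        · exact sum_antidiagonal_inv_sq_snd_le N
    _ ≤ 6 * (((N : ℝ) + 1) / ((N : ℝ) + 2) ^ 2) := by
        rw [inv_mul_eq_div, mul_div_assoc', div_le_div_iff₀ (by positivity) (by positivity)]
        nlinarith [(N.cast_nonneg : (0 : ℝ) ≤ N)]

-- By Vandermonde each pair on the antidiagonal of `n + k` is counted at most `choose (n + k) k`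
-- times.
lemma sum_antidiagonal_choose_mul_le (n k : ℕ) {w : ℕ × ℕ → ℝ} (hw : ∀ z, 0 ≤ w z) :
    ∑ x ∈ antidiagonal n, ∑ y ∈ antidiagonal k,
      ((x + y).1.choose y.1 : ℝ) * ((x + y).2.choose y.2 : ℝ) * w (x + y) ≤
    ((n + k).choose k : ℝ) * ∑ z ∈ antidiagonal (n + k), w z := by
  have vandermonde : ∀ z ∈ antidiagonal (n + k), ((n + k).choose k : ℝ) * w z =
      ∑ y ∈ antidiagonal k, (z.1.choose y.1 : ℝ) * (z.2.choose y.2 : ℝ) * w z := by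
    intro z hz
    rw [← Finset.sum_mul, ← mem_antidiagonal.1 hz, Nat.add_choose_eq]
    push_cast
    rfl
  rw [Finset.sum_comm, Finset.mul_sum, Finset.sum_congr rfl vandermonde,
    Finset.sum_comm (s := antidiagonal (n + k))]
  refine Finset.sum_le_sum fun y hy => ?_
  rw [← Finset.sum_image (s := antidiagonal n) (g := (· + y))
    (f := fun z => (z.1.choose y.1 : ℝ) * (z.2.choose y.2 : ℝ) * w z)
    (add_left_injective y).injOn]
  refine Finset.sum_le_sum_of_subset_of_nonneg ?_ fun z _ _ => by have := hw z; positivity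
  rintro _ hz
  obtain ⟨x, hx, rfl⟩ := Finset.mem_image.1 hz
  rw [mem_antidiagonal] at hx hy ⊢
  simp only [Prod.fst_add, Prod.snd_add]
  omega

/-- The coefficient of `tⁿ xᵏ` in the majorant series `C ∑ₘ (R x + T t)ᵐ / (m + 1)²` of the
method of majorants; the weights `(m + 1)⁻²` make it almost closed under multiplication. -/
noncomputable def ckMajorant (C R T : ℝ) (n k : ℕ) : ℝ :=
  C * R ^ k * T ^ n * ((n + k).choose k : ℝ) / ((n + k : ℕ) + 1 : ℝ) ^ 2

variable {C R T : ℝ}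

lemma ckMajorant_nonneg (hC : 0 ≤ C) (hR : 0 ≤ R) (hT : 0 ≤ T) (n k : ℕ) :
    0 ≤ ckMajorant C R T n k := by
  unfold ckMajorant; positivity

lemma succ_mul_ckMajorant_succ_right (C R T : ℝ) (n k : ℕ) :
    ((k : ℝ) + 1) * ckMajorant C R T n (k + 1) =
      C * R ^ (k + 1) * T ^ n * (((n + k).choose k : ℝ) *
        (((n + k : ℕ) + 1 : ℝ) / ((n + k : ℕ) + 2 : ℝ) ^ 2)) := by
  have h : ((n + k + 1).choose (k + 1) : ℝ) * ((k : ℝ) + 1) =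
      ((n + k : ℕ) + 1 : ℝ) * ((n + k).choose k : ℝ) := by
    exact_mod_cast (Nat.add_one_mul_choose_eq (n + k) k).symm
  calc ((k : ℝ) + 1) * ckMajorant C R T n (k + 1)
      = C * R ^ (k + 1) * T ^ n * (((n + k + 1).choose (k + 1) : ℝ) * ((k : ℝ) + 1)) /
          ((n + k : ℕ) + 2 : ℝ) ^ 2 := by unfold ckMajorant; rw [← add_assoc]; push_cast; ring
    _ = _ := by rw [h]; ring

lemma succ_mul_ckMajorant_succ_left (C R T : ℝ) (n k : ℕ) :
    ((n : ℝ) + 1) * ckMajorant C R T (n + 1) k =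
      C * R ^ k * T ^ (n + 1) * (((n + k).choose k : ℝ) *
        (((n + k : ℕ) + 1 : ℝ) / ((n + k : ℕ) + 2 : ℝ) ^ 2)) := by
  have h : ((n + 1 + k).choose k : ℝ) * ((n : ℝ) + 1) =
      ((n + k : ℕ) + 1 : ℝ) * ((n + k).choose k : ℝ) := by
    have := Nat.add_one_mul_choose_eq (n + k) n
    rw [Nat.choose_symm_add, Nat.choose_symm_of_eq_add (show n + k + 1 = (n + 1) + k by ring),
      add_right_comm] at this
    replace this := congrArg (Nat.cast (R := ℝ)) this
    push_cast at this ⊢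
    linarith
  calc ((n : ℝ) + 1) * ckMajorant C R T (n + 1) k
      = C * R ^ k * T ^ (n + 1) * (((n + 1 + k).choose k : ℝ) * ((n : ℝ) + 1)) /
          ((n + k : ℕ) + 2 : ℝ) ^ 2 := by unfold ckMajorant; push_cast; ring
    _ = _ := by rw [h]; ring

lemma mul_succ_mul_ckMajorant_comm (C R T : ℝ) (n k : ℕ) :
    R * (((n : ℝ) + 1) * ckMajorant C R T (n + 1) k) =
      T * (((k : ℝ) + 1) * ckMajorant C R T n (k + 1)) := by
  rw [succ_mul_ckMajorant_succ_left, succ_mul_ckMajorant_succ_right]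
  ring

lemma sum_antidiagonal_ckMajorant_mul_le (hR : 0 ≤ R) (hT : 0 ≤ T) (n k : ℕ) :
    ∑ x ∈ antidiagonal n, ∑ y ∈ antidiagonal k, ckMajorant C R T x.1 y.1 *
        (((y.2 : ℝ) + 1) * ckMajorant C R T x.2 (y.2 + 1)) ≤
      6 * C * (((k : ℝ) + 1) * ckMajorant C R T n (k + 1)) := by
  set w : ℕ × ℕ → ℝ := fun z =>
    ((z.2 : ℝ) + 1) / (((z.1 : ℝ) + 1) ^ 2 * ((z.2 : ℝ) + 2) ^ 2) with hw
  have hterm : ∀ x ∈ antidiagonal n, ∀ y ∈ antidiagonal k,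
      ckMajorant C R T x.1 y.1 * (((y.2 : ℝ) + 1) * ckMajorant C R T x.2 (y.2 + 1)) =
        C ^ 2 * R ^ (k + 1) * T ^ n *
          (((x + y).1.choose y.1 : ℝ) * ((x + y).2.choose y.2 : ℝ) * w (x + y)) := by
    intro x hx y hy
    rw [succ_mul_ckMajorant_succ_right, ckMajorant, ← mem_antidiagonal.1 hx,
      ← mem_antidiagonal.1 hy]
    simp only [hw, Prod.fst_add, Prod.snd_add]
    have h₁ : ((x.1 + y.1 : ℕ) : ℝ) + 1 ≠ 0 := by positivity
    have h₂ : ((x.2 + y.2 : ℕ) : ℝ) + 2 ≠ 0 := by positivity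
    field_simp
    ring
  rw [Finset.sum_congr rfl fun x hx => Finset.sum_congr rfl fun y hy => hterm x hx y hy]
  simp only [← Finset.mul_sum]
  calc C ^ 2 * R ^ (k + 1) * T ^ n * ∑ x ∈ antidiagonal n, ∑ y ∈ antidiagonal k,
          ((x + y).1.choose y.1 : ℝ) * ((x + y).2.choose y.2 : ℝ) * w (x + y)
      ≤ C ^ 2 * R ^ (k + 1) * T ^ n *
          (((n + k).choose k : ℝ) * ∑ z ∈ antidiagonal (n + k), w z) := by
        gcongr
        exact sum_antidiagonal_choose_mul_le n k fun z => by positivity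
    _ ≤ C ^ 2 * R ^ (k + 1) * T ^ n * (((n + k).choose k : ℝ) *
          (6 * (((n + k : ℕ) + 1 : ℝ) / ((n + k : ℕ) + 2 : ℝ) ^ 2))) := by
        gcongr
        exact sum_antidiagonal_div_mul_sq_le (n + k)
    _ = _ := by rw [succ_mul_ckMajorant_succ_right]; ring

lemma le_ckMajorant_of_recursion {a : ℕ → ℕ → ℝ} {K L : ℝ} (ha : ∀ n k, 0 ≤ a n k)
    (hK : 0 ≤ K) (hL : 0 ≤ L) (hC : 0 ≤ C) (hR : 0 < R) (hT : (6 * K * C + L) * R ≤ T)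
    (hzero : ∀ k, a 0 k ≤ ckMajorant C R T 0 k)
    (hsucc : ∀ n k : ℕ, ((n : ℝ) + 1) * a (n + 1) k ≤
      K * ∑ x ∈ antidiagonal n, ∑ y ∈ antidiagonal k,
        a x.1 y.1 * (((y.2 : ℝ) + 1) * a x.2 (y.2 + 1)) + L * (((k : ℝ) + 1) * a n (k + 1)))
    (n k : ℕ) : a n k ≤ ckMajorant C R T n k := by
  have hT0 : 0 ≤ T := le_trans (by positivity) hT
  induction n using Nat.strong_induction_on generalizing k with
  | _ n ih =>
  rcases n with _ | n
  · exact hzero k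
  set m : ℝ := ((k : ℝ) + 1) * ckMajorant C R T n (k + 1)
  have hm : 0 ≤ m := mul_nonneg (by positivity) (ckMajorant_nonneg hC hR.le hT0 _ _)
  have hsum : ∑ x ∈ antidiagonal n, ∑ y ∈ antidiagonal k,
      a x.1 y.1 * (((y.2 : ℝ) + 1) * a x.2 (y.2 + 1)) ≤ 6 * C * m := by
    refine le_trans (Finset.sum_le_sum fun x hx => Finset.sum_le_sum fun y _ => ?_)
      (sum_antidiagonal_ckMajorant_mul_le hR.le hT0 n k)
    have := mem_antidiagonal.1 hx
    exact mul_le_mul (ih _ (by omega) _)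
      (mul_le_mul_of_nonneg_left (ih _ (by omega) _) (by positivity))
      (mul_nonneg (by positivity) (ha _ _)) (ckMajorant_nonneg hC hR.le hT0 _ _)
  have hrec : ((n : ℝ) + 1) * a (n + 1) k ≤ K * (6 * C * m) + L * m := by
    refine (hsucc n k).trans ?_
    gcongr
    exact mul_le_mul_of_nonneg_left (ih n n.lt_succ_self (k + 1)) (by positivity)
  refine le_of_mul_le_mul_left (le_of_mul_le_mul_left ?_ hR) (by positivity : (0 : ℝ) < n + 1)
  calc R * (((n : ℝ) + 1) * a (n + 1) k) ≤ R * (K * (6 * C * m) + L * m) := by gcongr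
    _ = (6 * K * C + L) * R * m := by ring
    _ ≤ T * m := by gcongr
    _ = R * (((n : ℝ) + 1) * ckMajorant C R T (n + 1) k) :=
        (mul_succ_mul_ckMajorant_comm C R T n k).symm

lemma ckMajorant_le (hC : 0 ≤ C) (hR : 0 ≤ R) (hT : 0 ≤ T) (n k : ℕ) :
    ckMajorant C R T n k ≤ C * (2 * T) ^ n * (2 * R) ^ k := by
  have hchoose : ((n + k).choose k : ℝ) ≤ 2 ^ (n + k) := by
    exact_mod_cast Nat.choose_le_two_pow _ _
  calc ckMajorant C R T n k ≤ C * R ^ k * T ^ n * ((n + k).choose k : ℝ) :=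
        div_le_self (by positivity) (one_le_pow₀ (le_add_of_nonneg_left (Nat.cast_nonneg _)))
    _ ≤ C * R ^ k * T ^ n * 2 ^ (n + k) := by gcongr
    _ = C * (2 * T) ^ n * (2 * R) ^ k := by rw [mul_pow, mul_pow, pow_add]; ring

lemma mul_pow_le_ckMajorant_zero {A : ℝ} (hC : 0 ≤ C) (hA : 0 ≤ A) (hR : 4 * A ≤ R) (k : ℕ) :
    C * A ^ k ≤ ckMajorant C R T 0 k := by
  have hk : ((k : ℝ) + 1) ≤ 2 ^ k := by exact_mod_cast (Nat.lt_two_pow_self : k < 2 ^ k)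
  rw [ckMajorant, zero_add, Nat.choose_self, pow_zero, le_div_iff₀ (by positivity)]
  calc C * A ^ k * ((k : ℝ) + 1) ^ 2 ≤ C * A ^ k * (2 ^ k) ^ 2 := by gcongr
    _ = C * (4 * A) ^ k := by rw [← pow_mul, mul_comm k, pow_mul, mul_pow]; norm_num; ring
    _ ≤ C * R ^ k := by gcongr
    _ = C * R ^ k * 1 * (1 : ℕ) := by simp

end Majorant

section TaylorNorm

open Finset.HasAntidiagonal

variable {P E F G : Type*} [NormedAddCommGroup P] [NormedSpace ℝ P] [NormedAddCommGroup E]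
  [NormedSpace ℝ E] [NormedAddCommGroup F] [NormedSpace ℝ F] [NormedAddCommGroup G]
  [NormedSpace ℝ G]

/-- The norm of the `k`-th homogeneous Taylor polynomial of `f` at `q`, as a multilinear map. -/
noncomputable def taylorNorm (f : P → E) (k : ℕ) (q : P) : ℝ :=
  ‖iteratedFDeriv ℝ k f q‖ / k.factorial

lemma taylorNorm_nonneg (f : P → E) (k : ℕ) (q : P) : 0 ≤ taylorNorm f k q := by
  unfold taylorNorm; positivity

lemma taylorNorm_le_iff {f : P → E} {k : ℕ} {q : P} {a : ℝ} :
    taylorNorm f k q ≤ a ↔ ‖iteratedFDeriv ℝ k f q‖ ≤ a * k.factorial :=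
  div_le_iff₀ (by positivity)

lemma taylorNorm_fderiv (f : P → E) (k : ℕ) (q : P) :
    taylorNorm (fderiv ℝ f) k q = ((k : ℝ) + 1) * taylorNorm f (k + 1) q := by
  rw [taylorNorm, taylorNorm, norm_iteratedFDeriv_fderiv, Nat.factorial_succ]
  push_cast
  field_simp

lemma taylorNorm_const_smul {f : P → E} (hf : ContDiff ℝ ∞ f) {c : ℝ} (hc : 0 ≤ c) (k : ℕ)
    (q : P) : taylorNorm (fun q => c • f q) k q = c * taylorNorm f k q := by
  have : iteratedFDeriv ℝ k (fun q => c • f q) q = c • iteratedFDeriv ℝ k f q :=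
    iteratedFDeriv_const_smul_apply (hf.of_le (by exact_mod_cast le_top)).contDiffAt
  rw [taylorNorm, this, norm_smul, Real.norm_of_nonneg hc, mul_div_assoc, taylorNorm]

lemma taylorNorm_add_le {f g : P → E} (hf : ContDiff ℝ ∞ f) (hg : ContDiff ℝ ∞ g) (k : ℕ) (q : P) :
    taylorNorm (fun q => f q + g q) k q ≤ taylorNorm f k q + taylorNorm g k q := by
  have hk : (k : WithTop ℕ∞) ≤ ∞ := by exact_mod_cast le_top
  have : iteratedFDeriv ℝ k (fun q => f q + g q) q =
      iteratedFDeriv ℝ k f q + iteratedFDeriv ℝ k g q :=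
    iteratedFDeriv_add_apply (hf.of_le hk).contDiffAt (hg.of_le hk).contDiffAt
  rw [taylorNorm, this, taylorNorm, taylorNorm, ← add_div]
  gcongr
  exact norm_add_le _ _

lemma taylorNorm_sum_le {ι : Type*} (s : Finset ι) {f : ι → P → E}
    (hf : ∀ i, ContDiff ℝ ∞ (f i)) (k : ℕ) (q : P) :
    taylorNorm (fun q => ∑ i ∈ s, f i q) k q ≤ ∑ i ∈ s, taylorNorm (f i) k q := by
  have : iteratedFDeriv ℝ k (fun q => ∑ i ∈ s, f i q) q = ∑ i ∈ s, iteratedFDeriv ℝ k (f i) q := by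
    rw [← iteratedFDeriv_sum_apply fun i _ =>
      ((hf i).of_le (by exact_mod_cast le_top)).contDiffAt]
    congr 1
    exact (Finset.sum_fn s f).symm
  simp only [taylorNorm, this, ← Finset.sum_div]
  gcongr
  exact norm_sum_le _ _

lemma taylorNorm_clm_comp_le (L : E →L[ℝ] F) {f : P → E} (hf : ContDiff ℝ ∞ f) (k : ℕ) (q : P) :
    taylorNorm (fun q => L (f q)) k q ≤ ‖L‖ * taylorNorm f k q := by
  rw [taylorNorm, taylorNorm, ← mul_div_assoc]
  gcongr
  exact L.norm_iteratedFDeriv_comp_left hf.contDiffAt (by exact_mod_cast le_top)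

lemma taylorNorm_bilinear_le (B : E →L[ℝ] F →L[ℝ] G) {f : P → E} {g : P → F}
    (hf : ContDiff ℝ ∞ f) (hg : ContDiff ℝ ∞ g) (k : ℕ) (q : P) :
    taylorNorm (fun q => B (f q) (g q)) k q ≤
      ‖B‖ * ∑ y ∈ antidiagonal k, taylorNorm f y.1 q * taylorNorm g y.2 q := by
  rw [taylorNorm_le_iff]
  refine (B.norm_iteratedFDeriv_le_of_bilinear hf hg q (by exact_mod_cast le_top)).trans_eq ?_
  rw [mul_assoc, Finset.sum_mul, ← Finset.Nat.sum_antidiagonal_eq_sum_range_succ fun i j =>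
    (k.choose i : ℝ) * ‖iteratedFDeriv ℝ i f q‖ * ‖iteratedFDeriv ℝ j g q‖]
  congr 1
  refine Finset.sum_congr rfl fun y hy => ?_
  have hchoose : (k.choose y.1 : ℝ) * y.1.factorial * y.2.factorial = k.factorial := by
    rw [← mem_antidiagonal.1 hy]
    rw [Nat.choose_symm_add]
    exact_mod_cast Nat.add_choose_mul_factorial_mul_factorial y.1 y.2
  rw [taylorNorm, taylorNorm, ← hchoose]
  field_simp

end TaylorNorm

lemma fderiv_periodic {V F : Type*} [NormedAddCommGroup V] [NormedSpace ℝ V]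
    [NormedAddCommGroup F] [NormedSpace ℝ F] {f : V → F} {v : V} (h : Function.Periodic f v) :
    Function.Periodic (fderiv ℝ f) v := fun z => by
  rw [← fderiv_comp_add_right, funext h]

section TimeCoeff

open Finset.HasAntidiagonal

set_option maxSynthPendingDepth 3

variable {P E : Type*} [NormedAddCommGroup P] [NormedSpace ℝ P] [NormedAddCommGroup E]
  [NormedSpace ℝ E]

/-- Smooth functions with uniform Cauchy estimates on the whole space. -/
structure HasCauchyBound (C A : ℝ) (u : P → E) : Prop where
  contDiff : ContDiff ℝ ∞ u
  norm_iteratedFDeriv_le : ∀ k q, ‖iteratedFDeriv ℝ k u q‖ ≤ C * A ^ k * k.factorial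

lemma HasCauchyBound.norm_le {C A : ℝ} {u : P → E} (hu : HasCauchyBound C A u) (q : P) :
    ‖u q‖ ≤ C := by
  simpa using hu.norm_iteratedFDeriv_le 0 q

lemma HasCauchyBound.norm_fderiv_le {C A : ℝ} {u : P → E} (hu : HasCauchyBound C A u) (q : P) :
    ‖fderiv ℝ u q‖ ≤ C * A := by
  simpa [norm_iteratedFDeriv_one] using hu.norm_iteratedFDeriv_le 1 q

lemma HasCauchyBound.differentiable {C A : ℝ} {u : P → E} (hu : HasCauchyBound C A u) :
    Differentiable ℝ u :=
  hu.contDiff.differentiable (by simp)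

/-- Taylor coefficients in time of the formal solution of `U_t = B(U, DU) + L(DU)`,
`U|_{t=0} = u`. -/
noncomputable def timeCoeff (B : E →L[ℝ] (P →L[ℝ] E) →L[ℝ] E) (L : (P →L[ℝ] E) →L[ℝ] E)
    (u : P → E) : ℕ → P → E
  | 0 => u
  | n + 1 => fun q => ((n : ℝ) + 1)⁻¹ •
      (∑ i : Fin (n + 1), B (timeCoeff B L u i q) (fderiv ℝ (timeCoeff B L u (n - i)) q) +
        L (fderiv ℝ (timeCoeff B L u n) q))

variable {B : E →L[ℝ] (P →L[ℝ] E) →L[ℝ] E} {L : (P →L[ℝ] E) →L[ℝ] E} {u : P → E}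

lemma timeCoeff_zero : timeCoeff B L u 0 = u := by rw [timeCoeff]

lemma add_one_smul_timeCoeff_succ (n : ℕ) (q : P) :
    ((n : ℝ) + 1) • timeCoeff B L u (n + 1) q =
      ∑ x ∈ antidiagonal n, B (timeCoeff B L u x.1 q) (fderiv ℝ (timeCoeff B L u x.2) q) +
        L (fderiv ℝ (timeCoeff B L u n) q) := by
  rw [timeCoeff, smul_inv_smul₀ (by positivity),
    Finset.Nat.sum_antidiagonal_eq_sum_range_succ_mk, Finset.sum_range]

lemma contDiff_timeCoeff (hu : ContDiff ℝ ∞ u) (n : ℕ) : ContDiff ℝ ∞ (timeCoeff B L u n) := by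
  induction n using Nat.strong_induction_on with
  | _ n ih =>
  rcases n with _ | n
  · rwa [timeCoeff_zero]
  have hd : ∀ i ≤ n, ContDiff ℝ ∞ (fderiv ℝ (timeCoeff B L u i)) := fun i hi =>
    (ih i (by omega)).fderiv_right (by simp)
  rw [timeCoeff]
  refine ContDiff.const_smul _ (ContDiff.add (ContDiff.sum fun i _ => ?_) ?_)
  · exact B.isBoundedBilinearMap.contDiff.comp₂ (ih i (by omega)) (hd _ (by omega))
  · exact L.contDiff.comp (hd n le_rfl)

lemma taylorNorm_timeCoeff_succ_le (hu : ContDiff ℝ ∞ u) (q : P) (n k : ℕ) :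
    ((n : ℝ) + 1) * taylorNorm (timeCoeff B L u (n + 1)) k q ≤
      ‖B‖ * ∑ x ∈ antidiagonal n, ∑ y ∈ antidiagonal k, taylorNorm (timeCoeff B L u x.1) y.1 q *
        (((y.2 : ℝ) + 1) * taylorNorm (timeCoeff B L u x.2) (y.2 + 1) q) +
      ‖L‖ * (((k : ℝ) + 1) * taylorNorm (timeCoeff B L u n) (k + 1) q) := by
  have hc := contDiff_timeCoeff (B := B) (L := L) hu
  have hd : ∀ i, ContDiff ℝ ∞ (fderiv ℝ (timeCoeff B L u i)) := fun i =>
    (hc i).fderiv_right (by simp)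
  have hB : ∀ x : ℕ × ℕ, ContDiff ℝ ∞
      (fun q => B (timeCoeff B L u x.1 q) (fderiv ℝ (timeCoeff B L u x.2) q)) := fun x =>
    B.isBoundedBilinearMap.contDiff.comp₂ (hc _) (hd _)
  rw [← taylorNorm_const_smul (hc _) (by positivity)]
  simp only [add_one_smul_timeCoeff_succ, ← taylorNorm_fderiv]
  refine (taylorNorm_add_le (ContDiff.sum fun x _ => hB x) (L.contDiff.comp (hd n)) k q).trans ?_
  rw [Finset.mul_sum]
  exact add_le_add ((taylorNorm_sum_le _ hB k q).trans
    (Finset.sum_le_sum fun x _ => taylorNorm_bilinear_le B (hc _) (hd _) k q))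
    (taylorNorm_clm_comp_le L (hd n) k q)

lemma HasCauchyBound.exists_timeCoeff {C A : ℝ} (hu : HasCauchyBound C A u) (hA : 0 ≤ A) :
    ∃ M ρ : ℝ, 0 < M ∧ 0 < ρ ∧ ∀ n, HasCauchyBound (M * ρ ^ n) ρ (timeCoeff B L u n) := by
  have hC : 0 ≤ C := (norm_nonneg _).trans (hu.norm_le 0)
  set R : ℝ := 4 * A + 1
  set T : ℝ := (6 * ‖B‖ * C + ‖L‖) * R + R
  have hR : 0 < R := by positivity
  have hRT : R ≤ T := le_add_of_nonneg_left (by positivity)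
  have hzero : ∀ q k, taylorNorm (timeCoeff B L u 0) k q ≤ ckMajorant C R T 0 k := fun q k => by
    refine le_trans ?_ (mul_pow_le_ckMajorant_zero (T := T) hC hA (by linarith : 4 * A ≤ R) k)
    rw [timeCoeff_zero, taylorNorm_le_iff]
    exact hu.norm_iteratedFDeriv_le k q
  refine ⟨C + 1, 2 * T, by positivity, by positivity, fun n =>
    ⟨contDiff_timeCoeff hu.contDiff n, fun k q => taylorNorm_le_iff.1 ?_⟩⟩
  calc taylorNorm (timeCoeff B L u n) k q ≤ ckMajorant C R T n k :=
        le_ckMajorant_of_recursion (a := fun n k => taylorNorm (timeCoeff B L u n) k q)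
          (fun n k => taylorNorm_nonneg _ k q) (norm_nonneg B) (norm_nonneg L) hC hR
          (by linarith) (hzero q) (taylorNorm_timeCoeff_succ_le hu.contDiff q) n k
    _ ≤ C * (2 * T) ^ n * (2 * R) ^ k := ckMajorant_le hC hR.le (hR.le.trans hRT) n k
    _ ≤ (C + 1) * (2 * T) ^ n * (2 * T) ^ k := by gcongr; linarith

lemma timeCoeff_add_period {v : P} (hv : ∀ q, u (q + v) = u q) (n : ℕ) (q : P) :
    timeCoeff B L u n (q + v) = timeCoeff B L u n q := by
  induction n using Nat.strong_induction_on generalizing q with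
  | _ n ih =>
  rcases n with _ | n
  · simp only [timeCoeff_zero, hv]
  have hd : ∀ i ≤ n, fderiv ℝ (timeCoeff B L u i) (q + v) = fderiv ℝ (timeCoeff B L u i) q :=
    fun i hi => fderiv_periodic (ih i (by omega)) q
  simp only [timeCoeff, hd n le_rfl]
  congr 2
  refine Finset.sum_congr rfl fun i _ => ?_
  rw [hd _ (by omega), ih i (by omega)]

end TimeCoeff

section Taylor

variable {P E : Type*} [NormedAddCommGroup P] [NormedSpace ℝ P] [NormedAddCommGroup E]
  [NormedSpace ℝ E] {f : P → E} {C A : ℝ}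

lemma HasCauchyBound.norm_iteratedFDeriv_apply_le (hf : HasCauchyBound C A f) (k : ℕ) (x y : P) :
    ‖iteratedFDeriv ℝ k f x fun _ => y‖ ≤ C * (A * ‖y‖) ^ k * k.factorial := by
  calc ‖iteratedFDeriv ℝ k f x fun _ => y‖ ≤ ‖iteratedFDeriv ℝ k f x‖ * ‖y‖ ^ k := by
        simpa using (iteratedFDeriv ℝ k f x).le_opNorm fun _ => y
    _ ≤ C * A ^ k * k.factorial * ‖y‖ ^ k := by
        gcongr
        exact hf.norm_iteratedFDeriv_le k x
    _ = C * (A * ‖y‖) ^ k * k.factorial := by rw [mul_pow]; ring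

lemma HasCauchyBound.norm_sub_taylor_le [CompleteSpace E] (hf : HasCauchyBound C A f) (x y : P)
    (n : ℕ) : ‖f (x + y) - ∑ k ∈ Finset.range (n + 1),
        (k.factorial : ℝ)⁻¹ • iteratedFDeriv ℝ k f x fun _ => y‖ ≤
      C * (((n + 1 : ℕ) : ℝ) * (A * ‖y‖) ^ (n + 1)) := by
  rw [map_add_eq_sum_add_integral_iteratedFDeriv (n := n)
    fun t _ => (hf.contDiff.of_le (by exact_mod_cast le_top)).contDiffAt, add_sub_cancel_left,
    norm_smul, norm_inv, Real.norm_natCast, inv_mul_le_iff₀ (by positivity)]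
  have hint : ∀ t ∈ Set.uIoc (0 : ℝ) 1,
      ‖(1 - t) ^ n • iteratedFDeriv ℝ (n + 1) f (x + t • y) fun _ => y‖ ≤
        C * (A * ‖y‖) ^ (n + 1) * (n + 1).factorial := by
    intro t ht
    rw [Set.uIoc_of_le zero_le_one] at ht
    have hle : ‖(1 - t : ℝ)‖ ≤ 1 := by
      rw [Real.norm_eq_abs, abs_le]; constructor <;> linarith [ht.1, ht.2]
    rw [norm_smul, norm_pow]
    exact (mul_le_of_le_one_left (norm_nonneg _) (pow_le_one₀ (norm_nonneg _) hle)).trans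
      (hf.norm_iteratedFDeriv_apply_le _ _ _)
  refine (intervalIntegral.norm_integral_le_of_norm_le_const hint).trans_eq ?_
  rw [Nat.factorial_succ, sub_zero, abs_one]
  push_cast
  ring

lemma HasCauchyBound.hasSum_taylor [CompleteSpace E] (hf : HasCauchyBound C A f) (hA : 0 ≤ A)
    (x : P) {y : P} (hy : A * ‖y‖ < 1) :
    HasSum (fun k : ℕ => (k.factorial : ℝ)⁻¹ • iteratedFDeriv ℝ k f x fun _ => y)
      (f (x + y)) := by
  have hr : 0 ≤ A * ‖y‖ := by positivity
  have hs : Summable fun k : ℕ => (k.factorial : ℝ)⁻¹ • iteratedFDeriv ℝ k f x fun _ => y := by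
    refine Summable.of_norm_bounded ((summable_geometric_of_lt_one hr hy).mul_left C) fun k => ?_
    rw [norm_smul, norm_inv, Real.norm_natCast, inv_mul_le_iff₀ (by positivity),
      mul_comm]
    exact hf.norm_iteratedFDeriv_apply_le k x y
  rw [hs.hasSum_iff_tendsto_nat, ← Filter.tendsto_add_atTop_iff_nat 1,
    tendsto_iff_norm_sub_tendsto_zero]
  have hlim := (((Filter.tendsto_add_atTop_iff_nat 1).2
    (tendsto_self_mul_const_pow_of_lt_one hr hy)).const_mul C)
  rw [mul_zero] at hlim
  refine squeeze_zero (fun _ => norm_nonneg _) (fun n => ?_) hlim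
  rw [norm_sub_rev]
  exact hf.norm_sub_taylor_le x y n

end Taylor

section JointSeries

open Finset.HasAntidiagonal

variable {P E : Type*} [NormedAddCommGroup P] [NormedSpace ℝ P] [NormedAddCommGroup E]
  [NormedSpace ℝ E]

/-- The part of degree `N` of the series `∑ₙ tⁿ aₙ₊ₘ(h)` in `(t, h)`; the shift `m` makes the
recursion on `N` possible. -/
noncomputable def jointSeries (a : ℕ → FormalMultilinearSeries ℝ P E) :
    (N : ℕ) → ℕ → ContinuousMultilinearMap ℝ (fun _ : Fin N => ℝ × P) E
  | 0, m => (a m 0).compContinuousLinearMap fun _ => ContinuousLinearMap.snd ℝ ℝ P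
  | N + 1, m => ((ContinuousLinearMap.fst ℝ ℝ P).smulRight (jointSeries a N (m + 1))).uncurryLeft +
      (a m (N + 1)).compContinuousLinearMap fun _ => ContinuousLinearMap.snd ℝ ℝ P

lemma jointSeries_apply (a : ℕ → FormalMultilinearSeries ℝ P E) (N m : ℕ) (z : ℝ × P) :
    jointSeries a N m (fun _ => z) =
      ∑ x ∈ antidiagonal N, z.1 ^ x.1 • a (m + x.1) x.2 (fun _ => z.2) := by
  induction N generalizing m with
  | zero => simp [jointSeries]
  | succ N ih =>
    have htail : (Fin.tail fun _ : Fin (N + 1) => z) = fun _ => z := rfl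
    rw [Finset.Nat.sum_antidiagonal_succ, jointSeries]
    simp only [add_apply, ContinuousLinearMap.uncurryLeft_apply,
      ContinuousLinearMap.smulRight_apply, ContinuousLinearMap.coe_fst',
      smul_apply, ContinuousMultilinearMap.compContinuousLinearMap_apply,
      ContinuousLinearMap.coe_snd', pow_zero, one_smul, add_zero]
    rw [htail, ih, Finset.smul_sum, add_comm]
    congr 1
    refine Finset.sum_congr rfl fun x _ => ?_
    rw [smul_smul, pow_succ', add_right_comm, add_assoc]

lemma norm_jointSeries_le (a : ℕ → FormalMultilinearSeries ℝ P E) (N m : ℕ) :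
    ‖jointSeries a N m‖ ≤ ∑ x ∈ antidiagonal N, ‖a (m + x.1) x.2‖ := by
  have hsnd : ∀ n k, ‖(a n k).compContinuousLinearMap fun _ => ContinuousLinearMap.snd ℝ ℝ P‖ ≤
      ‖a n k‖ := by
    intro n k
    refine (ContinuousMultilinearMap.norm_compContinuousLinearMap_le _ _).trans ?_
    refine mul_le_of_le_one_right (norm_nonneg _) (Finset.prod_le_one (fun _ _ => norm_nonneg _) ?_)
    exact fun _ _ => ContinuousLinearMap.norm_snd_le ..
  induction N generalizing m with
  | zero => simpa [jointSeries] using hsnd m 0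
  | succ N ih =>
    rw [Finset.Nat.sum_antidiagonal_succ, jointSeries]
    refine (norm_add_le _ _).trans ((add_comm _ _).trans_le
      (add_le_add (by simpa using hsnd m (N + 1)) ?_))
    rw [ContinuousLinearMap.uncurryLeft_norm, ContinuousLinearMap.norm_smulRight_apply]
    refine (mul_le_of_le_one_left (norm_nonneg _) (ContinuousLinearMap.norm_fst_le ..)).trans ?_
    refine (ih (m + 1)).trans_eq (Finset.sum_congr rfl fun x _ => ?_)
    rw [add_right_comm, add_assoc]

variable {a : ℕ → FormalMultilinearSeries ℝ P E} {M ρ : ℝ}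

lemma le_radius_jointSeries (hρ : 0 < ρ) (ha : ∀ n k, ‖a n k‖ ≤ M * ρ ^ n * ρ ^ k) :
    ENNReal.ofReal (1 / (2 * ρ)) ≤
      FormalMultilinearSeries.radius fun N => jointSeries a N 0 := by
  have hM : 0 ≤ M := by simpa using (norm_nonneg _).trans (ha 0 0)
  refine FormalMultilinearSeries.le_radius_of_bound _ M fun N => ?_
  rw [Real.coe_toNNReal _ (by positivity)]
  have hnorm : ‖jointSeries a N 0‖ ≤ ((N : ℝ) + 1) * (M * ρ ^ N) := by
    refine (norm_jointSeries_le a N 0).trans ?_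
    refine (Finset.sum_le_card_nsmul _ _ (M * ρ ^ N) fun x hx => ?_).trans_eq ?_
    · refine (ha _ _).trans_eq ?_
      rw [mul_assoc, ← pow_add, zero_add, mem_antidiagonal.1 hx]
    · rw [Finset.Nat.card_antidiagonal, nsmul_eq_mul, Nat.cast_succ]
  have hpow : ((N : ℝ) + 1) ≤ 2 ^ N := by exact_mod_cast (Nat.lt_two_pow_self : N < 2 ^ N)
  calc ‖jointSeries a N 0‖ * (1 / (2 * ρ)) ^ N ≤ 2 ^ N * (M * ρ ^ N) * (1 / (2 * ρ)) ^ N := by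
        gcongr
        exact hnorm.trans (by gcongr)
    _ = M * (2 * ρ * (1 / (2 * ρ))) ^ N := by rw [mul_pow, mul_pow]; ring
    _ = M := by rw [mul_one_div_cancel (by positivity), one_pow, mul_one]

lemma summable_pow_smul_apply [CompleteSpace E] (hρ : 0 < ρ)
    (ha : ∀ n k, ‖a n k‖ ≤ M * ρ ^ n * ρ ^ k) {t : ℝ} {y : P} (ht : ρ * |t| < 1)
    (hy : ρ * ‖y‖ < 1) : Summable fun x : ℕ × ℕ => t ^ x.1 • a x.1 x.2 fun _ => y := by
  have hM : 0 ≤ M := by simpa using (norm_nonneg _).trans (ha 0 0)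
  have hgeom := ((summable_geometric_of_lt_one (by positivity) ht).mul_left M).mul_of_nonneg
    (summable_geometric_of_lt_one (by positivity) hy) (fun _ => by positivity)
    (fun _ => by positivity)
  refine Summable.of_norm_bounded hgeom fun x => ?_
  rw [norm_smul, norm_pow, Real.norm_eq_abs]
  calc |t| ^ x.1 * ‖a x.1 x.2 fun _ => y‖ ≤ |t| ^ x.1 * (‖a x.1 x.2‖ * ‖y‖ ^ x.2) := by
        gcongr
        simpa using (a x.1 x.2).le_opNorm fun _ => y
    _ ≤ |t| ^ x.1 * (M * ρ ^ x.1 * ρ ^ x.2 * ‖y‖ ^ x.2) := by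
        gcongr
        exact ha _ _
    _ = M * (ρ * |t|) ^ x.1 * (ρ * ‖y‖) ^ x.2 := by rw [mul_pow, mul_pow]; ring

lemma hasSum_jointSeries [CompleteSpace E] {c : ℕ → E} {t : ℝ} {y : P}
    (hs : Summable fun x : ℕ × ℕ => t ^ x.1 • a x.1 x.2 fun _ => y)
    (hc : ∀ n, HasSum (fun k => a n k fun _ => y) (c n)) :
    HasSum (fun N => jointSeries a N 0 fun _ => (t, y)) (∑' n, t ^ n • c n) := by
  have hsum := hs.hasSum
  rw [← (hsum.prod_fiberwise fun n => (hc n).const_smul (t ^ n)).tsum_eq] at hsum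
  have hanti := ((sigmaAntidiagonalEquivProd (A := ℕ)).hasSum_iff.2 hsum).sigma
    fun N => hasSum_fintype _
  convert! hanti using 2 with N
  simp only [jointSeries_apply, zero_add]
  rw [← Finset.sum_coe_sort (antidiagonal N)]
  rfl

lemma hasFPowerSeriesOnBall_tsum_pow_smul [CompleteSpace E] {c : ℕ → P → E} (hρ : 0 < ρ)
    (ha : ∀ n k, ‖a n k‖ ≤ M * ρ ^ n * ρ ^ k) {q : P}
    (hc : ∀ n h, ρ * ‖h‖ < 1 → HasSum (fun k => a n k fun _ => h) (c n (q + h))) :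
    HasFPowerSeriesOnBall (fun z : ℝ × P => ∑' n, z.1 ^ n • c n z.2)
      (fun N => jointSeries a N 0) (0, q) (ENNReal.ofReal (1 / (2 * ρ))) where
  r_le := le_radius_jointSeries hρ ha
  r_pos := ENNReal.ofReal_pos.2 (by positivity)
  hasSum := by
    intro z hz
    have hρz : ρ * ‖z‖ < 1 := by
      rw [mem_eball_zero_iff, ← ofReal_norm, ENNReal.ofReal_lt_ofReal_iff (by positivity),
        lt_div_iff₀ (by positivity)] at hz
      have := mul_nonneg hρ.le (norm_nonneg z)
      linarith
    have ht : ρ * |z.1| < 1 := lt_of_le_of_lt (by gcongr; exact norm_fst_le z) hρz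
    have hy : ρ * ‖z.2‖ < 1 := lt_of_le_of_lt (by gcongr; exact norm_snd_le z) hρz
    simpa using hasSum_jointSeries (summable_pow_smul_apply hρ ha ht hy) fun n => hc n z.2 hy

end JointSeries

section PowerSeriesInTime

open Finset.HasAntidiagonal

variable {P E F G : Type*} [NormedAddCommGroup P] [NormedSpace ℝ P] [NormedAddCommGroup E]
  [NormedSpace ℝ E] [NormedAddCommGroup F] [NormedSpace ℝ F] [NormedAddCommGroup G]
  [NormedSpace ℝ G] {M ρ t : ℝ}

lemma summable_norm_pow_smul {f : ℕ → E} (hf : ∀ n, ‖f n‖ ≤ M * ρ ^ n) (hρ : 0 < ρ)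
    (ht : |t| * ρ < 1) : Summable fun n => ‖t ^ n • f n‖ := by
  refine Summable.of_nonneg_of_le (fun _ => norm_nonneg _) (fun n => ?_)
    ((summable_geometric_of_lt_one (by positivity) ht).mul_left M)
  rw [norm_smul, norm_pow, Real.norm_eq_abs, mul_pow, mul_left_comm]
  exact mul_le_mul_of_nonneg_left (hf n) (by positivity)

lemma hasDerivAt_tsum_pow_smul [CompleteSpace E] {f : ℕ → E} (hf : ∀ n, ‖f n‖ ≤ M * ρ ^ n)
    (hρ : 0 < ρ) (ht : |t| * ρ < 1) :
    HasDerivAt (fun s => ∑' n, s ^ n • f n) (∑' n : ℕ, t ^ n • ((n : ℝ) + 1) • f (n + 1)) t := by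
  obtain ⟨r, htr, hr⟩ := exists_between ((lt_div_iff₀ hρ).2 ht)
  have hr0 : 0 < r := (abs_nonneg t).trans_lt htr
  have hrρ : r * ρ < 1 := (lt_div_iff₀ hρ).1 hr
  have hsum : Summable fun n : ℕ => M / r * ((n : ℝ) * (r * ρ) ^ n) := by
    have := summable_pow_mul_geometric_of_norm_lt_one 1 (r := r * ρ)
      (by rwa [Real.norm_of_nonneg (by positivity)])
    simpa using this.mul_left (M / r)
  have hbound : ∀ n : ℕ, ∀ y ∈ Metric.ball (0 : ℝ) r,
      ‖((n : ℝ) * y ^ (n - 1)) • f n‖ ≤ M / r * ((n : ℝ) * (r * ρ) ^ n) := by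
    intro n y hy
    rcases n with _ | n
    · simp
    have hy' : |y| ≤ r := by simpa using (mem_ball_zero_iff.1 hy).le
    rw [norm_smul, norm_mul, norm_pow, Real.norm_natCast, Real.norm_eq_abs, Nat.add_sub_cancel]
    calc ((n + 1 : ℕ) : ℝ) * |y| ^ n * ‖f (n + 1)‖
        ≤ ((n + 1 : ℕ) : ℝ) * r ^ n * (M * ρ ^ (n + 1)) := by
          gcongr
          exact hf _
      _ = M / r * (((n + 1 : ℕ) : ℝ) * (r * ρ) ^ (n + 1)) := by rw [mul_pow]; field_simp; ring
  have htball : t ∈ Metric.ball (0 : ℝ) r := by simpa using htr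
  have hderiv := hasDerivAt_tsum_of_isPreconnected hsum Metric.isOpen_ball
    (convex_ball 0 r).isPreconnected (fun n y _ => (hasDerivAt_pow n y).smul_const (f n))
    hbound htball (summable_norm_pow_smul hf hρ ht).of_norm htball
  convert! hderiv using 1
  rw [(Summable.of_norm_bounded hsum fun n => hbound n t htball).tsum_eq_zero_add]
  simp [smul_smul, mul_comm]

lemma hasSum_bilinear_antidiagonal [CompleteSpace E] [CompleteSpace F] [CompleteSpace G]
    (B : E →L[ℝ] F →L[ℝ] G) {f : ℕ → E} {g : ℕ → F}
    (hf : Summable fun n => ‖f n‖) (hg : Summable fun n => ‖g n‖) :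
    HasSum (fun n => ∑ x ∈ antidiagonal n, B (f x.1) (g x.2)) (B (∑' n, f n) (∑' n, g n)) := by
  have hs : Summable fun x : ℕ × ℕ => B (f x.1) (g x.2) :=
    Summable.of_norm_bounded ((hf.mul_left ‖B‖).mul_of_nonneg hg (fun _ => by positivity)
      fun _ => by positivity) fun x => B.le_opNorm₂ _ _
  have hrows : ∀ n, HasSum (fun m => B (f n) (g m)) (B (f n) (∑' n, g n)) := fun n =>
    (B (f n)).hasSum hg.of_norm.hasSum
  have htotal : HasSum (fun n => B (f n) (∑' n, g n)) (B (∑' n, f n) (∑' n, g n)) :=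
    (B.flip (∑' n, g n)).hasSum hf.of_norm.hasSum
  have hsum := hs.hasSum
  rw [(hsum.prod_fiberwise hrows).unique htotal] at hsum
  have hanti := ((sigmaAntidiagonalEquivProd (A := ℕ)).hasSum_iff.2 hsum).sigma
    fun N => hasSum_fintype _
  convert! hanti using 2 with N
  rw [← Finset.sum_coe_sort (antidiagonal N)]
  rfl

lemma HasCauchyBound.norm_iteratedFDeriv_pow_smul_le {f : P → E} {n : ℕ}
    (hf : HasCauchyBound (M * ρ ^ n) ρ f) (t : ℝ) (k : ℕ) (q : P) :
    ‖iteratedFDeriv ℝ k (fun q => t ^ n • f q) q‖ ≤ M * ρ ^ k * k.factorial * (|t| * ρ) ^ n := by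
  have : iteratedFDeriv ℝ k (fun q => t ^ n • f q) q = t ^ n • iteratedFDeriv ℝ k f q :=
    iteratedFDeriv_const_smul_apply (hf.contDiff.of_le (by exact_mod_cast le_top)).contDiffAt
  rw [this, norm_smul, norm_pow, Real.norm_eq_abs]
  calc |t| ^ n * ‖iteratedFDeriv ℝ k f q‖ ≤ |t| ^ n * (M * ρ ^ n * ρ ^ k * k.factorial) := by
        gcongr
        exact hf.norm_iteratedFDeriv_le k q
    _ = M * ρ ^ k * k.factorial * (|t| * ρ) ^ n := by rw [mul_pow]; ring

variable {c : ℕ → P → E}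

lemma hasFDerivAt_tsum_pow_smul [CompleteSpace E] (hc : ∀ n, HasCauchyBound (M * ρ ^ n) ρ (c n))
    (hρ : 0 < ρ) (ht : |t| * ρ < 1) (q : P) :
    HasFDerivAt (fun q => ∑' n, t ^ n • c n q) (∑' n, t ^ n • fderiv ℝ (c n) q) q := by
  refine hasFDerivAt_tsum (u := fun n => M * ρ * (|t| * ρ) ^ n)
    ((summable_geometric_of_lt_one (by positivity) ht).mul_left _)
    (fun n x => ((hc n).differentiable x).hasFDerivAt.const_smul (t ^ n)) (fun n x => ?_)
    (summable_norm_pow_smul (fun n => (hc n).norm_le q) hρ ht).of_norm q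
  have := (hc n).norm_iteratedFDeriv_pow_smul_le t 1 x
  rwa [norm_iteratedFDeriv_one, pow_one, Nat.factorial_one, Nat.cast_one, mul_one,
    show fderiv ℝ (fun q => t ^ n • c n q) x = t ^ n • fderiv ℝ (c n) x from
      fderiv_const_smul ((hc n).differentiable x) _] at this

lemma analyticOnNhd_tsum_pow_smul [CompleteSpace E]
    (hc : ∀ n, HasCauchyBound (M * ρ ^ n) ρ (c n)) (hρ : 0 < ρ) :
    AnalyticOnNhd ℝ (fun z : ℝ × P => ∑' n, z.1 ^ n • c n z.2) {z | |z.1| < 1 / (2 * ρ)} := by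
  rintro ⟨t, q⟩ ht
  let a : ℕ → FormalMultilinearSeries ℝ P E :=
    fun n k => (k.factorial : ℝ)⁻¹ • iteratedFDeriv ℝ k (c n) q
  have ha : ∀ n k, ‖a n k‖ ≤ M * ρ ^ n * ρ ^ k := by
    intro n k
    rw [norm_smul, norm_inv, Real.norm_natCast, inv_mul_le_iff₀ (by positivity), mul_comm]
    exact (hc n).norm_iteratedFDeriv_le k q
  refine (hasFPowerSeriesOnBall_tsum_pow_smul hρ ha
    fun n y hy => (hc n).hasSum_taylor hρ.le q hy).analyticOnNhd (t, q) ?_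
  rw [Metric.mem_eball, edist_dist, ENNReal.ofReal_lt_ofReal_iff (by positivity)]
  simpa [Prod.dist_eq] using ht

lemma norm_iteratedFDeriv_tsum_pow_smul_sub_le [CompleteSpace E]
    (hc : ∀ n, HasCauchyBound (M * ρ ^ n) ρ (c n)) (hρ : 0 < ρ) (ht : |t| * ρ ≤ 1 / 2) (k : ℕ)
    (q : P) :
    ‖iteratedFDeriv ℝ k (fun q => ∑' n, t ^ n • c n q - c 0 q) q‖ ≤
      M * ρ ^ k * k.factorial * (2 * ρ) * |t| := by
  have hM : 0 ≤ M := by simpa using (norm_nonneg _).trans ((hc 0).norm_le q)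
  have hlt : |t| * ρ < 1 := ht.trans_lt (by norm_num)
  have htail : (fun q => ∑' n, t ^ n • c n q - c 0 q) =
      fun q => ∑' n, t ^ (n + 1) • c (n + 1) q := by
    funext q
    rw [(summable_norm_pow_smul (fun n => (hc n).norm_le q) hρ hlt).of_norm.tsum_eq_zero_add]
    simp
  have hs : ∀ k : ℕ, Summable fun n : ℕ => M * ρ ^ k * k.factorial * (|t| * ρ) ^ (n + 1) :=
    fun k => ((summable_nat_add_iff 1).2
      (summable_geometric_of_lt_one (by positivity) hlt)).mul_left _
  rw [htail, iteratedFDeriv_tsum_apply (N := ⊤) (f := fun n q => t ^ (n + 1) • c (n + 1) q)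
    (fun n => contDiff_const.smul (hc (n + 1)).contDiff) (fun k _ => hs k)
    (fun k n x _ => (hc (n + 1)).norm_iteratedFDeriv_pow_smul_le t k x) le_top]
  have hgeom : (1 - |t| * ρ)⁻¹ ≤ 2 := by
    rw [inv_le_comm₀ (by linarith) (by norm_num)]
    linarith
  calc _ ≤ ∑' n : ℕ, M * ρ ^ k * k.factorial * (|t| * ρ) ^ (n + 1) :=
        tsum_of_norm_bounded (hs k).hasSum fun n =>
          (hc (n + 1)).norm_iteratedFDeriv_pow_smul_le t k q
    _ = M * ρ ^ k * k.factorial * ((1 - |t| * ρ)⁻¹ * (|t| * ρ)) := by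
        simp only [tsum_mul_left, pow_succ, tsum_mul_right,
          tsum_geometric_of_lt_one (show 0 ≤ |t| * ρ by positivity) hlt]
    _ ≤ M * ρ ^ k * k.factorial * (2 * (|t| * ρ)) := by gcongr
    _ = M * ρ ^ k * k.factorial * (2 * ρ) * |t| := by ring

end PowerSeriesInTime

section CauchyKovalevskaya

open Finset.HasAntidiagonal

set_option maxSynthPendingDepth 3

variable {P E : Type*} [NormedAddCommGroup P] [NormedSpace ℝ P] [NormedAddCommGroup E]
  [NormedSpace ℝ E] [CompleteSpace E]

lemma hasDerivAt_tsum_timeCoeff {B : E →L[ℝ] (P →L[ℝ] E) →L[ℝ] E} {L : (P →L[ℝ] E) →L[ℝ] E}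
    {u : P → E} {M ρ t : ℝ} (hc : ∀ n, HasCauchyBound (M * ρ ^ n) ρ (timeCoeff B L u n))
    (hρ : 0 < ρ) (ht : |t| * ρ < 1) (q : P) :
    HasDerivAt (fun s => ∑' n, s ^ n • timeCoeff B L u n q)
      (B (∑' n, t ^ n • timeCoeff B L u n q)
          (fderiv ℝ (fun q => ∑' n, t ^ n • timeCoeff B L u n q) q) +
        L (fderiv ℝ (fun q => ∑' n, t ^ n • timeCoeff B L u n q) q)) t := by
  have hs := summable_norm_pow_smul (fun n => (hc n).norm_le q) hρ ht
  have hds := summable_norm_pow_smul (f := fun n => fderiv ℝ (timeCoeff B L u n) q) (M := M * ρ)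
    (fun n => ((hc n).norm_fderiv_le q).trans_eq (by ring)) hρ ht
  have hrhs := (hasSum_bilinear_antidiagonal B hs hds).add (L.hasSum hds.of_norm.hasSum)
  convert! hasDerivAt_tsum_pow_smul (fun n => (hc n).norm_le q) hρ ht using 1
  rw [(hasFDerivAt_tsum_pow_smul hc hρ ht q).fderiv, ← hrhs.tsum_eq]
  refine tsum_congr fun n => ?_
  rw [add_one_smul_timeCoeff_succ, smul_add, Finset.smul_sum, map_smul]
  congr 1
  refine Finset.sum_congr rfl fun x hx => ?_
  rw [map_smul, map_smul, smul_apply, smul_smul, ← pow_add, ← mem_antidiagonal.1 hx, add_comm x.2]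

theorem exists_analytic_solution (B : E →L[ℝ] (P →L[ℝ] E) →L[ℝ] E)
    (L : (P →L[ℝ] E) →L[ℝ] E) {u : P → E} {C A : ℝ} (hu : HasCauchyBound C A u) (hA : 0 ≤ A) :
    ∃ ε : ℝ, 0 < ε ∧ ∃ U : ℝ → P → E,
      AnalyticOnNhd ℝ (fun z : ℝ × P => U z.1 z.2) {z | |z.1| < ε} ∧ U 0 = u ∧
      (∀ t, |t| < ε → ∀ q, HasDerivAt (fun s => U s q)
        (B (U t q) (fderiv ℝ (U t) q) + L (fderiv ℝ (U t) q)) t) ∧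
      (∀ v, (∀ q, u (q + v) = u q) → ∀ t q, U t (q + v) = U t q) ∧
      ∀ k, ∃ M : ℝ, ∀ t, |t| < ε → ∀ q,
        ‖iteratedFDeriv ℝ k (fun q => U t q - u q) q‖ ≤ M * |t| := by
  obtain ⟨M, ρ, -, hρ, hc⟩ := hu.exists_timeCoeff (B := B) (L := L) hA
  have hlt : ∀ t : ℝ, |t| < 1 / (2 * ρ) → |t| * ρ < 1 / 2 := fun t ht => by
    rw [lt_div_iff₀ (by positivity)] at ht
    linarith
  refine ⟨1 / (2 * ρ), by positivity, fun t q => ∑' n, t ^ n • timeCoeff B L u n q,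
    analyticOnNhd_tsum_pow_smul hc hρ, ?_, fun t ht q => ?_, fun v hv t q => ?_, fun k => ?_⟩
  · funext q
    refine (tsum_eq_single 0 fun n hn => by simp [hn]).trans ?_
    rw [pow_zero, one_smul, timeCoeff_zero]
  · exact hasDerivAt_tsum_timeCoeff hc hρ ((hlt t ht).trans (by norm_num)) q
  · simp only [timeCoeff_add_period hv]
  · refine ⟨M * ρ ^ k * k.factorial * (2 * ρ), fun t ht q => ?_⟩
    have hclose := norm_iteratedFDeriv_tsum_pow_smul_sub_le hc hρ (hlt t ht).le k q
    rwa [timeCoeff_zero] at hclose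

end CauchyKovalevskaya
/-! ### Directional derivatives and uniqueness of analytic evolutions -/

section DirDeriv

variable {V : Type*} [NormedAddCommGroup V] [NormedSpace ℝ V]

/-- The derivative of a scalar function in the direction `v`, as a function of the base point, so
that it can be iterated. -/
noncomputable def dirDeriv (v : V) (Y : V → ℝ) (z : V) : ℝ := fderiv ℝ Y z v

variable {v : V} {Y Y' : V → ℝ} {z : V}

@[fun_prop]
lemma analyticAt_dirDeriv (h : AnalyticAt ℝ Y z) (v : V) : AnalyticAt ℝ (dirDeriv v Y) z :=
  ((ContinuousLinearMap.apply ℝ ℝ v).analyticAt _).comp h.fderiv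

lemma analyticOnNhd_dirDeriv {S : Set V} (h : AnalyticOnNhd ℝ Y S) (v : V) :
    AnalyticOnNhd ℝ (dirDeriv v Y) S := fun z hz => analyticAt_dirDeriv (h z hz) v

lemma dirDeriv_congr {S : Set V} (hS : IsOpen S) (h : Set.EqOn Y Y' S) (v : V) :
    Set.EqOn (dirDeriv v Y) (dirDeriv v Y') S := fun z hz => by
  rw [dirDeriv, dirDeriv, (h.eventuallyEq_of_mem (hS.mem_nhds hz)).fderiv_eq]

lemma dirDeriv_add (h : DifferentiableAt ℝ Y z) (h' : DifferentiableAt ℝ Y' z) :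
    dirDeriv v (fun z => Y z + Y' z) z = dirDeriv v Y z + dirDeriv v Y' z := by
  rw [dirDeriv, fderiv_fun_add h h']
  rfl

lemma dirDeriv_sub (h : DifferentiableAt ℝ Y z) (h' : DifferentiableAt ℝ Y' z) :
    dirDeriv v (fun z => Y z - Y' z) z = dirDeriv v Y z - dirDeriv v Y' z := by
  rw [dirDeriv, fderiv_fun_sub h h']
  rfl

lemma dirDeriv_mul (h : DifferentiableAt ℝ Y z) (h' : DifferentiableAt ℝ Y' z) :
    dirDeriv v (fun z => Y z * Y' z) z = Y z * dirDeriv v Y' z + Y' z * dirDeriv v Y z := by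
  rw [dirDeriv, fderiv_fun_mul h h']
  rfl

lemma dirDeriv_const_mul (c : ℝ) (h : DifferentiableAt ℝ Y z) :
    dirDeriv v (fun z => c * Y z) z = c * dirDeriv v Y z := by
  rw [dirDeriv, fderiv_const_mul h]
  rfl

lemma dirDeriv_const (c : ℝ) : dirDeriv v (fun _ => c) z = 0 := by
  simp [dirDeriv]

lemma dirDeriv_dirDeriv_apply (h : AnalyticAt ℝ Y z) (v w : V) :
    dirDeriv v (dirDeriv w Y) z = fderiv ℝ (fderiv ℝ Y) z v w := by
  change fderiv ℝ (fun z => fderiv ℝ Y z w) z v = _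
  rw [fderiv_clm_apply h.fderiv.differentiableAt (differentiableAt_const w)]
  simp

lemma dirDeriv_comm (h : AnalyticAt ℝ Y z) (v w : V) :
    dirDeriv v (dirDeriv w Y) z = dirDeriv w (dirDeriv v Y) z := by
  rw [dirDeriv_dirDeriv_apply h, dirDeriv_dirDeriv_apply h,
    h.contDiffAt.isSymmSndFDerivAt_of_omega v w]

end DirDeriv

section Uniqueness

variable {P : Type*} [NormedAddCommGroup P]

/-- The slab `|t| < ε` of points `(t, q)` of space-time. -/
def slab (P : Type*) (ε : ℝ) : Set (ℝ × P) := {z | |z.1| < ε}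

lemma isOpen_slab (ε : ℝ) : IsOpen (slab P ε) :=
  isOpen_lt (continuous_abs.comp continuous_fst) continuous_const

variable [NormedSpace ℝ P] {ε : ℝ} {Y Y' : ℝ × P → ℝ}

lemma hasDerivAt_time_slice {t : ℝ} {q : P} (h : DifferentiableAt ℝ Y (t, q)) :
    HasDerivAt (fun t => Y (t, q)) (dirDeriv (1, 0) Y (t, q)) t := by
  have hfd : HasFDerivAt (fun t => Y (t, q)) (_ : ℝ →L[ℝ] ℝ) t :=
    h.hasFDerivAt.comp t (hasFDerivAt_prodMk_left t q)
  simpa [dirDeriv] using hfd.hasDerivAt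

lemma dirDeriv_space_slice {t : ℝ} {q : P} (h : DifferentiableAt ℝ Y (t, q)) (v : P) :
    dirDeriv v (fun q => Y (t, q)) q = dirDeriv (0, v) Y (t, q) := by
  have hfd : HasFDerivAt (fun q => Y (t, q)) (_ : P →L[ℝ] ℝ) q :=
    h.hasFDerivAt.comp q (hasFDerivAt_prodMk_right t q)
  rw [dirDeriv, hfd.fderiv]
  simp [dirDeriv]

/-- `Y` is analytic on the slab `|t| < ε` and its time derivatives of order less than `n` vanish at
time zero. Stated for all `n`, this is the inductive hypothesis in uniqueness proofs. -/
def VanishesToOrder (ε : ℝ) : ℕ → (ℝ × P → ℝ) → Prop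
  | 0, Y => AnalyticOnNhd ℝ Y (slab P ε)
  | n + 1, Y => AnalyticOnNhd ℝ Y (slab P ε) ∧ (∀ q, Y (0, q) = 0) ∧
      VanishesToOrder ε n (dirDeriv (1, 0) Y)

namespace VanishesToOrder

variable {n : ℕ}

lemma analyticOnNhd (h : VanishesToOrder ε n Y) : AnalyticOnNhd ℝ Y (slab P ε) := by
  cases n with
  | zero => exact h
  | succ n => exact h.1

lemma of_succ (h : VanishesToOrder ε (n + 1) Y) : VanishesToOrder ε n Y := by
  induction n generalizing Y with
  | zero => exact h.1
  | succ n ih => exact ⟨h.1, h.2.1, ih h.2.2⟩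

lemma congr (hε : 0 < ε) (h : VanishesToOrder ε n Y) (he : Set.EqOn Y Y' (slab P ε)) :
    VanishesToOrder ε n Y' := by
  induction n generalizing Y Y' with
  | zero => exact AnalyticOnNhd.congr (isOpen_slab ε) h he
  | succ n ih =>
    refine ⟨AnalyticOnNhd.congr (isOpen_slab ε) h.1 he, fun q => ?_,
      ih h.2.2 (dirDeriv_congr (isOpen_slab ε) he _)⟩
    rw [← he (by simpa [slab] using hε), h.2.1]

lemma add (hε : 0 < ε) (h : VanishesToOrder ε n Y) (h' : VanishesToOrder ε n Y') :
    VanishesToOrder ε n (fun z => Y z + Y' z) := by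
  induction n generalizing Y Y' with
  | zero => exact AnalyticOnNhd.add h h'
  | succ n ih =>
    refine ⟨h.1.add h'.1, fun q => by simp only [h.2.1, h'.2.1, add_zero],
      (ih h.2.2 h'.2.2).congr hε fun z hz => ?_⟩
    exact (dirDeriv_add (h.1 z hz).differentiableAt (h'.1 z hz).differentiableAt).symm

lemma mul (hε : 0 < ε) (h : VanishesToOrder ε n Y') (hY : AnalyticOnNhd ℝ Y (slab P ε)) :
    VanishesToOrder ε n (fun z => Y z * Y' z) := by
  induction n generalizing Y Y' with
  | zero => exact AnalyticOnNhd.mul hY h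
  | succ n ih =>
    refine ⟨hY.mul h.1, fun q => by simp only [h.2.1, mul_zero], ?_⟩
    refine ((ih h.2.2 hY).add hε (ih h.of_succ (analyticOnNhd_dirDeriv hY (1, 0)))).congr hε
      fun z hz => ?_
    rw [dirDeriv_mul (hY z hz).differentiableAt (h.1 z hz).differentiableAt]
    ring

lemma const_mul (hε : 0 < ε) (c : ℝ) (h : VanishesToOrder ε n Y) :
    VanishesToOrder ε n (fun z => c * Y z) :=
  h.mul hε analyticOnNhd_const

lemma sub (hε : 0 < ε) (h : VanishesToOrder ε n Y) (h' : VanishesToOrder ε n Y') :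
    VanishesToOrder ε n (fun z => Y z - Y' z) :=
  (h.add hε (h'.const_mul hε (-1))).congr hε fun z _ => by ring

lemma dirDeriv_space (hε : 0 < ε) (h : VanishesToOrder ε n Y) (v : P) :
    VanishesToOrder ε n (dirDeriv (0, v) Y) := by
  induction n generalizing Y with
  | zero => exact analyticOnNhd_dirDeriv h _
  | succ n ih =>
    refine ⟨analyticOnNhd_dirDeriv h.1 _, fun q => ?_, (ih h.2.2).congr hε fun z hz =>
      dirDeriv_comm (h.1 z hz) _ _⟩
    rw [← dirDeriv_space_slice (h.1 (0, q) (by simpa [slab] using hε)).differentiableAt,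
      funext h.2.1, dirDeriv_const]

lemma mul_dirDeriv_sub (hε : 0 < ε) {a a' b b' : ℝ × P → ℝ} (ha' : AnalyticOnNhd ℝ a' (slab P ε))
    (hb : AnalyticOnNhd ℝ b (slab P ε)) (hb' : AnalyticOnNhd ℝ b' (slab P ε))
    (hva : VanishesToOrder ε n fun z => a z - a' z)
    (hvb : VanishesToOrder ε n fun z => b z - b' z) (v : P) :
    VanishesToOrder ε n fun z => a z * dirDeriv (0, v) b z - a' z * dirDeriv (0, v) b' z := by
  refine ((hva.mul hε (analyticOnNhd_dirDeriv hb (0, v))).add hε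
    ((hvb.dirDeriv_space hε v).mul hε ha')).congr hε fun z hz => ?_
  simp only [dirDeriv_sub (hb z hz).differentiableAt (hb' z hz).differentiableAt]
  ring

lemma mul_add_mul_dirDeriv (hε : 0 < ε) {a b : ℝ × P → ℝ} (hY : VanishesToOrder ε n Y)
    (ha : AnalyticOnNhd ℝ a (slab P ε)) (hb : AnalyticOnNhd ℝ b (slab P ε)) (v : P) :
    VanishesToOrder ε n fun z => a z * Y z + b z * dirDeriv (0, v) Y z :=
  (hY.mul hε ha).add hε ((hY.dirDeriv_space hε v).mul hε hb)

lemma iteratedDeriv_eq_zero (hε : 0 < ε) (h : VanishesToOrder ε n Y) (q : P) {k : ℕ} (hk : k < n) :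
    iteratedDeriv k (fun t => Y (t, q)) 0 = 0 := by
  induction n generalizing Y k with
  | zero => omega
  | succ n ih =>
    rcases k with _ | k
    · simpa using h.2.1 q
    have hderiv : deriv (fun t => Y (t, q)) =ᶠ[𝓝 0] fun t => dirDeriv (1, 0) Y (t, q) := by
      filter_upwards [Metric.ball_mem_nhds (0 : ℝ) hε] with t ht
      exact (hasDerivAt_time_slice
        (h.1 (t, q) (by simpa [slab] using ht)).differentiableAt).deriv
    rw [iteratedDeriv_succ', hderiv.iteratedDeriv_eq]
    exact ih h.2.2 (by omega)

lemma eqOn_zero (hε : 0 < ε) (h : ∀ n, VanishesToOrder ε n Y) {z : ℝ × P} (hz : z ∈ slab P ε) :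
    Y z = 0 := by
  obtain ⟨t, q⟩ := z
  have hline : AnalyticOnNhd ℝ (fun t => Y (t, q)) (Metric.ball 0 ε) := by
    intro s hs
    refine ((h 0).analyticOnNhd (s, q) (by simpa [slab] using hs)).comp_of_eq ?_ rfl
    exact analyticAt_id.prod analyticAt_const
  have horder : analyticOrderAt (fun t => Y (t, q)) 0 = ⊤ := by
    refine ENat.eq_top_iff_forall_ge.2 fun n => ?_
    rw [natCast_le_analyticOrderAt_iff_iteratedDeriv_eq_zero (hline 0 (by simpa using hε))]
    exact fun i hi => (h n).iteratedDeriv_eq_zero hε q hi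
  exact hline.eqOn_zero_of_preconnected_of_eventuallyEq_zero (convex_ball 0 ε).isPreconnected
    (by simpa using hε) (analyticOrderAt_eq_top.1 horder) (by simpa [slab] using hz)

end VanishesToOrder

theorem eqOn_zero_of_evolution {ι : Type*} (hε : 0 < ε) {Z : ι → ℝ × P → ℝ}
    (ha : ∀ i, AnalyticOnNhd ℝ (Z i) (slab P ε)) (h0 : ∀ i q, Z i (0, q) = 0)
    (hstep : ∀ n, (∀ j, VanishesToOrder ε n (Z j)) →
      ∀ i, VanishesToOrder ε n (dirDeriv (1, 0) (Z i))) (i : ι) {z : ℝ × P} (hz : z ∈ slab P ε) :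
    Z i z = 0 := by
  have hvanish : ∀ n i, VanishesToOrder ε n (Z i) := by
    intro n
    induction n with
    | zero => exact ha
    | succ n ih => exact fun i => ⟨ha i, h0 i, hstep n ih i⟩
  exact VanishesToOrder.eqOn_zero hε (fun n => hvanish n i) hz

end Uniqueness
/-! ### The symmetry flow in components -/

/-- `∂/∂t` on space-time. -/
noncomputable abbrev dT : (ℝ × Plane → ℝ) → ℝ × Plane → ℝ := dirDeriv (1, 0)

/-- `∂/∂x` on space-time. -/
noncomputable abbrev dX : (ℝ × Plane → ℝ) → ℝ × Plane → ℝ := dirDeriv (0, Pi.single 0 1)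

/-- `∂/∂y` on space-time. -/
noncomputable abbrev dY : (ℝ × Plane → ℝ) → ℝ × Plane → ℝ := dirDeriv (0, Pi.single 1 1)

/-- Analytic solutions `(L, u, f, g)` of the evolution system on the slab `|t| < ε`, in components;
`L` stands for the conformal factor and `u` for `u₀`. -/
structure EvolutionSolution (ε : ℝ) (L u f g : ℝ × Plane → ℝ) : Prop where
  anL : AnalyticOnNhd ℝ L (slab Plane ε)
  anu : AnalyticOnNhd ℝ u (slab Plane ε)
  anf : AnalyticOnNhd ℝ f (slab Plane ε)
  ang : AnalyticOnNhd ℝ g (slab Plane ε)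
  dTL : ∀ z ∈ slab Plane ε, dT L z = g z * dX L z + L z * dX g z + f z * dY L z + L z * dY f z
  dTu : ∀ z ∈ slab Plane ε, dT u z = -2 * (g z * dX L z) + g z * dX u z - 2 * (L z * dX g z) +
    2 * (f z * dY L z) + f z * dY u z + 2 * (L z * dY f z)
  dTf : ∀ z ∈ slab Plane ε, dT f z = 2 * dY u z
  dTg : ∀ z ∈ slab Plane ε, dT g z = -2 * dX u z

namespace EvolutionSolution

section Unique

variable {ε : ℝ} {L u f g L' u' f' g' : ℝ × Plane → ℝ} {n : ℕ}

lemma vanishesToOrder_dT_sub (h : EvolutionSolution ε L u f g)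
    (h' : EvolutionSolution ε L' u' f' g') (hε : 0 < ε)
    (vL : VanishesToOrder ε n fun z => L z - L' z) (vu : VanishesToOrder ε n fun z => u z - u' z)
    (vf : VanishesToOrder ε n fun z => f z - f' z) (vg : VanishesToOrder ε n fun z => g z - g' z) :
    VanishesToOrder ε n (dT fun z => L z - L' z) ∧ VanishesToOrder ε n (dT fun z => u z - u' z) ∧
    VanishesToOrder ε n (dT fun z => f z - f' z) ∧
    VanishesToOrder ε n (dT fun z => g z - g' z) := by
  have dsub : ∀ {a b : ℝ × Plane → ℝ}, AnalyticOnNhd ℝ a (slab Plane ε) →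
      AnalyticOnNhd ℝ b (slab Plane ε) → ∀ v, ∀ z ∈ slab Plane ε,
      dirDeriv v (fun z => a z - b z) z = dirDeriv v a z - dirDeriv v b z :=
    fun ha hb v z hz => dirDeriv_sub (ha z hz).differentiableAt (hb z hz).differentiableAt
  have gLx := VanishesToOrder.mul_dirDeriv_sub hε h'.ang h.anL h'.anL vg vL (Pi.single 0 1)
  have Lgx := VanishesToOrder.mul_dirDeriv_sub hε h'.anL h.ang h'.ang vL vg (Pi.single 0 1)
  have fLy := VanishesToOrder.mul_dirDeriv_sub hε h'.anf h.anL h'.anL vf vL (Pi.single 1 1)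
  have Lfy := VanishesToOrder.mul_dirDeriv_sub hε h'.anL h.anf h'.anf vL vf (Pi.single 1 1)
  have gux := VanishesToOrder.mul_dirDeriv_sub hε h'.ang h.anu h'.anu vg vu (Pi.single 0 1)
  have fuy := VanishesToOrder.mul_dirDeriv_sub hε h'.anf h.anu h'.anu vf vu (Pi.single 1 1)
  refine ⟨(((gLx.add hε Lgx).add hε fLy).add hε Lfy).congr hε fun z hz => ?_,
    ((((((gLx.add hε Lgx).const_mul hε (-2)).add hε ((fLy.add hε Lfy).const_mul hε 2))).add hε
      gux).add hε fuy).congr hε fun z hz => ?_,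
    ((vu.dirDeriv_space hε (Pi.single 1 1)).const_mul hε 2).congr hε fun z hz => ?_,
    ((vu.dirDeriv_space hε (Pi.single 0 1)).const_mul hε (-2)).congr hε fun z hz => ?_⟩
  · simp only [dsub h.anL h'.anL _ z hz]
    linear_combination - h.dTL z hz + h'.dTL z hz
  · simp only [dsub h.anu h'.anu _ z hz]
    linear_combination - h.dTu z hz + h'.dTu z hz
  · simp only [dsub h.anu h'.anu _ z hz, dsub h.anf h'.anf _ z hz]
    linear_combination - h.dTf z hz + h'.dTf z hz
  · simp only [dsub h.anu h'.anu _ z hz, dsub h.ang h'.ang _ z hz]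
    linear_combination - h.dTg z hz + h'.dTg z hz

theorem unique (h : EvolutionSolution ε L u f g) (h' : EvolutionSolution ε L' u' f' g')
    (hε : 0 < ε) (hL : ∀ q, L (0, q) = L' (0, q)) (hu : ∀ q, u (0, q) = u' (0, q))
    (hf : ∀ q, f (0, q) = f' (0, q)) (hg : ∀ q, g (0, q) = g' (0, q)) :
    ∀ z ∈ slab Plane ε, L z = L' z ∧ u z = u' z ∧ f z = f' z ∧ g z = g' z := by
  intro z hz
  have hzero : ∀ i, (![fun z => L z - L' z, fun z => u z - u' z, fun z => f z - f' z,
      fun z => g z - g' z] : Fin 4 → ℝ × Plane → ℝ) i z = 0 := fun i => by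
    refine eqOn_zero_of_evolution hε (Fin.forall_fin_succ.2 ⟨h.anL.sub h'.anL,
      Fin.forall_fin_succ.2 ⟨h.anu.sub h'.anu, Fin.forall_fin_two.2
        ⟨h.anf.sub h'.anf, h.ang.sub h'.ang⟩⟩⟩) (fun i q => ?_) (fun n hV => ?_) i hz
    · fin_cases i <;> simp [hL, hu, hf, hg]
    · obtain ⟨wL, wu, wf, wg⟩ := h.vanishesToOrder_dT_sub h' hε (hV 0) (hV 1) (hV 2) (hV 3)
      exact Fin.forall_fin_succ.2 ⟨wL, Fin.forall_fin_succ.2 ⟨wu, Fin.forall_fin_two.2 ⟨wf, wg⟩⟩⟩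
  exact ⟨sub_eq_zero.1 (hzero 0), sub_eq_zero.1 (hzero 1), sub_eq_zero.1 (hzero 2),
    sub_eq_zero.1 (hzero 3)⟩

end Unique

end EvolutionSolution

section Residuals

variable (L u f g : ℝ × Plane → ℝ)

/-- Left-hand side `f_x + g_y` of the first equation of the quasi-linear system. -/
noncomputable def resDiv (z : ℝ × Plane) : ℝ := dX f z + dY g z

/-- Left-hand side `(fΛ)_x - (gΛ)_y` of the second equation of the quasi-linear system. -/
noncomputable def resFlux (z : ℝ × Plane) : ℝ :=
  f z * dX L z + L z * dX f z - g z * dY L z - L z * dY g z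

/-- Left-hand side of the third equation of the quasi-linear system, the one with `(u₀)_x`. -/
noncomputable def resX (z : ℝ × Plane) : ℝ :=
  2 * dX L z + dX u z - 1 / 2 * (g z * (dY f z - dX g z))

/-- Left-hand side of the fourth equation of the quasi-linear system, the one with `(u₀)_y`. -/
noncomputable def resY (z : ℝ × Plane) : ℝ :=
  2 * dY L z - dY u z + 1 / 2 * (f z * (dY f z - dX g z))

end Residuals

namespace EvolutionSolution

section Residuals

variable {ε : ℝ} {L u f g : ℝ × Plane → ℝ} {z : ℝ × Plane} {n : ℕ}

lemma dT_dirDeriv (ha : AnalyticAt ℝ L z) {R : ℝ × Plane → ℝ}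
    (hR : ∀ z ∈ slab Plane ε, dT L z = R z) (hz : z ∈ slab Plane ε) (v : Plane) :
    dT (dirDeriv (0, v) L) z = dirDeriv (0, v) R z :=
  (dirDeriv_comm ha (1, 0) (0, v)).trans (dirDeriv_congr (isOpen_slab ε) hR (0, v) hz)

lemma dT_resDiv (h : EvolutionSolution ε L u f g) (hz : z ∈ slab Plane ε) :
    dT (resDiv f g) z = 0 := by
  have hu := h.anu z hz
  have hf := h.anf z hz
  have hg := h.ang z hz
  have tfx := dT_dirDeriv hf h.dTf hz (Pi.single 0 1)
  have tgy := dT_dirDeriv hg h.dTg hz (Pi.single 1 1)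
  have hxy : dY (dX u) z = dX (dY u) z := dirDeriv_comm hu _ _
  unfold resDiv
  simp only [dT, dX, dY] at *
  simp (disch := exact AnalyticAt.differentiableAt (by fun_prop)) only
    [dirDeriv_add, dirDeriv_mul, dirDeriv_const] at tfx tgy ⊢
  rw [tfx, tgy, hxy]
  ring

lemma dT_resFlux (h : EvolutionSolution ε L u f g) (hz : z ∈ slab Plane ε) :
    dT (resFlux L f g) z = (dX g z + dY f z) * resFlux L f g z + f z * dY (resFlux L f g) z +
      g z * dX (resFlux L f g) z + 2 * dY L z * resX L u f g z + 2 * L z * dY (resX L u f g) z -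
      2 * dX L z * resY L u f g z - 2 * L z * dX (resY L u f g) z +
      L z * f z * dY (resDiv f g) z - L z * g z * dX (resDiv f g) z +
      (f z * dY L z - L z * dX g z + L z * dY f z - g z * dX L z) * resDiv f g z := by
  have hL := h.anL z hz
  have hu := h.anu z hz
  have hf := h.anf z hz
  have hg := h.ang z hz
  have tLx := dT_dirDeriv hL h.dTL hz (Pi.single 0 1)
  have tLy := dT_dirDeriv hL h.dTL hz (Pi.single 1 1)
  have tfx := dT_dirDeriv hf h.dTf hz (Pi.single 0 1)
  have tgy := dT_dirDeriv hg h.dTg hz (Pi.single 1 1)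
  have cL : dY (dX L) z = dX (dY L) z := dirDeriv_comm hL _ _
  have cu : dY (dX u) z = dX (dY u) z := dirDeriv_comm hu _ _
  have cf : dY (dX f) z = dX (dY f) z := dirDeriv_comm hf _ _
  have cg : dY (dX g) z = dX (dY g) z := dirDeriv_comm hg _ _
  have eL := h.dTL z hz
  have ef := h.dTf z hz
  have eg := h.dTg z hz
  unfold resDiv resFlux resX resY
  simp only [dT, dX, dY] at *
  simp (disch := exact AnalyticAt.differentiableAt (by fun_prop)) only
    [dirDeriv_add, dirDeriv_sub, dirDeriv_mul, dirDeriv_const] at tLx tLy tfx tgy ⊢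
  rw [tfx, tgy, tLx, tLy, eL, ef, eg]
  simp only [cL, cu, cf, cg]
  ring

lemma dT_resX (h : EvolutionSolution ε L u f g) (hz : z ∈ slab Plane ε) :
    dT (resX L u f g) z = (2 * dY L z + dY u z) * resDiv f g z + 2 * L z * dY (resDiv f g) z +
      2 * dY (resFlux L f g) z + dY f z * resX L u f g z + f z * dY (resX L u f g) z +
      dY g z * resY L u f g z + g z * dY (resY L u f g) z := by
  have hL := h.anL z hz
  have hu := h.anu z hz
  have hf := h.anf z hz
  have hg := h.ang z hz
  have tLx := dT_dirDeriv hL h.dTL hz (Pi.single 0 1)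
  have tux := dT_dirDeriv hu h.dTu hz (Pi.single 0 1)
  have tfy := dT_dirDeriv hf h.dTf hz (Pi.single 1 1)
  have tgx := dT_dirDeriv hg h.dTg hz (Pi.single 0 1)
  have cL : dY (dX L) z = dX (dY L) z := dirDeriv_comm hL _ _
  have cu : dY (dX u) z = dX (dY u) z := dirDeriv_comm hu _ _
  have cf : dY (dX f) z = dX (dY f) z := dirDeriv_comm hf _ _
  have cg : dY (dX g) z = dX (dY g) z := dirDeriv_comm hg _ _
  have eg := h.dTg z hz
  unfold resDiv resFlux resX resY
  simp only [dT, dX, dY] at *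
  simp (disch := exact AnalyticAt.differentiableAt (by fun_prop)) only
    [dirDeriv_add, dirDeriv_sub, dirDeriv_mul, dirDeriv_const] at tLx tux tfy tgx ⊢
  rw [tLx, tux, tfy, tgx, eg]
  simp only [cL, cu, cf, cg]
  ring

lemma dT_resY (h : EvolutionSolution ε L u f g) (hz : z ∈ slab Plane ε) :
    dT (resY L u f g) z = (2 * dX L z - dX u z) * resDiv f g z + 2 * L z * dX (resDiv f g) z -
      2 * dX (resFlux L f g) z + dX f z * resX L u f g z + f z * dX (resX L u f g) z +
      dX g z * resY L u f g z + g z * dX (resY L u f g) z := by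
  have hL := h.anL z hz
  have hu := h.anu z hz
  have hf := h.anf z hz
  have hg := h.ang z hz
  have tLy := dT_dirDeriv hL h.dTL hz (Pi.single 1 1)
  have tuy := dT_dirDeriv hu h.dTu hz (Pi.single 1 1)
  have tfy := dT_dirDeriv hf h.dTf hz (Pi.single 1 1)
  have tgx := dT_dirDeriv hg h.dTg hz (Pi.single 0 1)
  have cL : dY (dX L) z = dX (dY L) z := dirDeriv_comm hL _ _
  have cu : dY (dX u) z = dX (dY u) z := dirDeriv_comm hu _ _
  have cg : dY (dX g) z = dX (dY g) z := dirDeriv_comm hg _ _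
  have ef := h.dTf z hz
  unfold resDiv resFlux resX resY
  simp only [dT, dX, dY] at *
  simp (disch := exact AnalyticAt.differentiableAt (by fun_prop)) only
    [dirDeriv_add, dirDeriv_sub, dirDeriv_mul, dirDeriv_const] at tLy tuy tfy tgx ⊢
  rw [tLy, tuy, tfy, tgx, ef]
  simp only [cL, cu, cg]
  ring

lemma vanishesToOrder_dT_resFlux (h : EvolutionSolution ε L u f g) (hε : 0 < ε)
    (vD : VanishesToOrder ε n (resDiv f g)) (vF : VanishesToOrder ε n (resFlux L f g))
    (vX : VanishesToOrder ε n (resX L u f g)) (vY : VanishesToOrder ε n (resY L u f g)) :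
    VanishesToOrder ε n (dT (resFlux L f g)) := by
  have hLx := analyticOnNhd_dirDeriv h.anL (0, Pi.single 0 1)
  have hLy := analyticOnNhd_dirDeriv h.anL (0, Pi.single 1 1)
  have hfy := analyticOnNhd_dirDeriv h.anf (0, Pi.single 1 1)
  have hgx := analyticOnNhd_dirDeriv h.ang (0, Pi.single 0 1)
  have termF := vF.mul_add_mul_dirDeriv hε (a := fun z => dX g z + dY f z) (hgx.add hfy) h.anf
    (Pi.single 1 1)
  have termFx := (vF.dirDeriv_space hε (Pi.single 0 1)).mul hε h.ang
  have termX := vX.mul_add_mul_dirDeriv hε (a := fun z => 2 * dY L z) (b := fun z => 2 * L z)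
    (analyticOnNhd_const.mul hLy) (analyticOnNhd_const.mul h.anL) (Pi.single 1 1)
  have termY := vY.mul_add_mul_dirDeriv hε (a := fun z => 2 * dX L z) (b := fun z => 2 * L z)
    (analyticOnNhd_const.mul hLx) (analyticOnNhd_const.mul h.anL) (Pi.single 0 1)
  have termD := vD.mul_add_mul_dirDeriv hε
    (a := fun z => f z * dY L z - L z * dX g z + L z * dY f z - g z * dX L z)
    (b := fun z => L z * f z) ((((h.anf.mul hLy).sub (h.anL.mul hgx)).add (h.anL.mul hfy)).sub
      (h.ang.mul hLx)) (h.anL.mul h.anf) (Pi.single 1 1)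
  have termDx := (vD.dirDeriv_space hε (Pi.single 0 1)).mul hε (Y := fun z => L z * g z)
    (h.anL.mul h.ang)
  refine (((((termF.add hε termFx).add hε termX).sub hε termY).add hε termD).sub hε termDx).congr
    hε fun z hz => ?_
  linear_combination -h.dT_resFlux hz

lemma vanishesToOrder_dT_resX (h : EvolutionSolution ε L u f g) (hε : 0 < ε)
    (vD : VanishesToOrder ε n (resDiv f g)) (vF : VanishesToOrder ε n (resFlux L f g))
    (vX : VanishesToOrder ε n (resX L u f g)) (vY : VanishesToOrder ε n (resY L u f g)) :
    VanishesToOrder ε n (dT (resX L u f g)) := by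
  have hLy := analyticOnNhd_dirDeriv h.anL (0, Pi.single 1 1)
  have huy := analyticOnNhd_dirDeriv h.anu (0, Pi.single 1 1)
  have hfy := analyticOnNhd_dirDeriv h.anf (0, Pi.single 1 1)
  have hgy := analyticOnNhd_dirDeriv h.ang (0, Pi.single 1 1)
  have termD := vD.mul_add_mul_dirDeriv hε (a := fun z => 2 * dY L z + dY u z)
    (b := fun z => 2 * L z) ((analyticOnNhd_const.mul hLy).add huy)
    (analyticOnNhd_const.mul h.anL) (Pi.single 1 1)
  have termF := (vF.dirDeriv_space hε (Pi.single 1 1)).const_mul hε 2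
  have termX := vX.mul_add_mul_dirDeriv hε hfy h.anf (Pi.single 1 1)
  have termY := vY.mul_add_mul_dirDeriv hε hgy h.ang (Pi.single 1 1)
  refine (((termD.add hε termF).add hε termX).add hε termY).congr hε fun z hz => ?_
  linear_combination -h.dT_resX hz

lemma vanishesToOrder_dT_resY (h : EvolutionSolution ε L u f g) (hε : 0 < ε)
    (vD : VanishesToOrder ε n (resDiv f g)) (vF : VanishesToOrder ε n (resFlux L f g))
    (vX : VanishesToOrder ε n (resX L u f g)) (vY : VanishesToOrder ε n (resY L u f g)) :
    VanishesToOrder ε n (dT (resY L u f g)) := by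
  have hLx := analyticOnNhd_dirDeriv h.anL (0, Pi.single 0 1)
  have hux := analyticOnNhd_dirDeriv h.anu (0, Pi.single 0 1)
  have hfx := analyticOnNhd_dirDeriv h.anf (0, Pi.single 0 1)
  have hgx := analyticOnNhd_dirDeriv h.ang (0, Pi.single 0 1)
  have termD := vD.mul_add_mul_dirDeriv hε (a := fun z => 2 * dX L z - dX u z)
    (b := fun z => 2 * L z) ((analyticOnNhd_const.mul hLx).sub hux)
    (analyticOnNhd_const.mul h.anL) (Pi.single 0 1)
  have termF := (vF.dirDeriv_space hε (Pi.single 0 1)).const_mul hε 2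
  have termX := vX.mul_add_mul_dirDeriv hε hfx h.anf (Pi.single 0 1)
  have termY := vY.mul_add_mul_dirDeriv hε hgx h.ang (Pi.single 0 1)
  refine (((termD.sub hε termF).add hε termX).add hε termY).congr hε fun z hz => ?_
  linear_combination -h.dT_resY hz

lemma analyticOnNhd_residuals (h : EvolutionSolution ε L u f g) :
    AnalyticOnNhd ℝ (resDiv f g) (slab Plane ε) ∧
    AnalyticOnNhd ℝ (resFlux L f g) (slab Plane ε) ∧
    AnalyticOnNhd ℝ (resX L u f g) (slab Plane ε) ∧
    AnalyticOnNhd ℝ (resY L u f g) (slab Plane ε) := by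
  have hd {Y : ℝ × Plane → ℝ} (hY : AnalyticOnNhd ℝ Y (slab Plane ε)) (i : Fin 2) :=
    analyticOnNhd_dirDeriv hY (0, Pi.single i 1)
  have hcurl := (hd h.anf 1).sub (hd h.ang 0)
  exact ⟨(hd h.anf 0).add (hd h.ang 1),
    (((h.anf.mul (hd h.anL 0)).add (h.anL.mul (hd h.anf 0))).sub (h.ang.mul (hd h.anL 1))).sub
      (h.anL.mul (hd h.ang 1)),
    ((analyticOnNhd_const.mul (hd h.anL 0)).add (hd h.anu 0)).sub
      (analyticOnNhd_const.mul (h.ang.mul hcurl)),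
    ((analyticOnNhd_const.mul (hd h.anL 1)).sub (hd h.anu 1)).add
      (analyticOnNhd_const.mul (h.anf.mul hcurl))⟩

theorem residuals_eq_zero (h : EvolutionSolution ε L u f g) (hε : 0 < ε)
    (hresD : ∀ q, resDiv f g (0, q) = 0) (hresF : ∀ q, resFlux L f g (0, q) = 0)
    (hresX : ∀ q, resX L u f g (0, q) = 0) (hresY : ∀ q, resY L u f g (0, q) = 0)
    (hz : z ∈ slab Plane ε) :
    resDiv f g z = 0 ∧ resFlux L f g z = 0 ∧ resX L u f g z = 0 ∧ resY L u f g z = 0 := by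
  obtain ⟨aD, aF, aX, aY⟩ := h.analyticOnNhd_residuals
  have hzero : ∀ i, (![resDiv f g, resFlux L f g, resX L u f g, resY L u f g] :
      Fin 4 → ℝ × Plane → ℝ) i z = 0 := fun i => by
    refine eqOn_zero_of_evolution hε (Fin.forall_fin_succ.2 ⟨aD, Fin.forall_fin_succ.2
      ⟨aF, Fin.forall_fin_two.2 ⟨aX, aY⟩⟩⟩) (fun i => ?_) (fun n hV => ?_) i hz
    · fin_cases i <;> assumption
    · have wD : VanishesToOrder ε n (dT (resDiv f g)) :=
        ((hV 0).const_mul hε 0).congr hε fun z hz => (zero_mul _).trans (h.dT_resDiv hz).symm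
      have wF := h.vanishesToOrder_dT_resFlux hε (hV 0) (hV 1) (hV 2) (hV 3)
      have wX := h.vanishesToOrder_dT_resX hε (hV 0) (hV 1) (hV 2) (hV 3)
      have wY := h.vanishesToOrder_dT_resY hε (hV 0) (hV 1) (hV 2) (hV 3)
      exact Fin.forall_fin_succ.2 ⟨wD, Fin.forall_fin_succ.2 ⟨wF, Fin.forall_fin_two.2 ⟨wX, wY⟩⟩⟩
  exact ⟨hzero 0, hzero 1, hzero 2, hzero 3⟩

end Residuals

end EvolutionSolution
/-! ### Conformal diffeomorphisms of the plane -/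

section Jacobian

variable {n : ℕ} {r s : (Fin n → ℝ) → Fin n → ℝ} {q : Fin n → ℝ}

lemma fderiv_apply_eq_jac_mulVec (r : (Fin n → ℝ) → Fin n → ℝ) (q v : Fin n → ℝ) :
    fderiv ℝ r q v = jac r q *ᵥ v := by
  conv_lhs => rw [pi_eq_sum_univ' v]
  ext i
  simp only [map_sum, map_smul, Finset.sum_apply, Pi.smul_apply, smul_eq_mul, Matrix.mulVec,
    dotProduct, jac, pd, Matrix.of_apply, mul_comm]

lemma jac_comp (hs : DifferentiableAt ℝ s (r q)) (hr : DifferentiableAt ℝ r q) :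
    jac (s ∘ r) q = jac s (r q) * jac r q := by
  refine Matrix.ext_of_mulVec_single fun j => ?_
  rw [← Matrix.mulVec_mulVec, ← fderiv_apply_eq_jac_mulVec, ← fderiv_apply_eq_jac_mulVec,
    ← fderiv_apply_eq_jac_mulVec, fderiv_comp q hs hr, ContinuousLinearMap.comp_apply]

lemma jac_id (q : Fin n → ℝ) : jac id q = 1 := by
  refine Matrix.ext_of_mulVec_single fun j => ?_
  rw [← fderiv_apply_eq_jac_mulVec, fderiv_id, ContinuousLinearMap.id_apply, Matrix.one_mulVec]

lemma det_jac_ne_zero (ψ : (Fin n → ℝ) ≃ (Fin n → ℝ)) (h : Differentiable ℝ ψ)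
    (h' : Differentiable ℝ ψ.symm) (q : Fin n → ℝ) : (jac ψ q).det ≠ 0 := by
  have hone : jac ψ.symm (ψ q) * jac ψ q = 1 := by
    rw [← jac_comp (h' _) (h _), ψ.symm_comp_self, jac_id]
  exact (Matrix.isUnit_det_of_left_inverse hone).ne_zero

lemma continuous_jac (h : ContDiff ℝ 1 r) : Continuous (jac r) := by
  have hcont : Continuous (fderiv ℝ r) := h.continuous_fderiv one_ne_zero
  exact continuous_pi fun i => continuous_pi fun j =>
    (continuous_apply i).comp (hcont.clm_apply continuous_const)

end Jacobian

section Entire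

variable {E : Type*} [NormedAddCommGroup E] [NormedSpace ℂ E] [CompleteSpace E]

lemma differentiable_dslope {f : ℂ → E} (hf : Differentiable ℂ f) (c : ℂ) :
    Differentiable ℂ (dslope f c) := by
  rw [← differentiableOn_univ] at hf ⊢
  exact (Complex.differentiableOn_dslope Filter.univ_mem).2 hf

theorem eq_affine_of_norm_le {g : ℂ → E} (hg : Differentiable ℂ g) {C : ℝ}
    (hC : ∀ z, ‖g z‖ ≤ ‖z‖ + C) (z : ℂ) : g z = g 0 + z • deriv g 0 := by
  obtain ⟨D, hD⟩ := (isCompact_closedBall (0 : ℂ) 1).exists_bound_of_continuousOn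
    (differentiable_dslope hg 0).continuous.continuousOn
  have hfar : ∀ w : ℂ, 1 < ‖w‖ → ‖dslope g 0 w‖ ≤ 1 + |C| + ‖g 0‖ := fun w hw => by
    have hsub : ‖w‖ * ‖dslope g 0 w‖ ≤ ‖w‖ + C + ‖g 0‖ := by
      have hw' := sub_smul_dslope g 0 w
      rw [sub_zero] at hw'
      rw [← norm_smul, hw']
      exact (norm_sub_le _ _).trans (by gcongr; exact hC w)
    refine le_of_mul_le_mul_left (hsub.trans ?_) (one_pos.trans hw)
    nlinarith [norm_nonneg (g 0), le_abs_self C, abs_nonneg C]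
  have hbdd : Bornology.IsBounded (Set.range (dslope g 0)) := by
    refine (Metric.isBounded_closedBall (x := (0 : E)) (r := max D (1 + |C| + ‖g 0‖))).subset ?_
    rintro _ ⟨w, rfl⟩
    rw [mem_closedBall_zero_iff]
    rcases le_or_gt ‖w‖ 1 with hw | hw
    · exact (hD w (mem_closedBall_zero_iff.2 hw)).trans (le_max_left _ _)
    · exact (hfar w hw).trans (le_max_right _ _)
  rw [← dslope_same g 0, (differentiable_dslope hg 0).apply_eq_apply_of_bounded hbdd 0 z]
  have hz := sub_smul_dslope g 0 z
  rw [sub_zero] at hz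
  exact (eq_add_of_sub_eq' hz.symm)

end Entire

lemma exists_forall_one_le_norm_sub {F G : ℂ → ℂ} (hG : Continuous G)
    (hGF : Function.LeftInverse G F) (w : ℂ) : ∃ R, ∀ z, R < ‖z‖ → 1 ≤ ‖F z - w‖ := by
  obtain ⟨C, hC⟩ := (isCompact_closedBall w 1).exists_bound_of_continuousOn hG.continuousOn
  refine ⟨C, fun z hz => ?_⟩
  by_contra! hlt
  exact hz.not_ge (hGF z ▸ hC (F z) (mem_closedBall_iff_norm.2 hlt.le))

lemma dslope_ne_zero {F : ℂ → ℂ} (hF : Function.Injective F) {c : ℂ} (hc : deriv F c ≠ 0)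
    (z : ℂ) : dslope F c z ≠ 0 := by
  intro hz
  have hFz : F z = F c := by simpa [hz, sub_eq_zero, eq_comm] using sub_smul_dslope F c z
  rw [hF hFz, dslope_same] at hz
  exact hc hz

/-- The reciprocal of the difference quotient `(F z - F 0) / z` is entire, has linear growth, hence
is affine, and has no zero, hence is constant. -/
theorem eq_affine_of_entire_homeomorph {F G : ℂ → ℂ} (hF : Differentiable ℂ F) (hG : Continuous G)
    (hGF : Function.LeftInverse G F) (h0 : deriv F 0 ≠ 0) (z : ℂ) :
    F z = F 0 + deriv F 0 * z := by
  have hslope : ∀ z, z * dslope F 0 z = F z - F 0 := fun z => by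
    simpa using sub_smul_dslope F 0 z
  have hne := dslope_ne_zero hGF.injective h0
  set g : ℂ → ℂ := fun z => (dslope F 0 z)⁻¹ with hg
  have hgd : Differentiable ℂ g := fun z => (differentiable_dslope hF 0 z).inv (hne z)
  obtain ⟨R, hR⟩ := exists_forall_one_le_norm_sub hG hGF (F 0)
  obtain ⟨C, hC⟩ := (isCompact_closedBall (0 : ℂ) R).exists_bound_of_continuousOn
    hgd.continuous.continuousOn
  have hgrow : ∀ z, ‖g z‖ ≤ ‖z‖ + |C| := fun z => by
    rcases le_or_gt ‖z‖ R with hz | hz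
    · linarith [hC z (mem_closedBall_zero_iff.2 hz), norm_nonneg z, le_abs_self C]
    · have hle : 1 ≤ ‖z‖ * ‖dslope F 0 z‖ := by rw [← norm_mul, hslope]; exact hR z hz
      have hgz : ‖g z‖ ≤ ‖z‖ := by
        rwa [hg, norm_inv, inv_le_iff_one_le_mul₀ (norm_pos_iff.2 (hne z))]
      linarith [abs_nonneg C]
  have haff : ∀ z, g z = g 0 + z * deriv g 0 := eq_affine_of_norm_le hgd hgrow
  have hconst : deriv g 0 = 0 := by
    by_contra hβ
    have hroot := haff (-(g 0) / deriv g 0)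
    rw [div_mul_cancel₀ _ hβ, add_neg_cancel] at hroot
    exact inv_ne_zero (hne _) hroot
  have hgz : g z = g 0 := by rw [haff z, hconst, mul_zero, add_zero]
  have hFz := hslope z
  rw [inv_injective hgz, dslope_same] at hFz
  linear_combination -hFz

lemma cauchyRiemann_of_transpose_mul_self {M : Matrix (Fin 2) (Fin 2) ℝ} {s σ : ℝ}
    (hM : Mᵀ * M = s • (1 : Matrix (Fin 2) (Fin 2) ℝ)) (hσ : σ * σ = 1) (hpos : 0 < σ * M.det) :
    M 0 1 = -σ * M 1 0 ∧ M 1 1 = σ * M 0 0 := by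
  have h00 := congrFun (congrFun hM 0) 0
  have h11 := congrFun (congrFun hM 1) 1
  simp only [Matrix.mul_apply, Matrix.transpose_apply, Fin.sum_univ_two, Matrix.smul_apply,
    Matrix.one_apply_eq, smul_eq_mul, mul_one] at h00 h11
  have hs : 0 ≤ s := h00 ▸ add_nonneg (mul_self_nonneg _) (mul_self_nonneg _)
  have hdet : σ * M.det = s := by
    refine (sq_eq_sq₀ hpos.le hs).1 ?_
    have hdet2 := congrArg Matrix.det hM
    rw [Matrix.det_mul, Matrix.det_transpose, Matrix.det_smul, Matrix.det_one] at hdet2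
    simp only [Fintype.card_fin, mul_one] at hdet2
    linear_combination hdet2 + M.det ^ 2 * hσ
  rw [Matrix.det_fin_two] at hdet
  have hsum : (M 1 1 - σ * M 0 0) ^ 2 + (M 0 1 + σ * M 1 0) ^ 2 = 0 := by
    linear_combination (M 0 0 * M 0 0 + M 1 0 * M 1 0) * hσ + h00 + h11 - 2 * hdet
  constructor <;> nlinarith [sq_nonneg (M 1 1 - σ * M 0 0), sq_nonneg (M 0 1 + σ * M 1 0)]

lemma exists_sign_mul_pos {X : Type*} [TopologicalSpace X] [PreconnectedSpace X] {d : X → ℝ}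
    (hd : Continuous d) (h0 : ∀ x, d x ≠ 0) : ∃ σ : ℝ, σ * σ = 1 ∧ ∀ x, 0 < σ * d x := by
  by_cases hneg : ∃ x, d x < 0
  · obtain ⟨x, hx⟩ := hneg
    refine ⟨-1, by norm_num, fun y => ?_⟩
    by_contra! hy
    obtain ⟨w, hw⟩ := mem_range_of_exists_le_of_exists_ge hd ⟨x, hx.le⟩ ⟨y, by linarith⟩
    exact h0 w hw
  · push Not at hneg
    exact ⟨1, one_mul 1, fun x => by simpa using (hneg x).lt_of_ne' (h0 x)⟩

/-- The identification `x + i y ↦ (x, σ y)` of `ℂ` with the plane; with `σ = -1` it reverses the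
orientation, so that orientation-reversing conformal maps become holomorphic. -/
noncomputable def complexPlane (σ : ℝ) (hσ : σ * σ = 1) : ℂ ≃L[ℝ] Plane :=
  LinearEquiv.toContinuousLinearEquiv
    { toFun := fun z => ![z.re, σ * z.im]
      invFun := fun w => ⟨w 0, σ * w 1⟩
      map_add' := fun z w => by ext i; fin_cases i <;> simp [mul_add]
      map_smul' := fun c z => by ext i; fin_cases i <;> simp [mul_left_comm]
      left_inv := fun z => by apply Complex.ext <;> simp [← mul_assoc, hσ]
      right_inv := fun w => by ext i; fin_cases i <;> simp [← mul_assoc, hσ] }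

lemma complexPlane_apply (σ : ℝ) (hσ : σ * σ = 1) (z : ℂ) :
    complexPlane σ hσ z = ![z.re, σ * z.im] := rfl

lemma complexPlane_symm_apply (σ : ℝ) (hσ : σ * σ = 1) (w : Plane) :
    (complexPlane σ hσ).symm w = ⟨w 0, σ * w 1⟩ := rfl

lemma hasDerivAt_complexPlane_conj {ψ : Plane → Plane} (hψ : Differentiable ℝ ψ) {σ : ℝ}
    (hσ : σ * σ = 1)
    (hCR : ∀ w, jac ψ w 0 1 = -σ * jac ψ w 1 0 ∧ jac ψ w 1 1 = σ * jac ψ w 0 0) (z : ℂ) :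
    HasDerivAt (fun z => (complexPlane 1 (one_mul 1)).symm (ψ (complexPlane σ hσ z)))
      ⟨jac ψ (complexPlane σ hσ z) 0 0, jac ψ (complexPlane σ hσ z) 1 0⟩ z := by
  have hreal := (complexPlane 1 (one_mul 1)).symm.hasFDerivAt.comp z
    ((hψ (complexPlane σ hσ z)).hasFDerivAt.comp z (complexPlane σ hσ).hasFDerivAt)
  refine hasFDerivAt_of_restrictScalars ℝ hreal (ContinuousLinearMap.ext fun ζ => ?_)
  obtain ⟨h01, h11⟩ := hCR (complexPlane σ hσ z)
  change ζ • _ = (complexPlane 1 (one_mul 1)).symm (fderiv ℝ ψ _ (complexPlane σ hσ ζ))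
  rw [fderiv_apply_eq_jac_mulVec, complexPlane_symm_apply, complexPlane_apply σ hσ ζ]
  apply Complex.ext <;> simp only [smul_eq_mul, Complex.mul_re, Complex.mul_im, Matrix.mulVec,
    dotProduct, Fin.sum_univ_two, Matrix.cons_val_zero, Matrix.cons_val_one, h01, h11]
  · linear_combination (ζ.im * jac ψ (complexPlane σ hσ z) 1 0) * hσ
  · linear_combination -(ζ.im * jac ψ (complexPlane σ hσ z) 0 0) * hσ

theorem exists_affine_of_conformal (ψ : Plane ≃ Plane) (h : ContDiff ℝ 1 ψ)
    (h' : Differentiable ℝ ψ.symm)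
    (hc : ∀ w, ∃ s : ℝ, (jac ψ w)ᵀ * jac ψ w = s • (1 : Matrix (Fin 2) (Fin 2) ℝ)) :
    ∃ (σ a b : ℝ) (β : Plane), σ * σ = 1 ∧ a ^ 2 + b ^ 2 ≠ 0 ∧
      ∀ w : Plane, ψ w = β + w 0 • ![a, b] + w 1 • ![-σ * b, σ * a] := by
  have hψ : Differentiable ℝ ψ := h.differentiable one_ne_zero
  have hdet := det_jac_ne_zero ψ hψ h'
  obtain ⟨σ, hσ, hpos⟩ := exists_sign_mul_pos (continuous_jac h).matrix_det hdet
  have hCR : ∀ w, jac ψ w 0 1 = -σ * jac ψ w 1 0 ∧ jac ψ w 1 1 = σ * jac ψ w 0 0 := fun w =>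
    cauchyRiemann_of_transpose_mul_self (hc w).choose_spec hσ (hpos w)
  set F : ℂ → ℂ := fun z => (complexPlane 1 (one_mul 1)).symm (ψ (complexPlane σ hσ z)) with hF
  have hderiv := hasDerivAt_complexPlane_conj hψ hσ hCR
  have h0 : jac ψ (complexPlane σ hσ 0) 0 0 ^ 2 + jac ψ (complexPlane σ hσ 0) 1 0 ^ 2 ≠ 0 := by
    have hd := hdet (complexPlane σ hσ 0)
    rw [Matrix.det_fin_two, (hCR _).1, (hCR _).2] at hd
    exact fun hz => hd (by linear_combination σ * hz)
  have haff := eq_affine_of_entire_homeomorph (F := F)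
    (G := fun z => (complexPlane σ hσ).symm (ψ.symm (complexPlane 1 (one_mul 1) z)))
    (fun z => (hderiv z).differentiableAt)
    ((complexPlane σ hσ).symm.continuous.comp
      (h'.continuous.comp (complexPlane 1 (one_mul 1)).continuous))
    (fun z => by simp [hF])
    (fun hz => h0 (by
      have hJ := Complex.ext_iff.1 ((hderiv 0).deriv.symm.trans hz)
      simp only [Complex.zero_re, Complex.zero_im] at hJ
      linear_combination jac ψ (complexPlane σ hσ 0) 0 0 * hJ.1 +
        jac ψ (complexPlane σ hσ 0) 1 0 * hJ.2))
  refine ⟨σ, _, _, complexPlane 1 (one_mul 1) (F 0), hσ, h0, fun w => ?_⟩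
  have hw := congrArg (complexPlane 1 (one_mul 1)) (haff ((complexPlane σ hσ).symm w))
  rw [map_add, (hderiv 0).deriv] at hw
  simp only [hF, ContinuousLinearEquiv.apply_symm_apply] at hw ⊢
  rw [hw, add_assoc, complexPlane_symm_apply, complexPlane_apply _ _ (_ * _)]
  congr 1
  ext i
  fin_cases i <;> simp <;> ring
/-! ### Liouville metrics -/

section Separated

variable {V : Type*} [NormedAddCommGroup V] [NormedSpace ℝ V] {Y : V → ℝ}

lemma hasDerivAt_comp_add_smul {z v : V} {s : ℝ} (h : DifferentiableAt ℝ Y (z + s • v)) :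
    HasDerivAt (fun s : ℝ => Y (z + s • v)) (dirDeriv v Y (z + s • v)) s := by
  have hline : HasDerivAt (fun s : ℝ => z + s • v) v s := by
    simpa using ((hasDerivAt_id s).smul_const v).const_add z
  exact h.hasFDerivAt.comp_hasDerivAt s hline

lemma dirDeriv_eq_of_separated (hY : Differentiable ℝ Y) {z e₁ e₂ : V} {k₁ k₂ : ℝ → ℝ}
    (h : ∀ x y : ℝ, Y (z + x • e₁ + y • e₂) = k₁ x + k₂ y) (x : ℝ) :
    dirDeriv e₂ Y (z + x • e₁) = dirDeriv e₂ Y z := by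
  have hx := hasDerivAt_comp_add_smul (v := e₂) (s := 0) (z := z + x • e₁) (hY _)
  have h0 := hasDerivAt_comp_add_smul (v := e₂) (s := 0) (z := z) (hY _)
  have hshift : (fun y : ℝ => Y (z + x • e₁ + y • e₂)) =
      fun y => Y (z + y • e₂) + (k₁ x - k₁ 0) := by
    funext y
    have hy := h 0 y
    rw [zero_smul, add_zero] at hy
    rw [h x y, hy]
    ring
  rw [hshift] at hx
  simpa using hx.unique (h0.add_const (k₁ x - k₁ 0))

lemma dirDeriv_dirDeriv_eq_zero_of_separated (hY : AnalyticOnNhd ℝ Y Set.univ)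
    {z e₁ e₂ : V} {k₁ k₂ : ℝ → ℝ} (h : ∀ x y : ℝ, Y (z + x • e₁ + y • e₂) = k₁ x + k₂ y) :
    dirDeriv e₁ (dirDeriv e₂ Y) z = 0 := by
  have hd := hasDerivAt_comp_add_smul (v := e₁) (s := 0) (z := z)
    (analyticOnNhd_dirDeriv hY e₂ _ (Set.mem_univ _)).differentiableAt
  have hY' : Differentiable ℝ Y := fun z => (hY z (Set.mem_univ z)).differentiableAt
  simp only [dirDeriv_eq_of_separated hY' h] at hd
  simpa using hd.unique (hasDerivAt_const _ _)

lemma exists_dirDeriv_eq_zero_of_periodic {v : V} (hY : Differentiable ℝ Y)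
    (h : Function.Periodic Y v) (z : V) : ∃ y : ℝ, dirDeriv v Y (z + y • v) = 0 := by
  have hd : ∀ y : ℝ, HasDerivAt (fun y : ℝ => Y (z + y • v)) (dirDeriv v Y (z + y • v)) y :=
    fun y => hasDerivAt_comp_add_smul (hY _)
  obtain ⟨y, -, hy⟩ := exists_hasDerivAt_eq_zero (a := (0 : ℝ)) (b := 1) zero_lt_one
    (fun y _ => (hd y).continuousAt.continuousWithinAt) (by simp [h z]) (fun y _ => hd y)
  exact ⟨y, hy⟩

end Separated

lemma jac_eq_of_affine {ψ : Plane → Plane} {β v w : Plane}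
    (h : ∀ q, ψ q = β + q 0 • v + q 1 • w) (q : Plane) : jac ψ q = (Matrix.of ![v, w])ᵀ := by
  set T : Plane →L[ℝ] Plane := LinearMap.toContinuousLinearMap (Matrix.of ![v, w])ᵀ.mulVecLin
  have hψ : ψ = fun q => β + T q := by
    funext q
    rw [h, add_assoc]
    ext i
    change β i + (q 0 * v i + q 1 * w i) = β i + ((Matrix.of ![v, w])ᵀ *ᵥ q) i
    simp only [Matrix.mulVec, dotProduct, Fin.sum_univ_two, Matrix.transpose_apply,
      Matrix.of_apply, Matrix.cons_val_zero, Matrix.cons_val_one, mul_comm]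
  refine Matrix.ext_of_mulVec_single fun j => ?_
  rw [← fderiv_apply_eq_jac_mulVec, hψ, fderiv_const_add, T.fderiv]
  rfl

namespace IsLiouvilleMetric

variable {Λ : Plane → ℝ}

lemma exists_separated_frame (hpos : ∀ q, 0 < Λ q) (h : IsLiouvilleMetric (conformalMetric Λ)) :
    ∃ σ a b : ℝ, σ * σ = 1 ∧ a ^ 2 + b ^ 2 ≠ 0 ∧ ∀ q, ∃ k₁ k₂ : ℝ → ℝ, ∀ x y : ℝ,
      Λ (q + x • ![a, b] + y • ![-σ * b, σ * a]) = k₁ x + k₂ y := by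
  obtain ⟨ψ, h₁, h₂, hs, hs', hm⟩ := h
  have hconf : ∀ w, Λ (ψ w) • ((jac ψ w)ᵀ * jac ψ w) =
      (h₁ (w 0) + h₂ (w 1)) • (1 : Matrix (Fin 2) (Fin 2) ℝ) := fun w => by
    rw [← hm w, conformalMetric, Matrix.mul_smul, Matrix.mul_one, Matrix.smul_mul]
  obtain ⟨σ, a, b, β, hσ, hab, haff⟩ := exists_affine_of_conformal ψ (hs.of_le (by simp))
    (hs'.differentiable (by simp)) fun w => ⟨(Λ (ψ w))⁻¹ * (h₁ (w 0) + h₂ (w 1)), by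
      rw [mul_smul, ← hconf w, smul_smul, inv_mul_cancel₀ (hpos _).ne', one_smul]⟩
  refine ⟨σ, a, b, hσ, hab, fun q => ?_⟩
  obtain ⟨w₀, rfl⟩ := ψ.surjective q
  refine ⟨fun x => (a ^ 2 + b ^ 2)⁻¹ * h₁ (w₀ 0 + x), fun y => (a ^ 2 + b ^ 2)⁻¹ * h₂ (w₀ 1 + y),
    fun x y => ?_⟩
  have hψ : ψ w₀ + x • ![a, b] + y • ![-σ * b, σ * a] = ψ ![w₀ 0 + x, w₀ 1 + y] := by
    rw [haff w₀, haff]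
    simp only [Matrix.cons_val_zero, Matrix.cons_val_one, add_smul]
    abel
  have h00 := congrFun (congrFun (hconf ![w₀ 0 + x, w₀ 1 + y]) 0) 0
  rw [jac_eq_of_affine haff] at h00
  simp only [Matrix.smul_apply, Matrix.mul_apply, Matrix.transpose_apply, Fin.sum_univ_two,
    Matrix.one_apply_eq, smul_eq_mul, Matrix.of_apply, Matrix.cons_val_zero, Matrix.cons_val_one,
    mul_one] at h00
  rw [hψ]
  field_simp
  linear_combination h00

lemma exists_wave_equation (hΛ : AnalyticOnNhd ℝ Λ Set.univ) (hpos : ∀ q, 0 < Λ q)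
    (h : IsLiouvilleMetric (conformalMetric Λ)) :
    ∃ a b : ℝ, a ^ 2 + b ^ 2 ≠ 0 ∧ ∀ q,
      a * b * (dirDeriv (Pi.single 1 1) (dirDeriv (Pi.single 1 1) Λ) q -
        dirDeriv (Pi.single 0 1) (dirDeriv (Pi.single 0 1) Λ) q) +
      (a ^ 2 - b ^ 2) * dirDeriv (Pi.single 0 1) (dirDeriv (Pi.single 1 1) Λ) q = 0 := by
  obtain ⟨σ, a, b, hσ, hab, hsep⟩ := h.exists_separated_frame hpos
  refine ⟨a, b, hab, fun q => ?_⟩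
  have hq := hΛ q (Set.mem_univ q)
  obtain ⟨k₁, k₂, hk⟩ := hsep q
  have hmix := dirDeriv_dirDeriv_eq_zero_of_separated hΛ hk
  have hframe : ∀ c d : ℝ, (![c, d] : Plane) = c • Pi.single 0 1 + d • Pi.single 1 1 :=
    fun c d => by ext i; fin_cases i <;> simp
  rw [dirDeriv_dirDeriv_apply hq, hframe, hframe] at hmix
  simp only [map_add, map_smul, add_apply, smul_apply, smul_eq_mul,
    ← dirDeriv_dirDeriv_apply hq, dirDeriv_comm hq (Pi.single 1 1) (Pi.single 0 1)] at hmix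
  linear_combination σ * hmix - (a * b * (dirDeriv (Pi.single 1 1) (dirDeriv (Pi.single 1 1) Λ) q -
    dirDeriv (Pi.single 0 1) (dirDeriv (Pi.single 0 1) Λ) q) +
    (a ^ 2 - b ^ 2) * dirDeriv (Pi.single 0 1) (dirDeriv (Pi.single 1 1) Λ) q) * hσ

theorem mixed_eq_zero_or (hΛ : AnalyticOnNhd ℝ Λ Set.univ) (hpos : ∀ q, 0 < Λ q)
    (hper : Function.Periodic Λ (Pi.single 1 1)) (h : IsLiouvilleMetric (conformalMetric Λ)) :
    (∀ q, dirDeriv (Pi.single 0 1) (dirDeriv (Pi.single 1 1) Λ) q = 0) ∨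
    ∀ q : Plane, ∃ y : ℝ,
      dirDeriv (Pi.single 0 1) (dirDeriv (Pi.single 0 1) Λ) (q + y • Pi.single 1 1) = 0 := by
  obtain ⟨a, b, hab, hwave⟩ := h.exists_wave_equation hΛ hpos
  rcases eq_or_ne (a * b) 0 with h0 | h0
  · refine Or.inl fun q => ?_
    have hq := hwave q
    rw [h0, zero_mul, zero_add] at hq
    refine (mul_eq_zero.1 hq).resolve_left fun hsub => hab ?_
    have hsq : (a ^ 2 + b ^ 2) ^ 2 = 0 := by
      linear_combination (a ^ 2 - b ^ 2) * hsub + 4 * a * b * h0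
    exact (pow_eq_zero_iff two_ne_zero).1 hsq
  · refine Or.inr fun q => ?_
    have hdiff : ∀ v, Differentiable ℝ (dirDeriv v Λ) := fun v z =>
      (analyticOnNhd_dirDeriv hΛ v z (Set.mem_univ z)).differentiableAt
    obtain ⟨y, hy⟩ := exists_dirDeriv_eq_zero_of_periodic (v := Pi.single 1 1)
      (((hdiff (Pi.single 1 1)).const_mul (a * b)).add
        ((hdiff (Pi.single 0 1)).const_mul (a ^ 2 - b ^ 2)))
      (fun z => by simp only [Pi.add_apply, dirDeriv, fderiv_periodic hper z]) q
    have hq := hwave (q + y • Pi.single 1 1)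
    change dirDeriv _ (fun z => _ + _) _ = 0 at hy
    rw [dirDeriv_add ((hdiff _).const_mul _ _) ((hdiff _).const_mul _ _),
      dirDeriv_const_mul _ (hdiff _ _), dirDeriv_const_mul _ (hdiff _ _),
      dirDeriv_comm (hΛ _ (Set.mem_univ _)) (Pi.single 1 1) (Pi.single 0 1)] at hy
    exact ⟨y, (mul_eq_zero.1 (by linear_combination hy - hq)).resolve_left h0⟩

end IsLiouvilleMetric
/-! ### The magnetic bracket on the energy level -/

lemma pd_apply {n m : ℕ} {U : (Fin n → ℝ) → Fin m → ℝ} {q : Fin n → ℝ}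
    (hU : DifferentiableAt ℝ U q) (i : Fin n) (j : Fin m) :
    pd i (fun q => U q j) q = pd i U q j := by
  rw [pd, pd, (hasFDerivAt_pi'.1 hU.hasFDerivAt j).fderiv]
  rfl

lemma conformalMetric_inv (L : Plane → ℝ) (q : Plane) :
    (conformalMetric L q)⁻¹ = (L q)⁻¹ • (1 : Matrix (Fin 2) (Fin 2) ℝ) := by
  rcases eq_or_ne (L q) 0 with h | h
  · simp [conformalMetric, h]
  · exact Matrix.inv_eq_right_inv (by simp [conformalMetric, h])

lemma hamiltonian_conformalMetric (L : Plane → ℝ) (z : Phase) :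
    hamiltonian (conformalMetric L) z = (z.2 0 ^ 2 + z.2 1 ^ 2) * (2 * L z.1)⁻¹ := by
  rw [hamiltonian, conformalMetric_inv, Matrix.smul_mulVec, Matrix.one_mulVec, mul_inv]
  simp only [dotProduct, Fin.sum_univ_two, Pi.smul_apply, smul_eq_mul]
  ring

lemma hamiltonian_conformalMetric_eq_half_iff {L : Plane → ℝ} {z : Phase} (h : L z.1 ≠ 0) :
    hamiltonian (conformalMetric L) z = 1 / 2 ↔ z.2 0 ^ 2 + z.2 1 ^ 2 = L z.1 := by
  rw [hamiltonian_conformalMetric, mul_inv_eq_iff_eq_mul₀ (mul_ne_zero two_ne_zero h)]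
  ring_nf

/-- The momentum coordinate `p_i` on phase space. -/
noncomputable def momentum (i : Fin 2) : Phase →L[ℝ] ℝ :=
  (ContinuousLinearMap.proj i : Plane →L[ℝ] ℝ).comp (ContinuousLinearMap.snd ℝ Plane Plane)

@[simp]
lemma momentum_apply (i : Fin 2) (z : Phase) : momentum i z = z.2 i := rfl

lemma hasFDerivAt_comp_fst {u : Plane → ℝ} {z : Phase} (hu : DifferentiableAt ℝ u z.1) :
    HasFDerivAt (fun z : Phase => u z.1)
      ((fderiv ℝ u z.1).comp (ContinuousLinearMap.fst ℝ Plane Plane)) z :=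
  hu.hasFDerivAt.comp z hasFDerivAt_fst

lemma hasFDerivAt_hamiltonian {L : Plane → ℝ} {z : Phase} (hL : DifferentiableAt ℝ L z.1)
    (hz : L z.1 ≠ 0) :
    HasFDerivAt (hamiltonian (conformalMetric L))
      ((z.2 0 / L z.1) • momentum 0 + (z.2 1 / L z.1) • momentum 1 -
        ((z.2 0 ^ 2 + z.2 1 ^ 2) / (2 * L z.1 ^ 2)) •
          (fderiv ℝ L z.1).comp (ContinuousLinearMap.fst ℝ Plane Plane)) z := by
  have hinv := (hasDerivAt_inv (mul_ne_zero two_ne_zero hz)).comp_hasFDerivAt z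
    ((hasFDerivAt_comp_fst hL).const_mul 2)
  rw [funext (hamiltonian_conformalMetric L)]
  refine ((((momentum 0).hasFDerivAt.pow 2).add ((momentum 1).hasFDerivAt.pow 2)).mul
    hinv).congr_fderiv ?_
  ext v <;> simp <;> field_simp

lemma hasFDerivAt_magIntegral {U : Plane → State} {z : Phase} (hU : DifferentiableAt ℝ U z.1) :
    HasFDerivAt (magIntegral U)
      ((4 * z.2 0 + 2 * U z.1 2) • momentum 0 - (4 * z.2 1 + 2 * U z.1 3) • momentum 1 +
        ((2 * z.2 0) • fderiv ℝ (fun q => U q 2) z.1 - (2 * z.2 1) • fderiv ℝ (fun q => U q 3) z.1 +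
          fderiv ℝ (fun q => U q 1) z.1).comp (ContinuousLinearMap.fst ℝ Plane Plane)) z := by
  have hp (i : Fin 2) := (momentum i).hasFDerivAt (x := z)
  have hq (i : Fin 4) := hasFDerivAt_comp_fst (differentiableAt_pi.1 hU i)
  have h := ((((((hp 0).pow 2).sub ((hp 1).pow 2)).const_mul 2).add
    (((hq 2).const_mul 2).mul (hp 0))).sub (((hq 3).const_mul 2).mul (hp 1))).add (hq 1)
  refine h.congr_fderiv ?_
  ext v <;> simp <;> ring

lemma magSystem_eq_zero_iff {U : Plane → State} {q : Plane} (hU : DifferentiableAt ℝ U q) :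
    magA (U q) *ᵥ pd 0 U q + magB (U q) *ᵥ pd 1 U q = 0 ↔
      pd 0 (fun q => U q 2) q + pd 1 (fun q => U q 3) q = 0 ∧
      U q 2 * pd 0 (fun q => U q 0) q + U q 0 * pd 0 (fun q => U q 2) q -
        U q 3 * pd 1 (fun q => U q 0) q - U q 0 * pd 1 (fun q => U q 3) q = 0 ∧
      2 * pd 0 (fun q => U q 0) q + pd 0 (fun q => U q 1) q + 2 * U q 3 * magField U q = 0 ∧
      2 * pd 1 (fun q => U q 0) q - pd 1 (fun q => U q 1) q - 2 * U q 2 * magField U q = 0 := by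
  simp only [magField, pd_apply hU, funext_iff, Fin.forall_fin_succ, Pi.add_apply, Pi.zero_apply,
    magA, magB, Matrix.mulVec, dotProduct, Fin.sum_univ_four, Matrix.of_apply, Matrix.cons_val,
    Fin.succ_zero_eq_one, Fin.succ_one_eq_two, IsEmpty.forall_iff, and_true]
  refine and_congr ?_ (and_congr ?_ (and_congr ?_ ?_)) <;> apply Eq.congr_left <;> simp <;> ring

lemma magBracket_eq {U : Plane → State} {q p : Plane} (hU : DifferentiableAt ℝ U q)
    (hne : U q 0 ≠ 0) (hp : p 0 ^ 2 + p 1 ^ 2 = U q 0) :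
    U q 0 * magBracket (magField U) (magIntegral U)
        (hamiltonian (conformalMetric (confFactor U))) (q, p) =
      2 * pd 0 (fun q => U q 2) q * p 0 ^ 2 + -2 * pd 1 (fun q => U q 3) q * p 1 ^ 2 +
      (2 * pd 0 (fun q => U q 0) q + pd 0 (fun q => U q 1) q +
        2 * U q 3 * magField U q) * p 0 +
      -(2 * pd 1 (fun q => U q 0) q - pd 1 (fun q => U q 1) q -
        2 * U q 2 * magField U q) * p 1 +
      (U q 2 * pd 0 (fun q => U q 0) q - U q 3 * pd 1 (fun q => U q 0) q) := by
  have hL : DifferentiableAt ℝ (confFactor U) q := differentiableAt_pi.1 hU 0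
  simp only [magBracket, dpos, dmom,
    (hasFDerivAt_hamiltonian (L := confFactor U) (z := (q, p)) hL hne).fderiv,
    (hasFDerivAt_magIntegral (z := (q, p)) hU).fderiv, Fin.sum_univ_two, magField, pd]
  rw [show confFactor U = fun q => U q 0 from rfl]
  simp [-neg_mul, hp]
  field_simp
  ring

lemma forall_circle_quadratic_eq_zero_iff {L : ℝ} (hL : 0 < L) {a b c d e : ℝ} :
    (∀ p : Plane, p 0 ^ 2 + p 1 ^ 2 = L →
      a * p 0 ^ 2 + b * p 1 ^ 2 + c * p 0 + d * p 1 + e = 0) ↔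
      a = b ∧ a * L + e = 0 ∧ c = 0 ∧ d = 0 := by
  refine ⟨fun h => ?_, fun ⟨hab, he, hc, hd⟩ p hp => ?_⟩
  · obtain ⟨s, hs, rfl⟩ : ∃ s : ℝ, s ≠ 0 ∧ s ^ 2 = L :=
      ⟨√L, (Real.sqrt_pos.2 hL).ne', Real.sq_sqrt hL.le⟩
    have heast := h ![s, 0] (by simp)
    have hwest := h ![-s, 0] (by simp)
    have hnorth := h ![0, s] (by simp)
    have hsouth := h ![0, -s] (by simp)
    simp only [Matrix.cons_val_zero, Matrix.cons_val_one] at heast hwest hnorth hsouth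
    refine ⟨?_, ?_, ?_, ?_⟩
    · apply mul_right_cancel₀ (pow_ne_zero 2 hs)
      linear_combination (heast + hwest - hnorth - hsouth) / 2
    · linear_combination (heast + hwest) / 2
    · exact (mul_eq_zero.1 (by linear_combination (heast - hwest) / 2)).resolve_right hs
    · exact (mul_eq_zero.1 (by linear_combination (hnorth - hsouth) / 2)).resolve_right hs
  · rw [hc, hd, ← hab]
    linear_combination a * hp + he

theorem solvesSystem_iff_isConservedOnLevel {U : Plane → State} (hU : Differentiable ℝ U)
    (hpos : ∀ q, 0 < confFactor U q) :
    SolvesSystem magA magB U ↔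
      IsConservedOnLevel (conformalMetric (confFactor U)) (magField U) (magIntegral U) := by
  rw [IsConservedOnLevel, Prod.forall]
  refine forall_congr' fun q => ?_
  have hne : U q 0 ≠ 0 := (hpos q).ne'
  have hlevel : ∀ p : Plane, hamiltonian (conformalMetric (confFactor U)) (q, p) = 1 / 2 ↔
      p 0 ^ 2 + p 1 ^ 2 = U q 0 := fun p => hamiltonian_conformalMetric_eq_half_iff hne
  have hbracket : ∀ p : Plane, p 0 ^ 2 + p 1 ^ 2 = U q 0 → _ := fun p hp =>
    (magBracket_eq (hU q) hne hp).congr_left.symm.trans (mul_eq_zero_iff_left hne)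
  simp only [hlevel]
  rw [← forall₂_congr hbracket, magSystem_eq_zero_iff (hU q)]
  refine Iff.trans ?_ (forall_circle_quadratic_eq_zero_iff (hpos q)).symm
  rw [confFactor, neg_eq_zero, neg_mul, ← sub_eq_zero (b := -_)]
  grind

/-! ### Independence of the integral and the energy -/

lemma linearIndependent_pair_of_minor_ne_zero {R M : Type*} [Field R] [AddCommGroup M] [Module R M]
    [TopologicalSpace R] [TopologicalSpace M] [IsTopologicalRing R] {S T : M →L[R] R} {v w : M}
    (h : S v * T w - S w * T v ≠ 0) : LinearIndependent R ![S, T] := by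
  rw [LinearIndependent.pair_iff]
  intro s t hst
  have hv : s * S v + t * T v = 0 := congrArg (fun A => A v) hst
  have hw : s * S w + t * T w = 0 := congrArg (fun A => A w) hst
  refine ⟨(mul_eq_zero.1 ?_).resolve_right h, (mul_eq_zero.1 ?_).resolve_right h⟩
  · linear_combination T w * hv - T v * hw
  · linear_combination S v * hw - S w * hv

lemma linearIndependent_fderiv_hamiltonian_magIntegral {U : Plane → State} {z : Phase}
    (hU : DifferentiableAt ℝ U z.1) (hne : U z.1 0 ≠ 0)
    (hz : 4 * z.2 0 * z.2 1 + U z.1 3 * z.2 0 + U z.1 2 * z.2 1 ≠ 0) :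
    LinearIndependent ℝ ![fderiv ℝ (hamiltonian (conformalMetric (confFactor U))) z,
      fderiv ℝ (magIntegral U) z] := by
  have hL : DifferentiableAt ℝ (confFactor U) z.1 := differentiableAt_pi.1 hU 0
  rw [(hasFDerivAt_hamiltonian hL hne).fderiv, (hasFDerivAt_magIntegral hU).fderiv]
  apply linearIndependent_pair_of_minor_ne_zero (v := (0, Pi.single 0 1)) (w := (0, Pi.single 1 1))
  convert mul_ne_zero (div_ne_zero (neg_ne_zero.2 two_ne_zero) hne) hz using 1
  simp [confFactor]
  field_simp
  ring

lemma ae_ne_zero_of_analyticOnNhd {f : ℝ → ℝ} (hf : AnalyticOnNhd ℝ f Set.univ) {x : ℝ}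
    (hx : f x ≠ 0) : ∀ᵐ t, f t ≠ 0 := by
  have hae := ae_restrict_le_codiscreteWithin (μ := MeasureTheory.volume) MeasurableSet.univ
    (hf.preimage_zero_mem_codiscrete hx)
  rwa [MeasureTheory.Measure.restrict_univ] at hae

lemma ae_trigonometric_ne_zero {a b c : ℝ} (ha : a ≠ 0) :
    ∀ᵐ φ : ℝ, a * (Real.cos φ * Real.sin φ) + b * Real.cos φ + c * Real.sin φ ≠ 0 := by
  have hf : AnalyticOnNhd ℝ (fun φ : ℝ => a * (Real.cos φ * Real.sin φ) + b * Real.cos φ +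
      c * Real.sin φ) Set.univ := fun φ _ => by
    have := Real.analyticAt_cos (x := φ)
    have := Real.analyticAt_sin (x := φ)
    fun_prop
  suffices ∃ φ : ℝ, a * (Real.cos φ * Real.sin φ) + b * Real.cos φ + c * Real.sin φ ≠ 0 from
    ae_ne_zero_of_analyticOnNhd hf this.choose_spec
  by_contra! hzero
  have h := hzero (Real.pi / 4)
  have h' := hzero (Real.pi / 4 + Real.pi)
  rw [Real.cos_add_pi, Real.sin_add_pi] at h'
  rw [Real.cos_pi_div_four, Real.sin_pi_div_four] at h h'
  have hsqrt : (√2 : ℝ) ^ 2 = 2 := Real.sq_sqrt (by norm_num)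
  exact ha (by linear_combination h + h' - a / 2 * hsqrt)

theorem isIndependentOnLevel_magIntegral {U : Plane → State} (hU : Differentiable ℝ U)
    (hpos : ∀ q, 0 < confFactor U q) :
    IsIndependentOnLevel (conformalMetric (confFactor U)) (magIntegral U) := by
  let minor : Plane × ℝ → ℝ := fun w => 4 * √(U w.1 0) * (Real.cos w.2 * Real.sin w.2) +
    U w.1 3 * Real.cos w.2 + U w.1 2 * Real.sin w.2
  have hminor : Continuous minor := by
    have hUc : Continuous U := hU.continuous
    fun_prop
  have hae : ∀ᵐ w, minor w ≠ 0 := by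
    rw [MeasureTheory.Measure.volume_eq_prod, MeasureTheory.Measure.ae_prod_iff_ae_ae
      (isOpen_ne_fun hminor continuous_const).measurableSet]
    exact .of_forall fun q =>
      ae_trigonometric_ne_zero (b := U q 3) (c := U q 2)
        (mul_ne_zero four_ne_zero (Real.sqrt_pos.2 (hpos q)).ne')
  filter_upwards [hae] with w hw r hr hlevel
  have hne : U w.1 0 ≠ 0 := (hpos w.1).ne'
  refine linearIndependent_fderiv_hamiltonian_magIntegral (hU _) hne ?_
  rw [hamiltonian_conformalMetric_eq_half_iff hne] at hlevel
  have hradius : √(U w.1 0) = r := by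
    rw [show U w.1 0 = r ^ 2 from ?_, Real.sqrt_sq hr.le]
    refine hlevel.symm.trans ?_
    simp [mul_pow, ← mul_add]
  convert mul_ne_zero hr.ne' hw using 1
  simp [minor, hradius]
  ring

/-! ### Periodic analytic coefficients -/

lemma analyticOnNhd_component {n : ℕ} {u : Plane → Fin n → ℝ} (hu : AnalyticOnNhd ℝ u Set.univ)
    (i : Fin n) : AnalyticOnNhd ℝ (fun q => u q i) Set.univ :=
  fun q hq => analyticAt_pi_iff.1 (hu q hq) i

theorem isQuadraticInMomenta_magIntegral {U : Plane → State} (hU : AnalyticOnNhd ℝ U Set.univ)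
    (hper : DoublyPeriodic U) :
    IsQuadraticInMomenta (conformalMetric (confFactor U)) (magIntegral U) := by
  have hc := analyticOnNhd_component hU
  refine ⟨fun _ => !![2, 0; 0, -2], fun q => ![2 * U q 2, -(2 * U q 3)], fun q => U q 1,
    fun i j => analyticOnNhd_const, fun q hq => ?_, hc 1, fun _ _ => rfl, fun q i => ?_,
    fun q i => ?_, fun q => ?_, fun z => ?_, 0, fun s hs => ?_⟩
  · refine analyticAt_pi_iff.2 (Fin.forall_fin_two.2 ⟨?_, ?_⟩)
    · exact analyticAt_const.mul (hc 2 q hq)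
    · exact (analyticAt_const.mul (hc 3 q hq)).neg
  · simp only [hper q i]
  · simp only [hper q i]
  · ext i j; fin_cases i <;> fin_cases j <;> rfl
  · simp [magIntegral, Matrix.mulVec, dotProduct, Fin.sum_univ_two]
    ring
  · rw [conformalMetric_inv] at hs
    have hxx := congrFun (congrFun hs 0) 0
    have hyy := congrFun (congrFun hs 1) 1
    simp only [Matrix.of_apply, Matrix.cons_val', Matrix.cons_val_zero, Matrix.cons_val_fin_one,
      Matrix.smul_apply, Matrix.one_apply_eq, smul_eq_mul, mul_one, Matrix.cons_val_one] at hxx hyy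
    linarith

theorem isAnalyticTorusMetric_conformalMetric {L : Plane → ℝ} (hL : AnalyticOnNhd ℝ L Set.univ)
    (hper : DoublyPeriodic L) (hpos : ∀ q, 0 < L q) : IsAnalyticTorusMetric (conformalMetric L) :=
  ⟨fun _ _ q hq => (hL q hq).mul analyticAt_const,
    fun q i => by rw [conformalMetric, conformalMetric, hper q i],
    fun q => Matrix.PosDef.one.smul (hpos q)⟩

theorem analyticOnNhd_magField {U : Plane → State} (hU : AnalyticOnNhd ℝ U Set.univ) :
    AnalyticOnNhd ℝ (magField U) Set.univ := fun q hq =>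
  analyticAt_const.mul ((analyticAt_dirDeriv (analyticOnNhd_component hU 3 q hq) _).sub
    (analyticAt_dirDeriv (analyticOnNhd_component hU 2 q hq) _))

theorem doublyPeriodic_magField {U : Plane → State} (hper : DoublyPeriodic U) :
    DoublyPeriodic (magField U) := fun q i => by
  have hfderiv (k : Fin 4) := fderiv_periodic (f := fun q => U q k) (v := Pi.single i 1)
    (fun q => congrFun (hper q i) k) q
  rw [magField, magField, pd, pd, hfderiv, hfderiv]
  rfl
/-! ### Simple roots and implicit functions -/

lemma not_isRoot_derivative_of_card_roots {K ι : Type*} [Field K] [CharZero K]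
    [Fintype ι] {p : Polynomial K} (hp : p ≠ 0) (hdeg : p.natDegree ≤ Fintype.card ι)
    {lam : ι → K} (hinj : Function.Injective lam) (hlam : ∀ i, p.IsRoot (lam i))
    {x : K} (hx : p.IsRoot x) : ¬ p.derivative.IsRoot x := by
  classical
  intro hx'
  have hle : Finset.univ.val.map lam ≤ p.roots :=
    (Multiset.le_iff_subset (Finset.univ.nodup.map hinj)).2 fun y hy => by
      obtain ⟨i, -, rfl⟩ := Multiset.mem_map.1 hy
      exact (Polynomial.mem_roots hp).2 (hlam i)
  have heq : Finset.univ.val.map lam = p.roots := Multiset.eq_of_le_of_card_le hle (by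
    simpa using (p.card_roots').trans hdeg)
  have hnodup : p.roots.Nodup := heq ▸ Finset.univ.nodup.map hinj
  exact ((Polynomial.one_lt_rootMultiplicity_iff_isRoot hp).2 ⟨hx, hx'⟩).not_ge
    (Polynomial.count_roots p ▸ Multiset.nodup_iff_count_le_one.1 hnodup x)

lemma exists_analytic_implicit {E : Type*} [NormedAddCommGroup E] [NormedSpace ℝ E]
    [CompleteSpace E] {G : E × ℝ → ℝ} {U : E} {x d : ℝ} (hG : AnalyticAt ℝ G (U, x))
    (hzero : G (U, x) = 0) (hd : HasDerivAt (fun y => G (U, y)) d x) (hne : d ≠ 0) :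
    ∃ φ : E → ℝ, AnalyticAt ℝ φ U ∧ φ U = x ∧ ∀ᶠ W in 𝓝 U, G (W, φ W) = 0 := by
  have hc : ContDiffAt ℝ ω G (U, x) := hG.contDiffAt
  have hinv : (fderiv ℝ G (U, x) ∘L .inr ℝ E ℝ).IsInvertible := by
    refine ⟨ContinuousLinearEquiv.unitsEquivAut ℝ (Units.mk0 d hne),
      ContinuousLinearMap.ext_ring ?_⟩
    have hcomp := (hG.differentiableAt.hasFDerivAt.comp x (hasFDerivAt_prodMk_right U x)).hasDerivAt
    simpa using hd.unique hcomp
  refine ⟨hc.implicitFunction (by simp) hinv,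
    (hc.contDiffAt_implicitFunction (by simp) hinv).analyticAt,
    hc.implicitFunction_apply_self (by simp) hinv, ?_⟩
  filter_upwards [hc.eventually_apply_implicitFunction (by simp) hinv] with W hW
  rw [hW, hzero]

lemma hasFDerivAt_comp_of_critical {E F : Type*} [NormedAddCommGroup E] [NormedSpace ℝ E]
    [NormedAddCommGroup F] [NormedSpace ℝ F] {G : E × ℝ → F} {φ : E → ℝ} {W : E}
    {G' : E × ℝ →L[ℝ] F} (hG : HasFDerivAt G G' (W, φ W)) (hφ : DifferentiableAt ℝ φ W)
    (hcrit : G' (0, 1) = 0) :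
    HasFDerivAt (fun V => G (V, φ V)) (G' ∘L .inl ℝ E ℝ) W := by
  refine (hG.comp W ((hasFDerivAt_id W).prodMk hφ.hasFDerivAt)).congr_fderiv ?_
  ext v
  have hsplit : (v, fderiv ℝ φ W v) = (v, 0) + fderiv ℝ φ W v • ((0, 1) : E × ℝ) := by simp
  calc G' (v, fderiv ℝ φ W v) = G' (v, 0) + fderiv ℝ φ W v • G' (0, 1) := by
        rw [hsplit, map_add, map_smul]
    _ = G' (v, 0) := by rw [hcrit, smul_zero, add_zero]

/-! ### Riemann invariants and conservation laws of quasi-linear systems -/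

lemma eventually_injective_of_continuousAt {X Y ι : Type*} [TopologicalSpace X] [TopologicalSpace Y]
    [T2Space Y] [Finite ι] {f : X → ι → Y} {x : X} (hf : ContinuousAt f x)
    (hinj : Function.Injective (f x)) : ∀ᶠ y in 𝓝 x, Function.Injective (f y) := by
  have hne : ∀ᶠ y in 𝓝 x, ∀ i j, i ≠ j → f y i ≠ f y j :=
    Filter.eventually_all.2 fun i => Filter.eventually_all.2 fun j =>
      Filter.eventually_imp_distrib_left.2 fun hij =>
        ((continuousAt_pi.1 hf i).ne_iff_eventually_ne (continuousAt_pi.1 hf j)).1 (hinj.ne hij)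
  filter_upwards [hne] with y hy i j hij
  exact by_contra fun h => hy i j h hij

section Quasilinear

variable {n : ℕ} {A B Z : (Fin n → ℝ) → Matrix (Fin n) (Fin n) ℝ} {U : Fin n → ℝ}

lemma jac_of_hasFDerivAt {r : (Fin n → ℝ) → Fin n → ℝ} {r' : Fin n → (Fin n → ℝ) →L[ℝ] ℝ}
    (h : ∀ i, HasFDerivAt (fun V => r V i) (r' i) U) :
    jac r U = Matrix.of fun i j => r' i (Pi.single j 1) := by
  ext i j
  simp only [jac, pd, Matrix.of_apply, (hasFDerivAt_pi.2 h).fderiv, ContinuousLinearMap.pi_apply]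

lemma det_ne_zero_of_left_eigenvectors {K : Type*} [Field K] {ι : Type*} [Fintype ι]
    [DecidableEq ι] {J M : Matrix ι ι K} {lam : ι → K} (hinj : Function.Injective lam)
    (hne : ∀ i, J i ≠ 0) (heig : ∀ i, J i ᵥ* M = lam i • J i) : J.det ≠ 0 := by
  have hli := Module.End.eigenvectors_linearIndependent' (Matrix.toLin' Mᵀ) lam hinj J fun i =>
    ⟨Module.End.mem_eigenspace_iff.2 (by rw [Matrix.toLin'_apply, Matrix.mulVec_transpose, heig]),
      hne i⟩
  exact ((Matrix.isUnit_iff_isUnit_det _).1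
    (Matrix.linearIndependent_rows_iff_isUnit.1 hli)).ne_zero

theorem hasRiemannInvariantsNear_of_left_eigenvectors {r lam : (Fin n → ℝ) → Fin n → ℝ}
    (hr : AnalyticAt ℝ r U) (hlam : ContinuousAt lam U) (hinj : Function.Injective (lam U))
    (hA : ∀ᶠ W in 𝓝 U, (A W).det ≠ 0) (hne : ∀ᶠ W in 𝓝 U, ∀ i, jac r W i ≠ 0)
    (heig : ∀ᶠ W in 𝓝 U, ∀ i, jac r W i ᵥ* ((A W)⁻¹ * B W) = lam W i • jac r W i) :
    HasRiemannInvariantsNear A B U := by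
  obtain ⟨N, hN, hopen, hU⟩ := eventually_nhds_iff.1 (hr.eventually_analyticAt.and
    ((eventually_injective_of_continuousAt hlam hinj).and (hA.and (hne.and heig))))
  refine ⟨N, hopen, hU, r, lam, fun W hW => (hN W hW).1.contDiffAt.contDiffWithinAt, fun W hW => ?_⟩
  obtain ⟨-, hinjW, hAW, hneW, heigW⟩ := hN W hW
  refine ⟨hAW, det_ne_zero_of_left_eigenvectors hinjW hneW heigW, hinjW, ?_⟩
  ext i j
  rw [Matrix.diagonal_mul]
  exact congrFun (heigW i) j

theorem hasConservationFormNear_of_multiplier {N : Set (Fin n → ℝ)} (hopen : IsOpen N)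
    (hU : U ∈ N) {Q R : (Fin n → ℝ) → Fin n → ℝ} (hQ : ContDiff ℝ ∞ Q) (hR : ContDiff ℝ ∞ R)
    (hA : ∀ W ∈ N, (A W).det ≠ 0) (hZ : ∀ W ∈ N, (Z W).det ≠ 0)
    (hjacQ : ∀ W, jac Q W = Z W * A W) (hjacR : ∀ W, jac R W = Z W * B W) :
    HasConservationFormNear A B U := by
  refine ⟨N, hopen, hU, Q, R, hQ.contDiffOn, hR.contDiffOn, fun W hW => ⟨hA W hW, ?_, ?_⟩⟩
  · rw [hjacQ, Matrix.det_mul]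
    exact mul_ne_zero (hZ W hW) (hA W hW)
  · rw [hjacQ, hjacR, Matrix.mul_assoc,
      Matrix.mul_nonsing_inv_cancel_left _ _ (hA W hW).isUnit]

end Quasilinear

/-! ### The eigenvalues of the magnetic system -/

/-- The characteristic polynomial of the pencil `B - x A`, up to the factor `-1/2`. -/
noncomputable def eigenPoly (U : State) : Polynomial ℝ :=
  (.C (U 2) * .X + .C (U 3)) ^ 2 * (1 + .X ^ 2) - .C (16 * U 0) * .X ^ 2

lemma eval_eigenPoly (U : State) (x : ℝ) :
    (eigenPoly U).eval x = (U 2 * x + U 3) ^ 2 * (1 + x ^ 2) - 16 * U 0 * x ^ 2 := by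
  simp [eigenPoly]

lemma eval_derivative_eigenPoly (U : State) (x : ℝ) : (eigenPoly U).derivative.eval x =
    2 * (U 2 * x + U 3) * U 2 * (1 + x ^ 2) + (U 2 * x + U 3) ^ 2 * (2 * x) - 32 * U 0 * x := by
  simp only [eigenPoly, Polynomial.derivative_sub, Polynomial.derivative_mul,
    Polynomial.derivative_pow, Polynomial.derivative_add, Polynomial.derivative_C,
    Polynomial.derivative_X, Polynomial.derivative_one, Polynomial.eval_sub, Polynomial.eval_add,
    Polynomial.eval_mul, Polynomial.eval_pow, Polynomial.eval_C, Polynomial.eval_X,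
    Polynomial.eval_one, Polynomial.eval_zero]
  norm_num
  ring

lemma natDegree_eigenPoly {U : State} (hf : U 2 ≠ 0) : (eigenPoly U).natDegree = 4 := by
  rw [eigenPoly]
  compute_degree!

lemma det_magA (U : State) : (magA U).det = -(U 2 ^ 2 / 2) := by
  simp [magA, Matrix.det_succ_row_zero, Fin.sum_univ_succ, Fin.succAbove]
  ring

lemma det_magA_ne_zero_iff {U : State} : (magA U).det ≠ 0 ↔ U 2 ≠ 0 := by
  simp [det_magA]

lemma det_magB_sub_smul_magA (U : State) (x : ℝ) :
    (magB U - x • magA U).det = -((eigenPoly U).eval x / 2) := by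
  rw [eval_eigenPoly]
  simp [magA, magB, Matrix.det_succ_row_zero, Fin.sum_univ_succ, Fin.succAbove]
  ring

lemma det_magB_sub_smul_magA_eq_zero_iff {U : State} {x : ℝ} :
    (magB U - x • magA U).det = 0 ↔ (eigenPoly U).IsRoot x := by
  simp [det_magB_sub_smul_magA]

namespace IsStrictlyHyperbolicAt

variable {U : State}

lemma f_ne_zero (h : IsStrictlyHyperbolicAt magA magB U) : U 2 ≠ 0 :=
  det_magA_ne_zero_iff.1 h.1

lemma exists_roots (h : IsStrictlyHyperbolicAt magA magB U) :
    ∃ lam : Fin 4 → ℝ, Function.Injective lam ∧ ∀ i, (eigenPoly U).IsRoot (lam i) :=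
  let ⟨_, lam, hinj, hlam⟩ := h
  ⟨lam, hinj, fun i => det_magB_sub_smul_magA_eq_zero_iff.1 (hlam i)⟩

lemma not_isRoot_derivative (h : IsStrictlyHyperbolicAt magA magB U) {x : ℝ}
    (hx : (eigenPoly U).IsRoot x) : ¬ (eigenPoly U).derivative.IsRoot x := by
  obtain ⟨lam, hinj, hlam⟩ := h.exists_roots
  have hdeg := natDegree_eigenPoly h.f_ne_zero
  have hne : eigenPoly U ≠ 0 := fun h0 => by simp [h0] at hdeg
  exact not_isRoot_derivative_of_card_roots hne (by simp [hdeg]) hinj hlam hx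

lemma g_ne_zero (h : IsStrictlyHyperbolicAt magA magB U) : U 3 ≠ 0 := fun hg =>
  h.not_isRoot_derivative (x := 0) (by simp [Polynomial.IsRoot, eval_eigenPoly, hg])
    (by simp [Polynomial.IsRoot, eval_derivative_eigenPoly, hg])

lemma conformal_pos (h : IsStrictlyHyperbolicAt magA magB U) : 0 < U 0 := by
  by_contra! hle
  obtain ⟨lam, -, hlam⟩ := h.exists_roots
  have hroot := hlam 0
  refine h.not_isRoot_derivative hroot ?_
  rw [Polynomial.IsRoot, eval_eigenPoly] at hroot
  set x := lam 0
  have hnonpos : U 0 * x ^ 2 ≤ 0 := mul_nonpos_of_nonpos_of_nonneg hle (sq_nonneg x)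
  have hlin : U 2 * x + U 3 = 0 :=
    (pow_eq_zero_iff two_ne_zero).1
      (by nlinarith [sq_nonneg (U 2 * x + U 3), sq_nonneg ((U 2 * x + U 3) * x)])
  have hmul : U 0 * x = 0 := by
    rw [hlin] at hroot
    exact (mul_eq_zero.1 (by linear_combination -hroot / 16 : U 0 * x * x = 0)).elim id
      fun hx => by rw [hx, mul_zero]
  rw [Polynomial.IsRoot, eval_derivative_eigenPoly, hlin]
  linear_combination -32 * hmul

end IsStrictlyHyperbolicAt

/-! ### The Riemann invariants of the magnetic system -/

/-- The integral `F` on `{H = ½}`, as a function of the state and of the angle `φ` of the momentum.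
Its critical values with respect to `φ` are the Riemann invariants. -/
noncomputable def levelIntegral (p : State × ℝ) : ℝ :=
  p.1 1 + 2 * (p.1 0 * (Real.cos p.2 ^ 2 - Real.sin p.2 ^ 2)) +
    2 * (√(p.1 0) * (p.1 2 * Real.cos p.2 - p.1 3 * Real.sin p.2))

/-- The derivative of `levelIntegral` with respect to the angle, up to the factor `-2 √Λ`. -/
noncomputable def phaseSlope (p : State × ℝ) : ℝ :=
  4 * √(p.1 0) * (Real.cos p.2 * Real.sin p.2) + p.1 2 * Real.sin p.2 + p.1 3 * Real.cos p.2

/-- The derivative of `levelIntegral` with respect to the state. -/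
noncomputable def levelGradient (p : State × ℝ) : State :=
  ![2 * (Real.cos p.2 ^ 2 - Real.sin p.2 ^ 2) +
      (p.1 2 * Real.cos p.2 - p.1 3 * Real.sin p.2) / √(p.1 0),
    1, 2 * √(p.1 0) * Real.cos p.2, -2 * √(p.1 0) * Real.sin p.2]

section LevelIntegral

variable {U : State} {x : ℝ}

lemma analyticAt_state_apply (i : Fin 4) (p : State × ℝ) :
    AnalyticAt ℝ (fun p : State × ℝ => p.1 i) p :=
  ((ContinuousLinearMap.proj (R := ℝ) i).comp (ContinuousLinearMap.fst ℝ State ℝ)).analyticAt p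

lemma analyticAt_sqrt_state (hL : 0 < U 0) :
    AnalyticAt ℝ (fun p : State × ℝ => √(p.1 0)) (U, x) :=
  (Real.contDiffAt_sqrt hL.ne').analyticAt.fun_comp (f := fun p : State × ℝ => p.1 0)
    (analyticAt_state_apply 0 (U, x))

lemma analyticAt_cos_phase (p : State × ℝ) :
    AnalyticAt ℝ (fun p : State × ℝ => Real.cos p.2) p :=
  Real.analyticAt_cos.fun_comp (f := fun p : State × ℝ => p.2) analyticAt_snd

lemma analyticAt_sin_phase (p : State × ℝ) :
    AnalyticAt ℝ (fun p : State × ℝ => Real.sin p.2) p :=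
  Real.analyticAt_sin.fun_comp (f := fun p : State × ℝ => p.2) analyticAt_snd

lemma analyticAt_phaseSlope (hL : 0 < U 0) : AnalyticAt ℝ phaseSlope (U, x) := by
  have hsqrt := analyticAt_sqrt_state (x := x) hL
  have happ := fun i => analyticAt_state_apply i (U, x)
  have hcos := analyticAt_cos_phase (U, x)
  have hsin := analyticAt_sin_phase (U, x)
  exact (((analyticAt_const.mul hsqrt).mul (hcos.mul hsin)).add ((happ 2).mul hsin)).add
    ((happ 3).mul hcos)

lemma analyticAt_levelIntegral (hL : 0 < U 0) : AnalyticAt ℝ levelIntegral (U, x) := by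
  have hsqrt := analyticAt_sqrt_state (x := x) hL
  have happ := fun i => analyticAt_state_apply i (U, x)
  have hcos := analyticAt_cos_phase (U, x)
  have hsin := analyticAt_sin_phase (U, x)
  exact ((happ 1).add (analyticAt_const.mul ((happ 0).mul ((hcos.pow 2).sub (hsin.pow 2))))).add
    (analyticAt_const.mul (hsqrt.mul (((happ 2).mul hcos).sub ((happ 3).mul hsin))))

lemma fderiv_levelIntegral_apply (hL : 0 < U 0) (v : State × ℝ) :
    fderiv ℝ levelIntegral (U, x) v =
      levelGradient (U, x) ⬝ᵥ v.1 - 2 * √(U 0) * phaseSlope (U, x) * v.2 := by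
  have happ : ∀ i : Fin 4, HasFDerivAt (fun p : State × ℝ => p.1 i)
      ((ContinuousLinearMap.proj (R := ℝ) i).comp (.fst ℝ State ℝ)) (U, x) := fun i =>
    ((ContinuousLinearMap.proj (R := ℝ) i).comp (.fst ℝ State ℝ)).hasFDerivAt
  have hsnd : HasFDerivAt (fun p : State × ℝ => p.2) (.snd ℝ State ℝ) (U, x) := hasFDerivAt_snd
  have hF : HasFDerivAt levelIntegral _ (U, x) :=
    ((happ 1).add (((happ 0).mul ((hsnd.cos.pow 2).sub (hsnd.sin.pow 2))).const_mul 2)).add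
      ((((happ 0).sqrt hL.ne').mul
        (((happ 2).mul hsnd.cos).sub ((happ 3).mul hsnd.sin))).const_mul 2)
  have hsq : √(U 0) ^ 2 = U 0 := Real.sq_sqrt hL.le
  have hne : √(U 0) ≠ 0 := (Real.sqrt_pos.2 hL).ne'
  rw [hF.fderiv]
  simp [levelGradient, phaseSlope, dotProduct, Fin.sum_univ_four]
  field_simp
  linear_combination 8 * v.2 * √(U 0) * Real.cos x * Real.sin x * hsq

lemma exists_phase (hL : 0 < U 0) (h : (eigenPoly U).IsRoot x) :
    ∃ φ, Real.cos φ ≠ 0 ∧ Real.sin φ = x * Real.cos φ ∧ phaseSlope (U, φ) = 0 := by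
  rw [Polynomial.IsRoot, eval_eigenPoly] at h
  simp only [phaseSlope]
  set c := Real.cos (Real.arctan x) with hc
  have hne : c ≠ 0 := (Real.cos_arctan_pos x).ne'
  have hsin : Real.sin (Real.arctan x) = x * c := by
    rw [hc, ← Real.tan_mul_cos hne, Real.tan_arctan]
  have hsc : c ^ 2 * (1 + x ^ 2) = 1 := by
    have htrig := Real.sin_sq_add_cos_sq (Real.arctan x)
    rw [hsin, ← hc] at htrig
    linear_combination htrig
  have hsq : √(U 0) ^ 2 = U 0 := Real.sq_sqrt hL.le
  -- The two factors are the slopes at the two angles `arctan x` and `arctan x + π`.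
  have hprod : (4 * √(U 0) * (c * (x * c)) + U 2 * (x * c) + U 3 * c) *
      (4 * √(U 0) * (c * (x * c)) - U 2 * (x * c) - U 3 * c) = 0 := by
    linear_combination 16 * c ^ 4 * x ^ 2 * hsq - c ^ 4 * h + c ^ 2 * (U 2 * x + U 3) ^ 2 * hsc
  rcases mul_eq_zero.1 hprod with hzero | hzero
  · exact ⟨Real.arctan x, hne, hsin, by rw [hsin]; exact hzero⟩
  · refine ⟨Real.arctan x + Real.pi, ?_, ?_, ?_⟩ <;>
      simp only [Real.cos_add_pi, Real.sin_add_pi, hsin, ← hc]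
    · exact neg_ne_zero.2 hne
    · ring
    · linear_combination hzero

lemma hasDerivAt_phaseSlope (U : State) (y : ℝ) : HasDerivAt (fun t => phaseSlope (U, t))
    (4 * √(U 0) * (Real.cos y ^ 2 - Real.sin y ^ 2) + U 2 * Real.cos y - U 3 * Real.sin y) y :=
  (((((Real.hasDerivAt_cos y).mul (Real.hasDerivAt_sin y)).const_mul (4 * √(U 0))).add
    ((Real.hasDerivAt_sin y).const_mul (U 2))).add
      ((Real.hasDerivAt_cos y).const_mul (U 3))).congr_deriv (by ring)

lemma isRoot_derivative_of_phaseSlope {y : ℝ} (hL : 0 < U 0) (hcos : Real.cos y ≠ 0)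
    (hsin : Real.sin y = x * Real.cos y) (hzero : phaseSlope (U, y) = 0)
    (hd : 4 * √(U 0) * (Real.cos y ^ 2 - Real.sin y ^ 2) + U 2 * Real.cos y -
      U 3 * Real.sin y = 0) : (eigenPoly U).derivative.IsRoot x := by
  rw [Polynomial.IsRoot, eval_derivative_eigenPoly]
  simp only [phaseSlope] at hzero
  have hsq : √(U 0) ^ 2 = U 0 := Real.sq_sqrt hL.le
  have hsc := Real.sin_sq_add_cos_sq y
  rw [hsin] at hzero hd hsc
  set c := Real.cos y
  have hslope : 4 * √(U 0) * c * x + U 2 * x + U 3 = 0 :=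
    mul_left_cancel₀ hcos (by linear_combination hzero)
  have hslope' : 4 * √(U 0) * c + U 2 * (1 + x ^ 2) = 0 :=
    mul_left_cancel₀ hcos (by linear_combination hd + x * c * hslope)
  rw [show U 2 * x + U 3 = -4 * √(U 0) * c * x by linear_combination hslope]
  linear_combination -8 * √(U 0) * c * x * hslope' + 32 * √(U 0) ^ 2 * x * hsc + 32 * x * hsq

lemma exists_phase_function (hL : 0 < U 0) (h : (eigenPoly U).IsRoot x)
    (hd : ¬ (eigenPoly U).derivative.IsRoot x) :
    ∃ φ : State → ℝ, AnalyticAt ℝ φ U ∧ Real.cos (φ U) ≠ 0 ∧ Real.tan (φ U) = x ∧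
      ∀ᶠ W in 𝓝 U, phaseSlope (W, φ W) = 0 := by
  obtain ⟨y, hcos, hsin, hzero⟩ := exists_phase hL h
  obtain ⟨φ, han, hφ, hslope⟩ := exists_analytic_implicit (analyticAt_phaseSlope hL) hzero
    (hasDerivAt_phaseSlope U y) fun h0 =>
      hd (isRoot_derivative_of_phaseSlope hL hcos hsin hzero h0)
  refine ⟨φ, han, by rwa [hφ], ?_, hslope⟩
  rw [hφ, Real.tan_eq_sin_div_cos, hsin, mul_div_cancel_right₀ _ hcos]

lemma jac_levelIntegral {φ : Fin 4 → State → ℝ} (hL : 0 < U 0)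
    (hφ : ∀ i, DifferentiableAt ℝ (φ i) U) (hcrit : ∀ i, phaseSlope (U, φ i U) = 0) :
    jac (fun W i => levelIntegral (W, φ i W)) U =
      Matrix.of fun i => levelGradient (U, φ i U) := by
  rw [jac_of_hasFDerivAt fun i => hasFDerivAt_comp_of_critical
    (analyticAt_levelIntegral hL).differentiableAt.hasFDerivAt (hφ i)
    (by rw [fderiv_levelIntegral_apply hL, hcrit]; simp)]
  ext i j
  simp [fderiv_levelIntegral_apply hL]

lemma levelGradient_vecMul (hL : 0 < U 0) (hf : U 2 ≠ 0) (hcos : Real.cos x ≠ 0)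
    (h : phaseSlope (U, x) = 0) :
    levelGradient (U, x) ᵥ* ((magA U)⁻¹ * magB U) = Real.tan x • levelGradient (U, x) := by
  have hsc := Real.sin_sq_add_cos_sq x
  have hq : (√(U 0))⁻¹ * U 0 = √(U 0) := by rw [inv_mul_eq_div, Real.div_sqrt]
  have hne : √(U 0) ≠ 0 := (Real.sqrt_pos.2 hL).ne'
  simp only [phaseSlope] at h
  set m : State := ![√(U 0) * (2 * Real.cos x ^ 2 - 1), 1 / √(U 0), Real.cos x, -Real.sin x]
    with hm
  have hA : m ᵥ* magA U = Real.cos x • levelGradient (U, x) := by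
    ext j
    fin_cases j <;> simp [hm, Matrix.vecMul, dotProduct, Fin.sum_univ_four, magA, levelGradient]
    · field_simp
      linear_combination Real.sin x * h - (U 2 + 2 * Real.cos x * √(U 0)) * hsc
    · linear_combination hq
    · linear_combination h / 2
  have hB : m ᵥ* magB U = Real.sin x • levelGradient (U, x) := by
    ext j
    fin_cases j <;> simp [hm, Matrix.vecMul, dotProduct, Fin.sum_univ_four, magB, levelGradient]
    · field_simp
      linear_combination -Real.cos x * h + (U 3 + 2 * Real.sin x * √(U 0)) * hsc
    · linear_combination -h / 2
    · linear_combination 2 * √(U 0) * hsc - hq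
  have hmul : Real.cos x • (levelGradient (U, x) ᵥ* ((magA U)⁻¹ * magB U)) =
      Real.sin x • levelGradient (U, x) := by
    rw [← Matrix.smul_vecMul, ← hA, Matrix.vecMul_vecMul,
      Matrix.mul_nonsing_inv_cancel_left _ _ (det_magA_ne_zero_iff.2 hf).isUnit, hB]
  rw [Real.tan_eq_sin_div_cos, div_eq_inv_mul, mul_smul, ← hmul, inv_smul_smul₀ hcos]

end LevelIntegral

theorem hasRiemannInvariantsNear_mag {U : State} (h : IsStrictlyHyperbolicAt magA magB U) :
    HasRiemannInvariantsNear magA magB U := by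
  obtain ⟨lam, hinj, hlam⟩ := h.exists_roots
  have hL := h.conformal_pos
  choose φ han hcos htan hcrit using fun j =>
    exists_phase_function hL (hlam j) (h.not_isRoot_derivative (hlam j))
  have hpos : ∀ᶠ W : State in 𝓝 U, 0 < W 0 :=
    (continuous_apply 0).continuousAt.eventually (lt_mem_nhds hL)
  have hf : ∀ᶠ W : State in 𝓝 U, W 2 ≠ 0 :=
    (continuous_apply 2).continuousAt.eventually_ne h.f_ne_zero
  have hcosW : ∀ᶠ W in 𝓝 U, ∀ i, Real.cos (φ i W) ≠ 0 := Filter.eventually_all.2 fun i =>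
    (Real.continuous_cos.continuousAt.comp (han i).continuousAt).eventually_ne (hcos i)
  have hcritW := Filter.eventually_all.2 hcrit
  have hjac : ∀ᶠ W in 𝓝 U, jac (fun W i => levelIntegral (W, φ i W)) W =
      Matrix.of fun i => levelGradient (W, φ i W) := by
    filter_upwards [hpos, hcritW, Filter.eventually_all.2 fun i => (han i).eventually_analyticAt]
      with W hLW hcritW hanW
    exact jac_levelIntegral hLW (fun i => (hanW i).differentiableAt) hcritW
  refine hasRiemannInvariantsNear_of_left_eigenvectors (lam := fun W i => Real.tan (φ i W))
    (AnalyticAt.pi fun i => (analyticAt_levelIntegral hL).fun_comp (f := fun W => (W, φ i W))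
      (analyticAt_id.prod (han i)))
    (continuousAt_pi.2 fun i => (Real.continuousAt_tan.2 (hcos i)).comp (han i).continuousAt)
    (by simpa only [htan] using hinj) (hf.mono fun W => det_magA_ne_zero_iff.2) ?_ ?_
  · filter_upwards [hjac] with W hW i h0
    simpa [hW, levelGradient] using congrFun h0 1
  · filter_upwards [hjac, hpos, hf, hcosW, hcritW] with W hW hLW hfW hcosW hcritW i
    rw [hW]
    exact levelGradient_vecMul hLW hfW (hcosW i) (hcritW i)

/-! ### The conservation laws of the magnetic system -/

/-- Densities of the conservation laws. -/
def magDensity (U : State) : State :=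
  ![U 2, U 0 * U 2, U 0 * U 2 * (U 0 + U 1),
    U 0 * U 2 * (U 1 ^ 2 + 2 * U 0 * U 1 + 2 * U 0 ^ 2 + U 0 * (U 2 ^ 2 + U 3 ^ 2))]

/-- Fluxes of the conservation laws. -/
def magFlux (U : State) : State :=
  ![U 3, -(U 0 * U 3), U 0 * U 3 * (U 0 - U 1),
    -(U 0 * U 3 * (U 1 ^ 2 - 2 * U 0 * U 1 + 2 * U 0 ^ 2 + U 0 * (U 2 ^ 2 + U 3 ^ 2)))]

/-- The matrix whose rows combine the equations `A U_x + B U_y = 0` into the conservation laws. -/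
def magMultiplier (U : State) : Matrix (Fin 4) (Fin 4) ℝ :=
  !![1, 0, 0, 0;
     0, 1, 0, 0;
     U 0 ^ 2, U 1, U 0 * U 2, U 0 * U 3;
     U 0 ^ 2 * (2 * U 1 + U 2 ^ 2 - U 3 ^ 2),
     U 1 ^ 2 + 2 * U 0 ^ 2 + 2 * U 0 * (U 2 ^ 2 + U 3 ^ 2),
     2 * U 0 * U 2 * (U 1 + U 0), 2 * U 0 * U 3 * (U 1 - U 0)]

lemma contDiff_magDensity : ContDiff ℝ ∞ magDensity := by
  refine contDiff_pi.2 fun i => ?_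
  fin_cases i <;> dsimp [magDensity] <;> fun_prop

lemma contDiff_magFlux : ContDiff ℝ ∞ magFlux := by
  refine contDiff_pi.2 fun i => ?_
  fin_cases i <;> dsimp [magFlux] <;> fun_prop

lemma det_magMultiplier (U : State) :
    (magMultiplier U).det = -(4 * U 0 ^ 3 * U 2 * U 3) := by
  simp [magMultiplier, Matrix.det_succ_row_zero, Fin.sum_univ_succ, Fin.succAbove]
  ring

lemma jac_magDensity (U : State) : jac magDensity U = magMultiplier U * magA U := by
  have hp : ∀ i : Fin 4, HasFDerivAt (fun V : State => V i)
      (ContinuousLinearMap.proj (R := ℝ) i) U := fun i => hasFDerivAt_apply i U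
  have hLf := (hp 0).mul (hp 2)
  have hcubic := (((hp 1).pow 2).add (((hp 0).const_mul 2).mul (hp 1))).add
    (((hp 0).pow 2).const_mul 2) |>.add ((hp 0).mul (((hp 2).pow 2).add ((hp 3).pow 2)))
  rw [jac_of_hasFDerivAt (r' := ![_, _, _, _]) (by
    rw [Fin.forall_fin_succ, Fin.forall_fin_succ, Fin.forall_fin_succ, Fin.forall_fin_one]
    exact ⟨hp 2, hLf, hLf.mul ((hp 0).add (hp 1)), hLf.mul hcubic⟩)]
  ext i j
  fin_cases i <;> fin_cases j <;>
    simp [magMultiplier, magA, Matrix.mul_apply, Fin.sum_univ_four] <;> ring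

lemma jac_magFlux (U : State) : jac magFlux U = magMultiplier U * magB U := by
  have hp : ∀ i : Fin 4, HasFDerivAt (fun V : State => V i)
      (ContinuousLinearMap.proj (R := ℝ) i) U := fun i => hasFDerivAt_apply i U
  have hLg := (hp 0).mul (hp 3)
  have hcubic := (((hp 1).pow 2).sub (((hp 0).const_mul 2).mul (hp 1))).add
    (((hp 0).pow 2).const_mul 2) |>.add ((hp 0).mul (((hp 2).pow 2).add ((hp 3).pow 2)))
  rw [jac_of_hasFDerivAt (r' := ![_, _, _, _]) (by
    rw [Fin.forall_fin_succ, Fin.forall_fin_succ, Fin.forall_fin_succ, Fin.forall_fin_one]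
    exact ⟨hp 3, hLg.neg, hLg.mul ((hp 0).sub (hp 1)), (hLg.mul hcubic).neg⟩)]
  ext i j
  fin_cases i <;> fin_cases j <;>
    simp [magMultiplier, magB, Matrix.mul_apply, Fin.sum_univ_four] <;> ring

theorem hasConservationFormNear_mag {U : State} (h : IsStrictlyHyperbolicAt magA magB U) :
    HasConservationFormNear magA magB U := by
  have hopen : IsOpen {W : State | 0 < W 0 ∧ W 2 ≠ 0 ∧ W 3 ≠ 0} :=
    (isOpen_lt continuous_const (continuous_apply 0)).inter
      ((isOpen_ne_fun (continuous_apply 2) continuous_const).inter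
        (isOpen_ne_fun (continuous_apply 3) continuous_const))
  refine hasConservationFormNear_of_multiplier hopen
    ⟨h.conformal_pos, h.f_ne_zero, h.g_ne_zero⟩ contDiff_magDensity contDiff_magFlux
    (fun W hW => det_magA_ne_zero_iff.2 hW.2.1) (fun W hW => ?_) jac_magDensity jac_magFlux
  rw [det_magMultiplier]
  simpa using ⟨⟨hW.1.ne', hW.2.1⟩, hW.2.2⟩

theorem isSemiHamiltonian_mag : IsSemiHamiltonian magA magB := fun _ h =>
  ⟨hasRiemannInvariantsNear_mag h, hasConservationFormNear_mag h⟩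

/-! ### Linear degeneracy fails -/

lemma exists_analytic_eigenvalue {U : State} {x : ℝ} (hroot : (eigenPoly U).IsRoot x)
    (hsimple : ¬ (eigenPoly U).derivative.IsRoot x) :
    ∃ lam : State → ℝ, AnalyticAt ℝ lam U ∧ lam U = x ∧
      ∀ᶠ W in 𝓝 U, (eigenPoly W).IsRoot (lam W) := by
  have hG : ContDiff ℝ ω fun p : State × ℝ => (eigenPoly p.1).eval p.2 := by
    simp only [eval_eigenPoly]
    fun_prop
  exact exists_analytic_implicit (G := fun p : State × ℝ => (eigenPoly p.1).eval p.2)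
    hG.contDiffAt.analyticAt hroot ((eigenPoly U).hasDerivAt x) hsimple

lemma eigenPoly_stationary {U : State} {lam : State → ℝ} {v : State}
    (hlam : DifferentiableAt ℝ lam U) (hroot : ∀ᶠ W in 𝓝 U, (eigenPoly W).IsRoot (lam W))
    (hv : fderiv ℝ lam U v = 0) :
    2 * (U 2 * lam U + U 3) * (v 2 * lam U + v 3) * (1 + lam U ^ 2) =
      16 * v 0 * lam U ^ 2 := by
  have hp : ∀ i : Fin 4, HasFDerivAt (fun V : State => V i)
      (ContinuousLinearMap.proj (R := ℝ) i) U := fun i => hasFDerivAt_apply i U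
  have hl := hlam.hasFDerivAt
  have hG := (((((hp 2).mul hl).add (hp 3)).pow 2).mul ((hl.pow 2).const_add 1)).sub
    (((hp 0).const_mul 16).mul (hl.pow 2))
  have hzero := (hasFDerivAt_const (𝕜 := ℝ) (0 : ℝ) U).congr_of_eventuallyEq
    (hroot.mono fun W hW => (eval_eigenPoly W (lam W)).symm.trans hW)
  have happ := congrArg (fun T : State →L[ℝ] ℝ => T v) (hG.unique hzero)
  simp only [Pi.add_apply, Pi.mul_apply, Nat.add_one_sub_one, pow_one, nsmul_eq_mul,
    Nat.cast_ofNat, smul_add, sub_apply, add_apply, smul_apply, hv, smul_eq_mul, mul_zero,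
    ContinuousLinearMap.proj_apply, zero_add, zero_apply] at happ
  linear_combination happ

lemma isStrictlyHyperbolicAt_example :
    IsStrictlyHyperbolicAt magA magB ![45 / 64, 0, 1, 1] := by
  have hsq : √65 ^ 2 = 65 := Real.sq_sqrt (by norm_num)
  have hlow : (8 : ℝ) < √65 := by rw [Real.lt_sqrt] <;> norm_num
  have hhigh : √65 < (9 : ℝ) := by rw [Real.sqrt_lt'] <;> norm_num
  refine ⟨det_magA_ne_zero_iff.2 (by simp), ![2, 1 / 2, (-9 + √65) / 4, (-9 - √65) / 4], ?_,
    fun i => det_magB_sub_smul_magA_eq_zero_iff.2 ?_⟩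
  · intro i j hij
    fin_cases i <;> fin_cases j <;> simp at hij ⊢ <;> linarith
  · rw [Polynomial.IsRoot, eval_eigenPoly]
    -- The polynomial is `(x² - 5/2 x + 1) (x² + 9/2 x + 1)`.
    fin_cases i <;> simp
    · norm_num
    · norm_num
    · linear_combination (((-9 + √65) / 4) ^ 2 - 5 / 2 * ((-9 + √65) / 4) + 1) * (hsq / 16)
    · linear_combination (((-9 - √65) / 4) ^ 2 - 5 / 2 * ((-9 - √65) / 4) + 1) * (hsq / 16)

theorem not_isLinearlyDegenerate_mag : ¬ IsLinearlyDegenerate magA magB := by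
  intro h
  set U : State := ![45 / 64, 0, 1, 1] with hU
  have hyp : IsStrictlyHyperbolicAt magA magB U := isStrictlyHyperbolicAt_example
  have hroot : (eigenPoly U).IsRoot 2 := by
    simp [Polynomial.IsRoot, eval_eigenPoly, hU]
    norm_num
  obtain ⟨lam, han, hval, hev⟩ := exists_analytic_eigenvalue hroot (hyp.not_isRoot_derivative hroot)
  have hstat := h U hyp lam han.contDiffAt
    (hev.mono fun W => det_magB_sub_smul_magA_eq_zero_iff.2) ![-15 / 16, 5 / 8, 1, 2] (by
      rw [hval]
      ext i
      fin_cases i <;>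
        simp [magA, magB, Matrix.mulVec, dotProduct, Fin.sum_univ_four, hU] <;> norm_num)
  have hkey := eigenPoly_stationary han.differentiableAt hev hstat
  rw [hval] at hkey
  simp [hU] at hkey
  norm_num at hkey
/-! ### Cauchy estimates for analytic functions on the torus -/

section CauchyEstimates

open scoped NNReal ENNReal

variable {P E : Type*} [NormedAddCommGroup P] [NormedSpace ℝ P] [NormedAddCommGroup E]
  [NormedSpace ℝ E] {f : P → E} {x : P}

lemma nnnorm_changeOrigin_mul_pow_le (p : FormalMultilinearSeries ℝ P E) {r r' : ℝ≥0}
    (hr : (r + r' : ℝ≥0∞) < p.radius) (hx : ‖x‖₊ ≤ r) (k : ℕ) :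
    ‖p.changeOrigin x k‖₊ * r' ^ k ≤
      ∑' s : Σ k l : ℕ, { s : Finset (Fin (k + l)) // s.card = l },
        ‖p (s.1 + s.2.1)‖₊ * r ^ s.2.1 * r' ^ s.1 := by
  have hrad : (r : ℝ≥0∞) < p.radius := le_self_add.trans_lt hr
  have hsum := p.changeOriginSeries_summable_aux₁ hr
  have hsum_k := p.changeOriginSeries_summable_aux₂ hrad k
  calc ‖p.changeOrigin x k‖₊ * r' ^ k
      ≤ (∑' s : Σ l : ℕ, { s : Finset (Fin (k + l)) // s.card = l },
          ‖p (k + s.1)‖₊ * r ^ s.1) * r' ^ k := by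
        gcongr
        refine (p.nnnorm_changeOrigin_le k ((ENNReal.coe_le_coe.2 hx).trans_lt hrad)).trans ?_
        exact Summable.tsum_le_tsum (fun s => by gcongr)
          (NNReal.summable_of_le (fun s => by gcongr) hsum_k) hsum_k
    _ = ∑' s : Σ l : ℕ, { s : Finset (Fin (k + l)) // s.card = l },
          ‖p (k + s.1)‖₊ * r ^ s.1 * r' ^ k := (NNReal.tsum_mul_right _ _).symm
    _ ≤ _ := by
        rw [hsum.tsum_sigma' (NNReal.summable_sigma.1 hsum).1]
        exact (NNReal.summable_sigma.1 hsum).2.le_tsum k fun _ _ => zero_le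

variable [CompleteSpace E]

lemma norm_iteratedFDeriv_le_factorial_mul {p : FormalMultilinearSeries ℝ P E} {r : ℝ≥0∞}
    (h : HasFPowerSeriesOnBall f p x r) (k : ℕ) :
    ‖iteratedFDeriv ℝ k f x‖ ≤ k.factorial * ‖p k‖ := by
  refine ContinuousMultilinearMap.opNorm_le_bound (by positivity) fun v => ?_
  rw [h.iteratedFDeriv_eq_sum_of_completeSpace]
  calc ‖∑ σ : Equiv.Perm (Fin k), p k fun i => v (σ i)‖
      ≤ ∑ _σ : Equiv.Perm (Fin k), ‖p k‖ * ∏ i, ‖v i‖ := norm_sum_le_of_le _ fun σ _ => by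
        simpa only [Equiv.prod_comp σ fun i => ‖v i‖] using (p k).le_opNorm fun i => v (σ i)
    _ = k.factorial * ‖p k‖ * ∏ i, ‖v i‖ := by
        simp [Fintype.card_perm, mul_assoc]

lemma exists_cauchy_estimate_of_analyticAt (h : AnalyticAt ℝ f x) :
    ∃ C A : ℝ, 0 ≤ C ∧ 0 ≤ A ∧ ∀ᶠ y in 𝓝 x, ∀ k : ℕ,
      ‖iteratedFDeriv ℝ k f y‖ ≤ C * A ^ k * k.factorial := by
  obtain ⟨p, R, hp⟩ := h
  obtain ⟨r, hr_pos, hrR⟩ := ENNReal.lt_iff_exists_nnreal_btwn.1 hp.r_pos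
  have hr_pos : 0 < r := by exact_mod_cast hr_pos
  set ρ : ℝ≥0 := r / 2
  have hρ_pos : 0 < ρ := half_pos hr_pos
  have hρ_add : (ρ + ρ : ℝ≥0∞) < R := by rwa [← ENNReal.coe_add, add_halves]
  set S := ∑' s : Σ k l : ℕ, { s : Finset (Fin (k + l)) // s.card = l },
    ‖p (s.1 + s.2.1)‖₊ * ρ ^ s.2.1 * ρ ^ s.1
  refine ⟨S, (ρ : ℝ)⁻¹, by positivity, by positivity, ?_⟩
  filter_upwards [Metric.ball_mem_nhds x (NNReal.coe_pos.2 hρ_pos)] with y hy k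
  have hyρ : ‖y - x‖₊ < ρ := by simpa [dist_eq_norm, ← NNReal.coe_lt_coe] using hy
  have hpy := hp.changeOrigin ((ENNReal.coe_lt_coe.2 hyρ).trans (le_self_add.trans_lt hρ_add))
  rw [add_sub_cancel] at hpy
  have hcoeff : ‖p.changeOrigin (y - x) k‖ * (ρ : ℝ) ^ k ≤ S := by
    exact_mod_cast nnnorm_changeOrigin_mul_pow_le p (hρ_add.trans_le hp.r_le) hyρ.le k
  calc ‖iteratedFDeriv ℝ k f y‖ ≤ k.factorial * ‖p.changeOrigin (y - x) k‖ :=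
        norm_iteratedFDeriv_le_factorial_mul hpy k
    _ ≤ k.factorial * (S / (ρ : ℝ) ^ k) := by
        gcongr
        rwa [le_div_iff₀ (by positivity)]
    _ = S * (ρ : ℝ)⁻¹ ^ k * k.factorial := by rw [inv_pow]; ring

lemma exists_cauchy_estimate_of_isCompact {K : Set P} (hK : IsCompact K)
    (hf : AnalyticOnNhd ℝ f K) :
    ∃ C A : ℝ, 0 ≤ C ∧ 0 ≤ A ∧ ∀ y ∈ K, ∀ k : ℕ,
      ‖iteratedFDeriv ℝ k f y‖ ≤ C * A ^ k * k.factorial := by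
  refine hK.induction_on ⟨0, 0, le_rfl, le_rfl, by simp⟩ ?_ ?_ fun x hx => ?_
  · rintro s t hst ⟨C, A, hC, hA, hb⟩
    exact ⟨C, A, hC, hA, fun y hy => hb y (hst hy)⟩
  · rintro s t ⟨C, A, hC, hA, hb⟩ ⟨C', A', -, hA', hb'⟩
    refine ⟨max C C', max A A', le_max_of_le_left hC, le_max_of_le_left hA, ?_⟩
    rintro y (hy | hy) k
    · exact (hb y hy k).trans (by gcongr <;> exact le_max_left _ _)
    · exact (hb' y hy k).trans (by gcongr <;> exact le_max_right _ _)
  · obtain ⟨C, A, hC, hA, hb⟩ := exists_cauchy_estimate_of_analyticAt (hf x hx)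
    exact ⟨_, mem_nhdsWithin_of_mem_nhds hb, C, A, hC, hA, fun y hy => hy⟩

end CauchyEstimates

section Torus

variable {ι : Type*} [DecidableEq ι]

lemma apply_fract_eq_of_periodic [Finite ι] {β : Type*} {f : (ι → ℝ) → β}
    (hf : ∀ i, Function.Periodic f (Pi.single i 1)) (q : ι → ℝ) :
    f (fun i => Int.fract (q i)) = f q := by
  have := Fintype.ofFinite ι
  have hlattice : Function.Periodic f (∑ i, ⌊q i⌋ • Pi.single i 1) :=
    Finset.sum_induction _ _ (fun _ _ => Function.Periodic.add_period) (by simp [Function.Periodic])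
      fun i _ => (hf i).zsmul _
  rw [← hlattice fun i => Int.fract (q i)]
  congr 1
  ext i
  simp [Finset.sum_apply, Pi.single_apply]

lemma exists_mem_Icc_eq_of_periodic [Finite ι] {β : Type*} {f : (ι → ℝ) → β}
    (hf : ∀ i, Function.Periodic f (Pi.single i 1)) (q : ι → ℝ) :
    ∃ q' ∈ Set.Icc (0 : ι → ℝ) 1, f q' = f q :=
  ⟨_, ⟨fun _ => Int.fract_nonneg _, fun _ => (Int.fract_lt_one _).le⟩,
    apply_fract_eq_of_periodic hf q⟩

lemma exists_hasCauchyBound_of_periodic [Fintype ι] {E : Type*} [NormedAddCommGroup E]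
    [NormedSpace ℝ E] [CompleteSpace E] {f : (ι → ℝ) → E} (hf : AnalyticOnNhd ℝ f Set.univ)
    (hper : ∀ i, Function.Periodic f (Pi.single i 1)) :
    ∃ C A : ℝ, 0 ≤ A ∧ HasCauchyBound C A f := by
  obtain ⟨C, A, -, hA, hb⟩ := exists_cauchy_estimate_of_isCompact
    (isCompact_Icc (a := (0 : ι → ℝ)) (b := 1)) (hf.mono (Set.subset_univ _))
  refine ⟨C, A, hA, hf.contDiff, fun k q => ?_⟩
  have hper_k (i : ι) : Function.Periodic (iteratedFDeriv ℝ k f) (Pi.single i 1) := fun q => by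
    rw [← iteratedFDeriv_comp_add_right k, funext (hper i)]
  obtain ⟨q', hq', hqq'⟩ := exists_mem_Icc_eq_of_periodic hper_k q
  exact hqq' ▸ hb q' hq' k

lemma exists_pos_le_of_periodic [Finite ι] {f : (ι → ℝ) → ℝ} (hf : Continuous f)
    (hper : ∀ i, Function.Periodic f (Pi.single i 1)) (hpos : ∀ q, 0 < f q) :
    ∃ m : ℝ, 0 < m ∧ ∀ q, m ≤ f q := by
  obtain ⟨x, -, hx⟩ := (isCompact_Icc (a := (0 : ι → ℝ)) (b := 1)).exists_isMinOn
    (Set.nonempty_Icc.2 zero_le_one) hf.continuousOn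
  refine ⟨f x, hpos x, fun q => ?_⟩
  obtain ⟨q', hq', hqq'⟩ := exists_mem_Icc_eq_of_periodic hper q
  exact hqq' ▸ hx hq'

end Torus

section LiouvilleState

variable {L₁ L₂ : ℝ → ℝ}

lemma analyticOnNhd_liouvilleState (h₁ : AnalyticOnNhd ℝ L₁ Set.univ)
    (h₂ : AnalyticOnNhd ℝ L₂ Set.univ) :
    AnalyticOnNhd ℝ (liouvilleState L₁ L₂) Set.univ := fun q _ => by
  have a₁ : AnalyticAt ℝ (fun q : Plane => L₁ (q 0)) q :=
    (h₁ _ trivial).comp_of_eq ((ContinuousLinearMap.proj (R := ℝ) 0).analyticAt q) rfl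
  have a₂ : AnalyticAt ℝ (fun q : Plane => L₂ (q 1)) q :=
    (h₂ _ trivial).comp_of_eq ((ContinuousLinearMap.proj (R := ℝ) 1).analyticAt q) rfl
  refine analyticAt_pi_iff.2 fun k => ?_
  fin_cases k <;> simp only [liouvilleState] <;> first | exact analyticAt_const | skip
  · exact a₁.add a₂
  · exact (analyticAt_const.mul a₂).sub (analyticAt_const.mul a₁)

lemma doublyPeriodic_liouvilleState (p₁ : Function.Periodic L₁ 1) (p₂ : Function.Periodic L₂ 1) :
    DoublyPeriodic (liouvilleState L₁ L₂) := fun q i => by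
  ext k
  fin_cases i <;> simp [liouvilleState, p₁ _, p₂ _]

end LiouvilleState

/-! ### The symmetry as a quadratic evolution equation -/

/-- The part of the symmetry that is bilinear in `(U, DU)`. -/
noncomputable def symQuadratic : State →L[ℝ] (Plane →L[ℝ] State) →L[ℝ] State :=
  LinearMap.toContinuousLinearMap
    { toFun := fun U =>
        (Matrix.toLin' (symA U - symA 0)).toContinuousLinearMap ∘L
          ContinuousLinearMap.apply ℝ State (Pi.single 0 1 : Plane) +
        (Matrix.toLin' (symB U - symB 0)).toContinuousLinearMap ∘L
          ContinuousLinearMap.apply ℝ State (Pi.single 1 1 : Plane)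
      map_add' := fun U V => by
        ext T i
        fin_cases i <;>
          simp [symA, symB, dotProduct, Fin.sum_univ_four] <;> ring
      map_smul' := fun c U => by
        ext T i
        fin_cases i <;>
          simp [symA, symB, dotProduct, Fin.sum_univ_four] <;> ring }

/-- The part of the symmetry that is linear in `DU` and independent of `U`. -/
noncomputable def symLinear : (Plane →L[ℝ] State) →L[ℝ] State :=
  LinearMap.toContinuousLinearMap
    { toFun := fun T => symA 0 *ᵥ T (Pi.single 0 1) + symB 0 *ᵥ T (Pi.single 1 1)
      map_add' := fun S T => by
        simp only [add_apply, Matrix.mulVec_add]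
        abel
      map_smul' := fun c T => by
        simp only [smul_apply, Matrix.mulVec_smul, smul_add, RingHom.id_apply] }

lemma symQuadratic_add_symLinear (U : State) (T : Plane →L[ℝ] State) :
    symQuadratic U T + symLinear T =
      symA U *ᵥ T (Pi.single 0 1) + symB U *ᵥ T (Pi.single 1 1) := by
  simp only [symQuadratic, symLinear, LinearMap.coe_toContinuousLinearMap', LinearMap.coe_mk,
    AddHom.coe_mk, add_apply, ContinuousLinearMap.comp_apply, ContinuousLinearMap.apply_apply,
    Matrix.toLin'_apply, Matrix.sub_mulVec]
  abel
/-! ### Periodic functions of one variable -/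

section PeriodicFunctions

variable {L L₁ L₂ : ℝ → ℝ} {c : ℝ}

lemma periodic_deriv (hL : Function.Periodic L c) : Function.Periodic (deriv L) c := fun s => by
  rw [← deriv_comp_add_const, funext hL]

lemma exists_deriv_eq_zero_of_periodic (hc : 0 < c) (hL : Function.Periodic L c)
    (hcont : Continuous L) : ∃ ξ, deriv L ξ = 0 := by
  obtain ⟨ξ, -, hξ⟩ := exists_deriv_eq_zero hc hcont.continuousOn hL.eq.symm
  exact ⟨ξ, hξ⟩

lemma eq_of_monotone_of_periodic (hc : 0 < c) (hmono : Monotone L) (hL : Function.Periodic L c)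
    (x y : ℝ) : L x = L y := by
  wlog hxy : x ≤ y generalizing x y
  · exact (this y x (le_of_not_ge hxy)).symm
  obtain ⟨n, hn⟩ := Archimedean.arch (y - x) hc
  refine (hmono hxy).antisymm ?_
  calc L y ≤ L (x + n • c) := hmono (by linarith)
    _ = L x := hL.nsmul n x

lemma eq_of_deriv_deriv_eq_zero (hc : 0 < c) (hL : Function.Periodic L c)
    (hd : Differentiable ℝ L) (hd' : Differentiable ℝ (deriv L))
    (hzero : ∀ s, deriv (deriv L) s = 0) (s s' : ℝ) : L s = L s' := by
  obtain ⟨ξ, hξ⟩ := exists_deriv_eq_zero_of_periodic hc hL hd.continuous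
  exact is_const_of_deriv_eq_zero hd
    (fun x => (is_const_of_deriv_eq_zero hd' hzero x ξ).trans hξ) s s'

/- For `κ ≥ 0` the function `L' L''` is periodic with derivative `(L'')² + κ (L')² ≥ 0`, hence
constant. -/
lemma eq_of_deriv_deriv_deriv_eq_mul (hc : 0 < c) (hL : Function.Periodic L c)
    (hL₃ : ContDiff ℝ 3 L) {κ : ℝ} (hκ : 0 ≤ κ)
    (hode : ∀ s, deriv (deriv (deriv L)) s = κ * deriv L s) (s s' : ℝ) : L s = L s' := by
  have hd' : ContDiff ℝ 2 (deriv L) := (hL₃.of_le (by norm_num)).deriv'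
  have hd'' : ContDiff ℝ 1 (deriv (deriv L)) := (hd'.of_le (by norm_num)).deriv'
  set G := deriv L * deriv (deriv L)
  have hG (x) : HasDerivAt G (deriv (deriv L) x ^ 2 + κ * deriv L x ^ 2) x :=
    ((hd'.differentiable (by simp) x).hasDerivAt.mul
      (hd''.differentiable (by simp) x).hasDerivAt).congr_deriv (by rw [hode]; ring)
  have hG_const := eq_of_monotone_of_periodic hc
    (monotone_of_hasDerivAt_nonneg hG fun x => by positivity)
    ((periodic_deriv hL).mul (periodic_deriv (periodic_deriv hL)))
  refine eq_of_deriv_deriv_eq_zero hc hL (hL₃.differentiable (by simp))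
    (hd'.differentiable (by simp)) (fun x => ?_) s s'
  have hsum : deriv (deriv L) x ^ 2 + κ * deriv L x ^ 2 = 0 :=
    (hG x).unique ((hasDerivAt_const x (G x)).congr_of_eventuallyEq
      (.of_forall fun y => hG_const y x))
  have hnonneg : 0 ≤ κ * deriv L x ^ 2 := by positivity
  exact pow_eq_zero_iff two_ne_zero |>.1 (by nlinarith [sq_nonneg (deriv (deriv L) x)])

lemma exists_deriv_ne_zero (hd : Differentiable ℝ L) (hne : ∃ s s', L s ≠ L s') :
    ∃ x, deriv L x ≠ 0 := by
  by_contra! hzero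
  obtain ⟨s, s', hs⟩ := hne
  exact hs (is_const_of_deriv_eq_zero hd hzero s s')

lemma exists_deriv_deriv_ne (hc : 0 < c) (hL : Function.Periodic L₁ c)
    (hd : Differentiable ℝ L₁) (hd' : Differentiable ℝ (deriv L₁)) (hne : ∃ s s', L₁ s ≠ L₁ s') :
    ∃ x y, deriv (deriv L₁) x ≠ deriv (deriv L₂) y := by
  by_contra! hcon
  obtain ⟨ξ, hξ⟩ := exists_deriv_eq_zero_of_periodic hc (periodic_deriv hL) hd'.continuous
  obtain ⟨s, s', hs⟩ := hne
  exact hs (eq_of_deriv_deriv_eq_zero hc hL hd hd'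
    (fun x => (hcon x 0).trans ((hcon ξ 0).symm.trans hξ)) s s')

lemma exists_third_derivatives_ne_zero {c₁ c₂ : ℝ} (hc₁ : 0 < c₁) (hc₂ : 0 < c₂)
    (hL₁ : Function.Periodic L₁ c₁) (hL₂ : Function.Periodic L₂ c₂) (hd₁ : ContDiff ℝ 3 L₁)
    (hd₂ : ContDiff ℝ 3 L₂) (hne₁ : ∃ s s', L₁ s ≠ L₁ s') (hne₂ : ∃ s s', L₂ s ≠ L₂ s') :
    ∃ x y, deriv (deriv (deriv L₁)) x * deriv L₂ y +
      deriv L₁ x * deriv (deriv (deriv L₂)) y ≠ 0 := by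
  by_contra! hcon
  obtain ⟨x₀, hx₀⟩ := exists_deriv_ne_zero (hd₁.differentiable (by simp)) hne₁
  obtain ⟨y₀, hy₀⟩ := exists_deriv_ne_zero (hd₂.differentiable (by simp)) hne₂
  -- Separation of variables: `L₁''' / L₁' = κ = -L₂''' / L₂'`.
  set κ := -(deriv (deriv (deriv L₂)) y₀ / deriv L₂ y₀) with hκ
  have hode₁ (x) : deriv (deriv (deriv L₁)) x = κ * deriv L₁ x := by
    rw [hκ]
    field_simp
    linear_combination hcon x y₀
  have hode₂ (y) : deriv (deriv (deriv L₂)) y = -κ * deriv L₂ y := by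
    have hxy := hcon x₀ y
    rw [hode₁] at hxy
    exact mul_left_cancel₀ hx₀ (by linear_combination hxy)
  obtain ⟨s₁, s₁', hs₁⟩ := hne₁
  obtain ⟨s₂, s₂', hs₂⟩ := hne₂
  rcases le_total 0 κ with hpos | hneg
  · exact hs₁ (eq_of_deriv_deriv_deriv_eq_mul hc₁ hL₁ hd₁ hpos hode₁ s₁ s₁')
  · exact hs₂ (eq_of_deriv_deriv_deriv_eq_mul hc₂ hL₂ hd₂ (neg_nonneg.2 hneg) hode₂ s₂ s₂')

end PeriodicFunctions

/-! ### Components of the symmetry flow -/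

section SpaceTime

variable {Y : ℝ × Plane → ℝ} {t x y : ℝ}

lemma hasDerivAt_dX (h : DifferentiableAt ℝ Y (t, ![x, y])) :
    HasDerivAt (fun s => Y (t, ![s, y])) (dX Y (t, ![x, y])) x := by
  have hline : HasDerivAt (fun s : ℝ => (![s, y] : Plane)) (Pi.single 0 1) x :=
    hasDerivAt_pi.2 fun i => by
      fin_cases i
      · simpa using hasDerivAt_id' x
      · simpa using hasDerivAt_const x y
  exact h.hasFDerivAt.comp_hasDerivAt x ((hasDerivAt_const x t).prodMk hline)

lemma hasDerivAt_dY (h : DifferentiableAt ℝ Y (t, ![x, y])) :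
    HasDerivAt (fun s => Y (t, ![x, s])) (dY Y (t, ![x, y])) y := by
  have hline : HasDerivAt (fun s : ℝ => (![x, s] : Plane)) (Pi.single 1 1) y :=
    hasDerivAt_pi.2 fun i => by
      fin_cases i
      · simpa using hasDerivAt_const y x
      · simpa using hasDerivAt_id' y
  exact h.hasFDerivAt.comp_hasDerivAt y ((hasDerivAt_const y t).prodMk hline)

lemma eventually_mem_slab {P : Type*} {ε : ℝ} (hε : 0 < ε) (q : P) :
    ∀ᶠ t : ℝ in 𝓝 0, (t, q) ∈ slab P ε := by
  filter_upwards [Metric.ball_mem_nhds (0 : ℝ) hε] with t ht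
  simpa [slab] using ht

lemma eventually_ne_zero_of_dT_iterate {P : Type*} [NormedAddCommGroup P] [NormedSpace ℝ P]
    {Y : ℝ × P → ℝ} {q : P} {ε : ℝ} (hε : 0 < ε) (hY : AnalyticOnNhd ℝ Y (slab P ε)) (n : ℕ)
    (hne : (dirDeriv (1, 0))^[n] Y (0, q) ≠ 0) : ∀ᶠ t in 𝓝[≠] 0, Y (t, q) ≠ 0 := by
  have hmem := eventually_mem_slab hε q
  have han : AnalyticAt ℝ (fun t => Y (t, q)) 0 :=
    AnalyticAt.fun_comp (f := fun t : ℝ => (t, q)) (hY (0, q) hmem.self_of_nhds)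
      (analyticAt_id.prod analyticAt_const)
  refine han.eventually_eq_zero_or_eventually_ne_zero.resolve_left fun hzero => hne ?_
  clear hne han
  induction n generalizing Y with
  | zero => exact hzero.self_of_nhds
  | succ _ ih =>
    refine ih (analyticOnNhd_dirDeriv hY _) ?_
    filter_upwards [hzero.eventually_nhds, hmem] with t ht htε
    exact (hasDerivAt_time_slice (hY _ htε).differentiableAt).unique
      ((hasDerivAt_const t (0 : ℝ)).congr_of_eventuallyEq ht)

lemma dT_dT_dX_dY {ε : ℝ} (hY : AnalyticOnNhd ℝ Y (slab Plane ε)) :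
    Set.EqOn (dT (dT (dX (dY Y)))) (dX (dY (dT (dT Y)))) (slab Plane ε) := by
  have ho := isOpen_slab (P := Plane) ε
  have comm {Z : ℝ × Plane → ℝ} (hZ : AnalyticOnNhd ℝ Z (slab Plane ε)) (v w : ℝ × Plane) :
      Set.EqOn (dirDeriv v (dirDeriv w Z)) (dirDeriv w (dirDeriv v Z)) (slab Plane ε) :=
    fun z hz => dirDeriv_comm (hZ z hz) v w
  have dT_dX_dY {Z : ℝ × Plane → ℝ} (hZ : AnalyticOnNhd ℝ Z (slab Plane ε)) :
      Set.EqOn (dT (dX (dY Z))) (dX (dY (dT Z))) (slab Plane ε) :=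
    (comm (analyticOnNhd_dirDeriv hZ _) _ _).trans (dirDeriv_congr ho (comm hZ _ _) _)
  exact (dirDeriv_congr ho (dT_dX_dY hY) _).trans (dT_dX_dY (analyticOnNhd_dirDeriv hY _))

end SpaceTime

namespace IsSymmetryFlow

variable {ε : ℝ} {U₀ : Plane → State} {U : ℝ → Plane → State}

lemma analyticOnNhd_spaceTime (h : IsSymmetryFlow ε U₀ U) (k : Fin 4) :
    AnalyticOnNhd ℝ (fun z : ℝ × Plane => U z.1 z.2 k) (slab Plane ε) := fun z hz =>
  analyticAt_pi_iff.1 (h.1 z hz) k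

lemma analyticOnNhd_slice (h : IsSymmetryFlow ε U₀ U) {t : ℝ} (ht : |t| < ε) :
    AnalyticOnNhd ℝ (U t) Set.univ := fun q _ =>
  AnalyticAt.fun_comp (f := fun q : Plane => (t, q)) (h.1 (t, q) ht)
    (analyticAt_const.prod analyticAt_id)

lemma mono (h : IsSymmetryFlow ε U₀ U) {δ : ℝ} (hδε : δ ≤ ε) : IsSymmetryFlow δ U₀ U :=
  ⟨h.1.mono fun z (hz : |z.1| < δ) => hz.trans_le hδε, h.2.1,
    fun t ht => h.2.2 t (ht.trans_le hδε)⟩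

lemma pd_eq (h : IsSymmetryFlow ε U₀ U) {t : ℝ} (ht : |t| < ε) (q : Plane) (i : Fin 2)
    (k : Fin 4) : pd i (fun q => U t q k) q =
      dirDeriv (0, Pi.single i 1) (fun z : ℝ × Plane => U z.1 z.2 k) (t, q) :=
  dirDeriv_space_slice (Y := fun z : ℝ × Plane => U z.1 z.2 k)
    (h.analyticOnNhd_spaceTime k (t, q) ht).differentiableAt _

lemma magField_eq (h : IsSymmetryFlow ε U₀ U) {t : ℝ} (ht : |t| < ε) (q : Plane) :
    magField (U t) q = 1 / 4 * (dX (fun z => U z.1 z.2 3) (t, q) -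
      dY (fun z => U z.1 z.2 2) (t, q)) := by
  rw [magField, h.pd_eq ht, h.pd_eq ht]

lemma dT_eq (h : IsSymmetryFlow ε U₀ U) {z : ℝ × Plane} (hz : z ∈ slab Plane ε) (k : Fin 4) :
    dT (fun z => U z.1 z.2 k) z =
      (symA (U z.1 z.2) *ᵥ pd 0 (U z.1) z.2 + symB (U z.1 z.2) *ᵥ pd 1 (U z.1) z.2) k := by
  obtain ⟨t, q⟩ := z
  have hcomp (k) : HasDerivAt (fun s => U s q k) (dT (fun z => U z.1 z.2 k) (t, q)) t :=
    hasDerivAt_time_slice (Y := fun z : ℝ × Plane => U z.1 z.2 k)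
      (h.analyticOnNhd_spaceTime k (t, q) hz).differentiableAt
  rw [← h.2.2 t hz q]
  exact (congrFun (hasDerivAt_pi.2 hcomp).deriv k).symm

theorem evolutionSolution (h : IsSymmetryFlow ε U₀ U) :
    EvolutionSolution ε (fun z => U z.1 z.2 0) (fun z => U z.1 z.2 1) (fun z => U z.1 z.2 2)
      (fun z => U z.1 z.2 3) := by
  have hpd : ∀ z ∈ slab Plane ε, ∀ i k, pd i (U z.1) z.2 k =
      dirDeriv (0, Pi.single i 1) (fun z => U z.1 z.2 k) z := by
    rintro ⟨t, q⟩ hz i k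
    exact (pd_apply (h.analyticOnNhd_slice hz q (Set.mem_univ q)).differentiableAt i k).symm.trans
      (h.pd_eq hz q i k)
  refine ⟨h.analyticOnNhd_spaceTime 0, h.analyticOnNhd_spaceTime 1, h.analyticOnNhd_spaceTime 2,
    h.analyticOnNhd_spaceTime 3, fun z hz => ?_, fun z hz => ?_, fun z hz => ?_, fun z hz => ?_⟩ <;>
  · rw [h.dT_eq hz]
    simp [symA, symB, dotProduct, Fin.sum_univ_four, hpd z hz]
    try ring

theorem unique (h : IsSymmetryFlow ε U₀ U) {W : ℝ → Plane → State}
    (hW : IsSymmetryFlow ε U₀ W) (hε : 0 < ε) {t : ℝ} (ht : |t| < ε) : W t = U t := by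
  have hinit (q k) : W 0 q k = U 0 q k := by rw [hW.2.1, h.2.1]
  funext q k
  obtain ⟨hΛ, hu, hf, hg⟩ := hW.evolutionSolution.unique h.evolutionSolution hε
    (hinit · 0) (hinit · 1) (hinit · 2) (hinit · 3) (t, q) ht
  fin_cases k
  exacts [hΛ, hu, hf, hg]

end IsSymmetryFlow
/-! ### Taylor coefficients at a Liouville metric -/

section LiouvilleData

variable {ε : ℝ} {L u f g : ℝ × Plane → ℝ} {L₁ L₂ : ℝ → ℝ}

/-- An analytic solution of the evolution system, in components, whose initial value is a Liouville
metric `L₁(x) + L₂(y)` without magnetic field. -/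
structure HasLiouvilleData (ε : ℝ) (L u f g : ℝ × Plane → ℝ) (L₁ L₂ : ℝ → ℝ) : Prop where
  pos : 0 < ε
  sol : EvolutionSolution ε L u f g
  an₁ : AnalyticOnNhd ℝ L₁ Set.univ
  an₂ : AnalyticOnNhd ℝ L₂ Set.univ
  initL : ∀ x y, L (0, ![x, y]) = L₁ x + L₂ y
  initu : ∀ x y, u (0, ![x, y]) = 2 * L₂ y - 2 * L₁ x
  initf : ∀ x y, f (0, ![x, y]) = 0
  initg : ∀ x y, g (0, ![x, y]) = 0

namespace HasLiouvilleData

lemma mem (h : HasLiouvilleData ε L u f g L₁ L₂) (q : Plane) : ((0 : ℝ), q) ∈ slab Plane ε :=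
  (eventually_mem_slab h.pos q).self_of_nhds

lemma dX_eq (h : HasLiouvilleData ε L u f g L₁ L₂) {Y : ℝ × Plane → ℝ}
    (hY : AnalyticOnNhd ℝ Y (slab Plane ε)) {x y : ℝ} {k : ℝ → ℝ} {d : ℝ}
    (he : ∀ x, Y (0, ![x, y]) = k x) (hk : HasDerivAt k d x) : dX Y (0, ![x, y]) = d :=
  (hasDerivAt_dX (hY _ (h.mem ![x, y])).differentiableAt).unique (funext he ▸ hk)

lemma dY_eq (h : HasLiouvilleData ε L u f g L₁ L₂) {Y : ℝ × Plane → ℝ}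
    (hY : AnalyticOnNhd ℝ Y (slab Plane ε)) {x y : ℝ} {k : ℝ → ℝ} {d : ℝ}
    (he : ∀ y, Y (0, ![x, y]) = k y) (hk : HasDerivAt k d y) : dY Y (0, ![x, y]) = d :=
  (hasDerivAt_dY (hY _ (h.mem ![x, y])).differentiableAt).unique (funext he ▸ hk)

lemma first_derivatives (h : HasLiouvilleData ε L u f g L₁ L₂) (x y : ℝ) :
    dX L (0, ![x, y]) = deriv L₁ x ∧ dY L (0, ![x, y]) = deriv L₂ y ∧
    dX u (0, ![x, y]) = -2 * deriv L₁ x ∧ dY u (0, ![x, y]) = 2 * deriv L₂ y ∧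
    dX f (0, ![x, y]) = 0 ∧ dY f (0, ![x, y]) = 0 ∧
    dX g (0, ![x, y]) = 0 ∧ dY g (0, ![x, y]) = 0 := by
  have d₁ := (h.an₁ x (Set.mem_univ x)).differentiableAt.hasDerivAt
  have d₂ := (h.an₂ y (Set.mem_univ y)).differentiableAt.hasDerivAt
  exact ⟨h.dX_eq h.sol.anL (h.initL · y) (d₁.add_const _),
    h.dY_eq h.sol.anL (h.initL x) (d₂.const_add _),
    h.dX_eq h.sol.anu (h.initu · y) (((d₁.const_mul 2).const_sub _).congr_deriv (by ring)),
    h.dY_eq h.sol.anu (h.initu x) ((d₂.const_mul 2).sub_const _),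
    h.dX_eq h.sol.anf (h.initf · y) (hasDerivAt_const _ _),
    h.dY_eq h.sol.anf (h.initf x) (hasDerivAt_const _ _),
    h.dX_eq h.sol.ang (h.initg · y) (hasDerivAt_const _ _),
    h.dY_eq h.sol.ang (h.initg x) (hasDerivAt_const _ _)⟩

lemma second_derivatives (h : HasLiouvilleData ε L u f g L₁ L₂) (x y : ℝ) :
    dX (dX L) (0, ![x, y]) = deriv (deriv L₁) x ∧
    dX (dX u) (0, ![x, y]) = -2 * deriv (deriv L₁) x ∧
    dY (dY u) (0, ![x, y]) = 2 * deriv (deriv L₂) y := by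
  have d₁ := (h.an₁.deriv x (Set.mem_univ x)).differentiableAt.hasDerivAt
  have d₂ := (h.an₂.deriv y (Set.mem_univ y)).differentiableAt.hasDerivAt
  have ux (x) := (h.first_derivatives x y).2.2.1
  have uy (y) := (h.first_derivatives x y).2.2.2.1
  exact ⟨h.dX_eq (analyticOnNhd_dirDeriv h.sol.anL _) (fun x => (h.first_derivatives x y).1) d₁,
    h.dX_eq (analyticOnNhd_dirDeriv h.sol.anu _) ux (d₁.const_mul _),
    h.dY_eq (analyticOnNhd_dirDeriv h.sol.anu _) uy (d₂.const_mul _)⟩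

lemma residuals_eq_zero (h : HasLiouvilleData ε L u f g L₁ L₂) {z : ℝ × Plane}
    (hz : z ∈ slab Plane ε) : resDiv f g z = 0 ∧ resFlux L f g z = 0 ∧ resX L u f g z = 0 ∧
      resY L u f g z = 0 := by
  have hinit (x y : ℝ) : resDiv f g (0, ![x, y]) = 0 ∧ resFlux L f g (0, ![x, y]) = 0 ∧
      resX L u f g (0, ![x, y]) = 0 ∧ resY L u f g (0, ![x, y]) = 0 := by
    obtain ⟨Lx, Ly, ux, uy, fx, fy, gx, gy⟩ := h.first_derivatives x y
    simp only [resDiv, resFlux, resX, resY, Lx, Ly, ux, uy, fx, fy, gx, gy, h.initf, h.initg]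
    refine ⟨?_, ?_, ?_, ?_⟩ <;> ring
  have hq (q : Plane) : ![q 0, q 1] = q := List.ofFn_injective rfl
  exact h.sol.residuals_eq_zero h.pos (fun q => hq q ▸ (hinit _ _).1)
    (fun q => hq q ▸ (hinit _ _).2.1) (fun q => hq q ▸ (hinit _ _).2.2.1)
    (fun q => hq q ▸ (hinit _ _).2.2.2) hz

lemma dT_dX_g (h : HasLiouvilleData ε L u f g L₁ L₂) (x y : ℝ) :
    dT (dX g) (0, ![x, y]) = 4 * deriv (deriv L₁) x := by
  have hm := h.mem ![x, y]
  calc dT (dX g) (0, ![x, y])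
      = dX (fun z => -2 * dX u z) (0, ![x, y]) :=
        EvolutionSolution.dT_dirDeriv (h.sol.ang _ hm) h.sol.dTg hm _
    _ = -2 * dX (dX u) (0, ![x, y]) :=
        dirDeriv_const_mul _ (analyticAt_dirDeriv (h.sol.anu _ hm) _).differentiableAt
    _ = 4 * deriv (deriv L₁) x := by rw [(h.second_derivatives x y).2.1]; ring

lemma dT_dY_f (h : HasLiouvilleData ε L u f g L₁ L₂) (x y : ℝ) :
    dT (dY f) (0, ![x, y]) = 4 * deriv (deriv L₂) y := by
  have hm := h.mem ![x, y]
  calc dT (dY f) (0, ![x, y])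
      = dY (fun z => 2 * dY u z) (0, ![x, y]) :=
        EvolutionSolution.dT_dirDeriv (h.sol.anf _ hm) h.sol.dTf hm _
    _ = 2 * dY (dY u) (0, ![x, y]) :=
        dirDeriv_const_mul _ (analyticAt_dirDeriv (h.sol.anu _ hm) _).differentiableAt
    _ = 4 * deriv (deriv L₂) y := by rw [(h.second_derivatives x y).2.2]; ring

lemma dT_curl (h : HasLiouvilleData ε L u f g L₁ L₂) (x y : ℝ) :
    dT (fun z => dX g z - dY f z) (0, ![x, y]) =
      4 * (deriv (deriv L₁) x - deriv (deriv L₂) y) := by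
  have hm := h.mem ![x, y]
  calc dT (fun z => dX g z - dY f z) (0, ![x, y])
      = dT (dX g) (0, ![x, y]) - dT (dY f) (0, ![x, y]) :=
        dirDeriv_sub (analyticAt_dirDeriv (h.sol.ang _ hm) _).differentiableAt
          (analyticAt_dirDeriv (h.sol.anf _ hm) _).differentiableAt
    _ = 4 * (deriv (deriv L₁) x - deriv (deriv L₂) y) := by
        rw [h.dT_dX_g, h.dT_dY_f, mul_sub]

lemma dT_dT_conformalFactor (h : HasLiouvilleData ε L u f g L₁ L₂) (x y : ℝ) :
    dT (dT L) (0, ![x, y]) = 4 * (deriv L₁ x ^ 2 + deriv L₂ y ^ 2 +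
      (L₁ x + L₂ y) * (deriv (deriv L₁) x + deriv (deriv L₂) y)) := by
  have hm := h.mem ![x, y]
  obtain ⟨Lx, Ly, ux, uy, -, fy, gx, -⟩ := h.first_derivatives x y
  have hL := h.sol.anL _ hm
  have hf := h.sol.anf _ hm
  have hg := h.sol.ang _ hm
  rw [dT, dirDeriv_congr (isOpen_slab ε) h.sol.dTL _ hm]
  simp (disch := exact AnalyticAt.differentiableAt (by fun_prop)) only
    [dirDeriv_add, dirDeriv_mul]
  simp only [h.dT_dX_g, h.dT_dY_f, h.sol.dTg _ hm, h.sol.dTf _ hm, Lx, Ly, ux, uy, fy, gx,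
    h.initL, h.initf, h.initg]
  ring

lemma dT_dT_dX_dY_conformalFactor (h : HasLiouvilleData ε L u f g L₁ L₂) (x y : ℝ) :
    dT (dT (dX (dY L))) (0, ![x, y]) = 4 * (deriv (deriv (deriv L₁)) x * deriv L₂ y +
      deriv L₁ x * deriv (deriv (deriv L₂)) y) := by
  have d₁ := (h.an₁ x (Set.mem_univ x)).differentiableAt.hasDerivAt
  have d₁'' := (h.an₁.deriv.deriv x (Set.mem_univ x)).differentiableAt.hasDerivAt
  have d₂ := (h.an₂ y (Set.mem_univ y)).differentiableAt.hasDerivAt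
  have d₂' := (h.an₂.deriv y (Set.mem_univ y)).differentiableAt.hasDerivAt
  have d₂'' := (h.an₂.deriv.deriv y (Set.mem_univ y)).differentiableAt.hasDerivAt
  have hZ := analyticOnNhd_dirDeriv (analyticOnNhd_dirDeriv h.sol.anL (1, 0)) (1, 0)
  have hy (x) : dY (dT (dT L)) (0, ![x, y]) = 4 * (2 * deriv L₂ y * deriv (deriv L₂) y +
      (deriv L₂ y * (deriv (deriv L₁) x + deriv (deriv L₂) y) +
        (L₁ x + L₂ y) * deriv (deriv (deriv L₂)) y)) :=
    h.dY_eq hZ (h.dT_dT_conformalFactor x)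
      ((((d₂'.pow 2).const_add _).add
        ((d₂.const_add _).mul (d₂''.const_add _))).const_mul 4 |>.congr_deriv (by simp))
  rw [dT_dT_dX_dY h.sol.anL (h.mem _)]
  exact h.dX_eq (analyticOnNhd_dirDeriv hZ _) hy
    ((((d₁''.add_const _).const_mul _).add ((d₁.add_const _).mul_const _)).const_add _
      |>.const_mul 4 |>.congr_deriv (by ring))

end HasLiouvilleData

theorem IsSymmetryFlow.hasLiouvilleData {U : ℝ → Plane → State} (hε : 0 < ε)
    (h₁ : AnalyticOnNhd ℝ L₁ Set.univ) (h₂ : AnalyticOnNhd ℝ L₂ Set.univ)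
    (hU : IsSymmetryFlow ε (liouvilleState L₁ L₂) U) :
    HasLiouvilleData ε (fun z => U z.1 z.2 0) (fun z => U z.1 z.2 1) (fun z => U z.1 z.2 2)
      (fun z => U z.1 z.2 3) L₁ L₂ := by
  refine ⟨hε, hU.evolutionSolution, h₁, h₂, ?_, ?_, ?_, ?_⟩ <;> intro x y <;>
    simp [hU.2.1, liouvilleState]

end LiouvilleData
/-! ### Closeness in `C^k` -/

section CkClose

lemma norm_iteratedFDeriv_component_le {P ι : Type*} [NormedAddCommGroup P] [NormedSpace ℝ P]
    [Fintype ι] {W : P → ι → ℝ} {k : ℕ} {q : P} (hW : ContDiffAt ℝ k W q) (i : ι) :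
    ‖iteratedFDeriv ℝ k (fun q => W q i) q‖ ≤ ‖iteratedFDeriv ℝ k W q‖ := by
  refine ((ContinuousLinearMap.proj (R := ℝ) (φ := fun _ : ι => ℝ)
    i).norm_iteratedFDeriv_comp_left hW le_rfl).trans (mul_le_of_le_one_left (norm_nonneg _) ?_)
  exact ContinuousLinearMap.opNorm_le_bound _ zero_le_one fun x =>
    (norm_le_pi_norm x i).trans_eq (one_mul _).symm

/-- The magnetic field `¼ (g_x - f_y)` as a linear function of the derivative of the state. -/
noncomputable def curlMap : (Plane →L[ℝ] State) →L[ℝ] ℝ :=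
  (1 / 4 : ℝ) • (ContinuousLinearMap.proj (R := ℝ) (φ := fun _ : Fin 4 => ℝ) 3 ∘L
      ContinuousLinearMap.apply ℝ State (Pi.single 0 1 : Plane) -
    ContinuousLinearMap.proj (R := ℝ) (φ := fun _ : Fin 4 => ℝ) 2 ∘L
      ContinuousLinearMap.apply ℝ State (Pi.single 1 1 : Plane))

lemma magField_eq_curlMap {W : Plane → State} {q : Plane} (hW : DifferentiableAt ℝ W q) :
    magField W q = curlMap (fderiv ℝ W q) := by
  rw [magField, pd_apply hW, pd_apply hW]
  rfl

lemma magField_liouvilleState (L₁ L₂ : ℝ → ℝ) :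
    magField (liouvilleState L₁ L₂) = fun _ => 0 := by
  funext q
  simp [magField, liouvilleState, pd]

variable {U V : Plane → State} {k : ℕ} {δ : ℝ}

lemma ckClose_confFactor (hU : ContDiff ℝ k U) (hV : ContDiff ℝ k V)
    (hb : ∀ j ≤ k, ∀ q, ‖iteratedFDeriv ℝ j (fun q => U q - V q) q‖ ≤ δ) :
    CkClose k δ (confFactor U) (confFactor V) := fun j hj q =>
  (norm_iteratedFDeriv_component_le
    ((hU.sub hV).contDiffAt.of_le (by exact_mod_cast hj)) 0).trans (hb j hj q)

lemma ckClose_magField (hU : ContDiff ℝ (k + 1) U) (hV : ContDiff ℝ (k + 1) V)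
    (hb : ∀ j ≤ k, ∀ q, ‖curlMap‖ * ‖iteratedFDeriv ℝ (j + 1) (fun q => U q - V q) q‖ ≤ δ) :
    CkClose k δ (magField U) (magField V) := fun j hj q => by
  have hcurl : (fun q => magField U q - magField V q) =
      curlMap ∘ fderiv ℝ fun q => U q - V q := by
    funext q
    have dU := hU.differentiable (by simp) q
    have dV := hV.differentiable (by simp) q
    rw [magField_eq_curlMap dU, magField_eq_curlMap dV, ← map_sub, ← fderiv_fun_sub dU dV]
    rfl
  have hderiv : ContDiff ℝ k (fderiv ℝ fun q => U q - V q) :=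
    (hU.sub hV).fderiv_right le_rfl
  rw [hcurl]
  refine (curlMap.norm_iteratedFDeriv_comp_left hderiv.contDiffAt
    (by exact_mod_cast hj)).trans ?_
  rw [norm_iteratedFDeriv_fderiv]
  exact hb j hj q

namespace CkClose

variable {u v : Plane → ℝ}

lemma abs_sub_le (h : CkClose k δ u v) (q : Plane) : |u q - v q| ≤ δ := by
  simpa using h 0 (Nat.zero_le k) q

lemma abs_dirDeriv_dirDeriv_sub_le (h : CkClose k δ u v) (hk : 2 ≤ k)
    (hu : AnalyticOnNhd ℝ u Set.univ) (hv : AnalyticOnNhd ℝ v Set.univ) (a b q : Plane) :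
    |dirDeriv a (dirDeriv b u) q - dirDeriv a (dirDeriv b v) q| ≤ δ * (‖a‖ * ‖b‖) := by
  have hsub : dirDeriv a (dirDeriv b fun q => u q - v q) q =
      dirDeriv a (dirDeriv b u) q - dirDeriv a (dirDeriv b v) q := by
    rw [← dirDeriv_sub (analyticOnNhd_dirDeriv hu b q trivial).differentiableAt
      (analyticOnNhd_dirDeriv hv b q trivial).differentiableAt]
    exact dirDeriv_congr isOpen_univ (fun q _ => dirDeriv_sub (hu q trivial).differentiableAt
      (hv q trivial).differentiableAt) a trivial
  have hiter : dirDeriv a (dirDeriv b fun q => u q - v q) q =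
      iteratedFDeriv ℝ 2 (fun q => u q - v q) q ![a, b] := by
    rw [dirDeriv_dirDeriv_apply ((hu q trivial).fun_sub (hv q trivial)),
      iteratedFDeriv_two_apply]
    rfl
  rw [← hsub, hiter, ← Real.norm_eq_abs]
  refine (ContinuousMultilinearMap.le_opNorm _ _).trans ?_
  rw [Fin.prod_univ_two]
  exact mul_le_mul_of_nonneg_right (h 2 hk q) (by positivity)

end CkClose

lemma eventually_mul_abs_lt (c : ℝ) (hδ : 0 < δ) : ∀ᶠ t : ℝ in 𝓝 0, c * |t| < δ :=
  (continuous_const.mul continuous_abs).continuousAt.eventually_lt_const (by simpa using hδ)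

end CkClose

/-! ### The symmetry flow of a Liouville metric -/

namespace IsSymmetryFlow

variable {ε : ℝ} {U₀ : Plane → State} {U : ℝ → Plane → State}

lemma eventually_ckClose (h : IsSymmetryFlow ε U₀ U) (hε : 0 < ε)
    (hb : ∀ k, ∃ M : ℝ, ∀ t, |t| < ε → ∀ q,
      ‖iteratedFDeriv ℝ k (fun q => U t q - U₀ q) q‖ ≤ M * |t|)
    (k : ℕ) {δ : ℝ} (hδ : 0 < δ) :
    ∀ᶠ t in 𝓝 0, CkClose k δ (confFactor (U t)) (confFactor U₀) ∧
      CkClose k δ (magField (U t)) (magField U₀) := by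
  choose M hM using hb
  have hsmooth {t : ℝ} (ht : |t| < ε) (n : ℕ∞ω) : ContDiff ℝ n (U t) :=
    (h.analyticOnNhd_slice ht).contDiff
  have hsmooth₀ (n : ℕ∞ω) : ContDiff ℝ n U₀ := h.2.1 ▸ hsmooth (by simpa using hε) n
  have hsmall : ∀ᶠ t : ℝ in 𝓝 0, ∀ j ∈ Finset.range (k + 1),
      M j * |t| < δ ∧ ‖curlMap‖ * M (j + 1) * |t| < δ :=
    (Finset.eventually_all _).2 fun j _ =>
      (eventually_mul_abs_lt _ hδ).and (eventually_mul_abs_lt _ hδ)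
  filter_upwards [eventually_mem_slab hε (0 : Plane), hsmall] with t ht hj
  refine ⟨ckClose_confFactor (hsmooth ht _) (hsmooth₀ _) fun j hjk q => ?_,
    ckClose_magField (hsmooth ht _) (hsmooth₀ _) fun j hjk q => ?_⟩
  · exact (hM j t ht q).trans (hj j (Finset.mem_range_succ_iff.2 hjk)).1.le
  · calc _ ≤ ‖curlMap‖ * (M (j + 1) * |t|) := by gcongr; exact hM (j + 1) t ht q
      _ = ‖curlMap‖ * M (j + 1) * |t| := (mul_assoc _ _ _).symm
      _ ≤ δ := (hj j (Finset.mem_range_succ_iff.2 hjk)).2.le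

lemma analyticOnNhd_confFactor (h : IsSymmetryFlow ε U₀ U) {t : ℝ} (ht : |t| < ε) :
    AnalyticOnNhd ℝ (confFactor (U t)) Set.univ :=
  analyticOnNhd_component (h.analyticOnNhd_slice ht) 0

lemma dirDeriv_dirDeriv_confFactor (h : IsSymmetryFlow ε U₀ U) {t : ℝ} (ht : |t| < ε)
    (v w q : Plane) : dirDeriv v (dirDeriv w (confFactor (U t))) q =
      dirDeriv (0, v) (dirDeriv (0, w) fun z => U z.1 z.2 0) (t, q) := by
  have han := h.analyticOnNhd_spaceTime 0
  have hw : dirDeriv w (confFactor (U t)) =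
      fun q => dirDeriv (0, w) (fun z : ℝ × Plane => U z.1 z.2 0) (t, q) :=
    funext fun q => dirDeriv_space_slice (Y := fun z : ℝ × Plane => U z.1 z.2 0)
      (han (t, q) ht).differentiableAt w
  rw [hw]
  exact dirDeriv_space_slice (analyticOnNhd_dirDeriv han _ (t, q) ht).differentiableAt v

lemma eventually_confFactor_pos
    (hclose : ∀ δ > 0, ∀ᶠ t in 𝓝 0, CkClose 0 δ (confFactor (U t)) (confFactor U₀))
    (hcont : Continuous U₀) (hper : DoublyPeriodic U₀) (hpos : ∀ q, 0 < confFactor U₀ q) :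
    ∀ᶠ t in 𝓝 0, ∀ q, 0 < confFactor (U t) q := by
  obtain ⟨m, hm, hmin⟩ := exists_pos_le_of_periodic (f := confFactor U₀)
    (continuous_pi_iff.1 hcont 0) (fun i q => congrFun (hper q i) 0) hpos
  filter_upwards [hclose (m / 2) (half_pos hm)] with t ht q
  linarith [hmin q, (abs_le.1 (ht.abs_sub_le q)).1]

variable {L₁ L₂ : ℝ → ℝ}

theorem solvesSystem (h : IsSymmetryFlow ε (liouvilleState L₁ L₂) U)
    (h₁ : AnalyticOnNhd ℝ L₁ Set.univ) (h₂ : AnalyticOnNhd ℝ L₂ Set.univ) {t : ℝ}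
    (ht : |t| < ε) : SolvesSystem magA magB (U t) := fun q => by
  have hdata := h.hasLiouvilleData ((abs_nonneg t).trans_lt ht) h₁ h₂
  obtain ⟨hdiv, hflux, hx, hy⟩ := hdata.residuals_eq_zero (z := (t, q)) ht
  rw [magSystem_eq_zero_iff (h.analyticOnNhd_slice ht q trivial).differentiableAt,
    h.magField_eq ht]
  simp only [h.pd_eq ht]
  simp only [resDiv, resFlux, resX, resY] at hdiv hflux hx hy
  exact ⟨by linear_combination hdiv, by linear_combination hflux, by linear_combination hx,
    by linear_combination hy⟩

lemma eventually_magField_ne_zero (h : IsSymmetryFlow ε (liouvilleState L₁ L₂) U) (hε : 0 < ε)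
    (h₁ : AnalyticOnNhd ℝ L₁ Set.univ) (h₂ : AnalyticOnNhd ℝ L₂ Set.univ) {x y : ℝ}
    (hxy : deriv (deriv L₁) x ≠ deriv (deriv L₂) y) :
    ∀ᶠ t in 𝓝[≠] 0, magField (U t) ![x, y] ≠ 0 := by
  have hdata := h.hasLiouvilleData hε h₁ h₂
  have hcurl := eventually_ne_zero_of_dT_iterate hε (q := ![x, y])
    ((analyticOnNhd_dirDeriv hdata.sol.ang (0, Pi.single 0 1)).sub
      (analyticOnNhd_dirDeriv hdata.sol.anf (0, Pi.single 1 1))) 1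
    ((hdata.dT_curl x y).trans_ne (mul_ne_zero four_ne_zero (sub_ne_zero.2 hxy)))
  filter_upwards [hcurl, nhdsWithin_le_nhds (eventually_mem_slab hε (0 : Plane))] with t ht htε
  rw [h.magField_eq htε]
  exact mul_ne_zero (by norm_num) ht

lemma eventually_dirDeriv_dirDeriv_confFactor_ne_zero
    (h : IsSymmetryFlow ε (liouvilleState L₁ L₂) U) (hε : 0 < ε)
    (h₁ : AnalyticOnNhd ℝ L₁ Set.univ) (h₂ : AnalyticOnNhd ℝ L₂ Set.univ) {x y : ℝ}
    (hxy : deriv (deriv (deriv L₁)) x * deriv L₂ y +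
      deriv L₁ x * deriv (deriv (deriv L₂)) y ≠ 0) :
    ∀ᶠ t in 𝓝[≠] 0, dirDeriv (Pi.single 0 1) (dirDeriv (Pi.single 1 1) (confFactor (U t)))
      ![x, y] ≠ 0 := by
  have hdata := h.hasLiouvilleData hε h₁ h₂
  have hmixed := eventually_ne_zero_of_dT_iterate hε (q := ![x, y])
    (analyticOnNhd_dirDeriv (analyticOnNhd_dirDeriv hdata.sol.anL (0, Pi.single 1 1))
      (0, Pi.single 0 1)) 2
    ((hdata.dT_dT_dX_dY_conformalFactor x y).trans_ne (mul_ne_zero four_ne_zero hxy))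
  filter_upwards [hmixed, nhdsWithin_le_nhds (eventually_mem_slab hε (0 : Plane))] with t ht htε
  rwa [h.dirDeriv_dirDeriv_confFactor htε]

lemma dirDeriv_dirDeriv_confFactor_ne_zero_of_ckClose
    (h : IsSymmetryFlow ε (liouvilleState L₁ L₂) U) (hε : 0 < ε)
    (h₁ : AnalyticOnNhd ℝ L₁ Set.univ) (h₂ : AnalyticOnNhd ℝ L₂ Set.univ) {x t : ℝ}
    (ht : |t| < ε)
    (hclose : CkClose 2 (|deriv (deriv L₁) x| / 2) (confFactor (U t))
      (confFactor (liouvilleState L₁ L₂))) (hx : deriv (deriv L₁) x ≠ 0) (y : ℝ) :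
    dirDeriv (Pi.single 0 1) (dirDeriv (Pi.single 0 1) (confFactor (U t))) ![x, y] ≠ 0 := by
  have hε₀ : |(0 : ℝ)| < ε := by simpa using hε
  have hinit : dirDeriv (Pi.single 0 1) (dirDeriv (Pi.single 0 1)
      (confFactor (liouvilleState L₁ L₂))) ![x, y] = deriv (deriv L₁) x := by
    rw [← h.2.1, h.dirDeriv_dirDeriv_confFactor hε₀]
    exact ((h.hasLiouvilleData hε h₁ h₂).second_derivatives x y).1
  have hbound := hclose.abs_dirDeriv_dirDeriv_sub_le le_rfl (h.analyticOnNhd_confFactor ht)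
    (h.2.1 ▸ h.analyticOnNhd_confFactor hε₀) (Pi.single 0 1) (Pi.single 0 1) ![x, y]
  intro hzero
  rw [hinit, hzero, zero_sub, abs_neg, Pi.norm_single, norm_one] at hbound
  linarith [abs_pos.2 hx]

theorem eventually_not_isLiouvilleMetric (h : IsSymmetryFlow ε (liouvilleState L₁ L₂) U)
    (hε : 0 < ε) (h₁ : AnalyticOnNhd ℝ L₁ Set.univ) (h₂ : AnalyticOnNhd ℝ L₂ Set.univ)
    (p₁ : Function.Periodic L₁ 1) (p₂ : Function.Periodic L₂ 1)
    (n₁ : ∃ s s', L₁ s ≠ L₁ s') (n₂ : ∃ s s', L₂ s ≠ L₂ s')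
    (hper : ∀ t, DoublyPeriodic (U t)) (hpos : ∀ᶠ t in 𝓝 0, ∀ q, 0 < confFactor (U t) q)
    (hclose : ∀ δ > 0, ∀ᶠ t in 𝓝 0, CkClose 2 δ (confFactor (U t))
      (confFactor (liouvilleState L₁ L₂))) :
    ∀ᶠ t in 𝓝[≠] 0, ¬IsLiouvilleMetric (conformalMetric (confFactor (U t))) := by
  obtain ⟨x₀, hx₀⟩ : ∃ x, deriv (deriv L₁) x ≠ 0 := by
    simpa using exists_deriv_deriv_ne (L₂ := 0) one_pos p₁ h₁.contDiff.differentiable_one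
      h₁.deriv.contDiff.differentiable_one n₁
  obtain ⟨x, y, hxy⟩ := exists_third_derivatives_ne_zero one_pos one_pos p₁ p₂ h₁.contDiff
    h₂.contDiff n₁ n₂
  filter_upwards [h.eventually_dirDeriv_dirDeriv_confFactor_ne_zero hε h₁ h₂ hxy,
    nhdsWithin_le_nhds (eventually_mem_slab hε (0 : Plane)), nhdsWithin_le_nhds hpos,
    nhdsWithin_le_nhds (hclose _ (half_pos (abs_pos.2 hx₀)))] with t hmixed ht hpos hclose hL
  rcases hL.mixed_eq_zero_or (h.analyticOnNhd_confFactor ht) hpos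
    (fun q => congrFun (hper t q 1) 0) with hzero | hzero
  · exact hmixed (hzero _)
  · obtain ⟨s, hs⟩ := hzero ![x₀, 0]
    have hpoint : (![x₀, 0] : Plane) + s • Pi.single 1 1 = ![x₀, s] := by
      ext i
      fin_cases i <;> simp
    rw [hpoint] at hs
    exact h.dirDeriv_dirDeriv_confFactor_ne_zero_of_ckClose hε h₁ h₂ ht hclose hx₀ s hs

end IsSymmetryFlow

theorem exists_isSymmetryFlow {U₀ : Plane → State} (han : AnalyticOnNhd ℝ U₀ Set.univ)
    (hper : DoublyPeriodic U₀) :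
    ∃ ε : ℝ, 0 < ε ∧ ∃ U : ℝ → Plane → State, IsSymmetryFlow ε U₀ U ∧
      (∀ t, DoublyPeriodic (U t)) ∧
      ∀ (k : ℕ) (δ : ℝ), 0 < δ → ∀ᶠ t in 𝓝 0,
        CkClose k δ (confFactor (U t)) (confFactor U₀) ∧
        CkClose k δ (magField (U t)) (magField U₀) := by
  obtain ⟨C, A, hA, hC⟩ := exists_hasCauchyBound_of_periodic han fun i q => hper q i
  obtain ⟨ε, hε, U, hUan, hU₀, hderiv, hUper, hb⟩ :=
    exists_analytic_solution symQuadratic symLinear hC hA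
  have hflow : IsSymmetryFlow ε U₀ U :=
    ⟨hUan, hU₀, fun t ht q => (hderiv t ht q).deriv.trans (symQuadratic_add_symLinear _ _)⟩
  exact ⟨ε, hε, U, hflow, fun t q i => hUper _ (fun q => hper q i) t q,
    fun k δ hδ => hflow.eventually_ckClose hε hb k hδ⟩

theorem exists_liouville_deformation {L₁ L₂ : ℝ → ℝ} (h₁ : AnalyticOnNhd ℝ L₁ Set.univ)
    (h₂ : AnalyticOnNhd ℝ L₂ Set.univ) (p₁ : Function.Periodic L₁ 1)
    (p₂ : Function.Periodic L₂ 1) (hpos : ∀ x y, 0 < L₁ x + L₂ y) :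
    ∃ ε : ℝ, 0 < ε ∧ ∃ U : ℝ → Plane → State,
      IsSymmetryFlow ε (liouvilleState L₁ L₂) U ∧
      (∀ t, |t| < ε → DoublyPeriodic (U t) ∧ ∀ q, 0 < confFactor (U t) q) ∧
      (∀ t, t ≠ 0 → |t| < ε → (∃ s s', L₁ s ≠ L₁ s') → (∃ s s', L₂ s ≠ L₂ s') →
        ¬IsLiouvilleMetric (conformalMetric (confFactor (U t))) ∧ ∃ q, magField (U t) q ≠ 0) ∧
      ∀ (k : ℕ) (δ : ℝ), 0 < δ → ∃ τ : ℝ, 0 < τ ∧ ∀ t, |t| < τ →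
        CkClose k δ (confFactor (U t)) (fun q => L₁ (q 0) + L₂ (q 1)) ∧
        CkClose k δ (magField (U t)) (fun _ => 0) := by
  have han := analyticOnNhd_liouvilleState h₁ h₂
  have hper := doublyPeriodic_liouvilleState p₁ p₂
  obtain ⟨ε, hε, U, hU, hUper, hclose⟩ := exists_isSymmetryFlow han hper
  have hclose₁ (k : ℕ) : ∀ δ > 0, ∀ᶠ t in 𝓝 0,
      CkClose k δ (confFactor (U t)) (confFactor (liouvilleState L₁ L₂)) :=
    fun δ hδ => (hclose k δ hδ).mono fun t ht => ht.1
  have hUpos := IsSymmetryFlow.eventually_confFactor_pos (hclose₁ 0)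
    (continuousOn_univ.1 han.continuousOn) hper fun q => hpos _ _
  have hdeformed : ∀ᶠ t in 𝓝[≠] 0, (∃ s s', L₁ s ≠ L₁ s') → (∃ s s', L₂ s ≠ L₂ s') →
      ¬IsLiouvilleMetric (conformalMetric (confFactor (U t))) ∧ ∃ q, magField (U t) q ≠ 0 := by
    refine Filter.eventually_imp_distrib_left.2 fun n₁ =>
      Filter.eventually_imp_distrib_left.2 fun n₂ => ?_
    obtain ⟨x, y, hxy⟩ := exists_deriv_deriv_ne (L₂ := L₂) one_pos p₁
      h₁.contDiff.differentiable_one h₁.deriv.contDiff.differentiable_one n₁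
    filter_upwards [hU.eventually_not_isLiouvilleMetric hε h₁ h₂ p₁ p₂ n₁ n₂ hUper hUpos
      (hclose₁ 2), hU.eventually_magField_ne_zero hε h₁ h₂ hxy] with t hL hΩ
    exact ⟨hL, _, hΩ⟩
  obtain ⟨τ, hτ, hball⟩ := Metric.eventually_nhds_iff.1
    (hUpos.and (eventually_nhdsWithin_iff.1 hdeformed))
  have hsmall {t : ℝ} (ht : |t| < min ε τ) : dist t 0 < τ := by
    simpa using ht.trans_le (min_le_right _ _)
  refine ⟨min ε τ, lt_min hε hτ, U, hU.mono (min_le_left _ _),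
    fun t ht => ⟨hUper t, (hball (hsmall ht)).1⟩, fun t ht₀ ht => (hball (hsmall ht)).2 ht₀,
    fun k δ hδ => ?_⟩
  obtain ⟨r, hr, hck⟩ := Metric.eventually_nhds_iff.1 (hclose k δ hδ)
  rw [magField_liouvilleState] at hck
  exact ⟨r, hr, fun t ht => hck (by simpa using ht)⟩

theorem theorem1_general :
    IsSemiHamiltonian magA magB ∧ ¬ IsLinearlyDegenerate magA magB ∧
    (∀ U : Plane → State, Differentiable ℝ U → (∀ q, 0 < confFactor U q) →
      (SolvesSystem magA magB U ↔
        IsConservedOnLevel (conformalMetric (confFactor U)) (magField U) (magIntegral U))) ∧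
    (∀ L₁ L₂ : ℝ → ℝ,
      AnalyticOnNhd ℝ L₁ Set.univ → AnalyticOnNhd ℝ L₂ Set.univ →
      (∀ s, L₁ (s + 1) = L₁ s) → (∀ s, L₂ (s + 1) = L₂ s) →
      (∀ x y, 0 < L₁ x + L₂ y) →
      ∃ ε : ℝ, 0 < ε ∧ ∃ U : ℝ → Plane → State,
        IsSymmetryFlow ε (liouvilleState L₁ L₂) U ∧
        (∀ δ : ℝ, 0 < δ → δ ≤ ε → ∀ W : ℝ → Plane → State,
          IsSymmetryFlow δ (liouvilleState L₁ L₂) W → ∀ t, |t| < δ → W t = U t) ∧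
        (∀ t, |t| < ε →
          DoublyPeriodic (U t) ∧
          SolvesSystem magA magB (U t) ∧
          IsAnalyticTorusMetric (conformalMetric (confFactor (U t))) ∧
          AnalyticOnNhd ℝ (magField (U t)) Set.univ ∧
          DoublyPeriodic (magField (U t)) ∧
          IsQuadraticIntegralOnLevel (conformalMetric (confFactor (U t))) (magField (U t))
            (magIntegral (U t))) ∧
        (∀ t, t ≠ 0 → |t| < ε → (∃ s s', L₁ s ≠ L₁ s') → (∃ s s', L₂ s ≠ L₂ s') →
          ¬ IsLiouvilleMetric (conformalMetric (confFactor (U t))) ∧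
          ∃ q, magField (U t) q ≠ 0) ∧
        (∀ (k : ℕ) (δ : ℝ), 0 < δ → ∃ τ : ℝ, 0 < τ ∧ ∀ t, |t| < τ →
          CkClose k δ (confFactor (U t)) (fun q => L₁ (q 0) + L₂ (q 1)) ∧
          CkClose k δ (magField (U t)) (fun _ => 0))) := by
  refine ⟨isSemiHamiltonian_mag, not_isLinearlyDegenerate_mag,
    fun U hU hpos => solvesSystem_iff_isConservedOnLevel hU hpos,
    fun L₁ L₂ h₁ h₂ p₁ p₂ hpos => ?_⟩
  obtain ⟨ε, hε, U, hU, htorus, hdeformed, hclose⟩ :=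
    exists_liouville_deformation h₁ h₂ p₁ p₂ hpos
  refine ⟨ε, hε, U, hU, fun δ hδ hδε W hW t ht => (hU.mono hδε).unique hW hδ ht,
    fun t ht => ?_, hdeformed, hclose⟩
  obtain ⟨hper, hUpos⟩ := htorus t ht
  have han := hU.analyticOnNhd_slice ht
  have hdiff : Differentiable ℝ (U t) := han.contDiff.differentiable_one
  have hsys := hU.solvesSystem h₁ h₂ ht
  exact ⟨hper, hsys,
    isAnalyticTorusMetric_conformalMetric (hU.analyticOnNhd_confFactor ht)
      (fun q i => congrFun (hper q i) 0) hUpos,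
    analyticOnNhd_magField han, doublyPeriodic_magField hper,
    isQuadraticInMomenta_magIntegral han hper,
    (solvesSystem_iff_isConservedOnLevel hdiff hUpos).1 hsys,
    isIndependentOnLevel_magIntegral hdiff hUpos⟩

theorem theorem1 :
    -- the quasi-linear system is semi-Hamiltonian and not linearly degenerate
    IsSemiHamiltonian magA magB ∧ ¬ IsLinearlyDegenerate magA magB ∧
    -- its solutions correspond to quadratic integrals on the energy level
    (∀ U : Plane → State, ContDiff ℝ 1 U → (∀ q, 0 < confFactor U q) →
      (SolvesSystem magA magB U ↔
        IsConservedOnLevel (conformalMetric (confFactor U)) (magField U) (magIntegral U))) ∧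
    -- flowing a Liouville solution by the symmetry
    (∀ L₁ L₂ : ℝ → ℝ,
      AnalyticOnNhd ℝ L₁ Set.univ → AnalyticOnNhd ℝ L₂ Set.univ →
      (∀ s, L₁ (s + 1) = L₁ s) → (∀ s, L₂ (s + 1) = L₂ s) →
      (∀ s, 0 < L₁ s) → (∀ s, 0 < L₂ s) →
      (∃ s s', L₁ s ≠ L₁ s') → (∃ s s', L₂ s ≠ L₂ s') →
      ∃ ε : ℝ, 0 < ε ∧ ∃ U : ℝ → Plane → State,
        IsSymmetryFlow ε (liouvilleState L₁ L₂) U ∧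
        (∀ δ : ℝ, 0 < δ → δ ≤ ε → ∀ W : ℝ → Plane → State,
          IsSymmetryFlow δ (liouvilleState L₁ L₂) W → ∀ t, |t| < δ → W t = U t) ∧
        (∀ t, |t| < ε →
          DoublyPeriodic (U t) ∧
          SolvesSystem magA magB (U t) ∧
          IsAnalyticTorusMetric (conformalMetric (confFactor (U t))) ∧
          AnalyticOnNhd ℝ (magField (U t)) Set.univ ∧
          DoublyPeriodic (magField (U t)) ∧
          IsQuadraticIntegralOnLevel (conformalMetric (confFactor (U t))) (magField (U t))
            (magIntegral (U t))) ∧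
        (∀ t, 0 < |t| → |t| < ε →
          ¬ IsLiouvilleMetric (conformalMetric (confFactor (U t))) ∧
          ∃ q, magField (U t) q ≠ 0) ∧
        (∀ (k : ℕ) (δ : ℝ), 0 < δ → ∃ τ : ℝ, 0 < τ ∧ ∀ t, |t| < τ →
          CkClose k δ (confFactor (U t)) (fun q => L₁ (q 0) + L₂ (q 1)) ∧
          CkClose k δ (magField (U t)) (fun _ => 0))) := by
  obtain ⟨hsemi, hdeg, hconserved, hdeform⟩ := theorem1_general
  refine ⟨hsemi, hdeg, fun U hU => hconserved U hU.differentiable_one,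
    fun L₁ L₂ h₁ h₂ p₁ p₂ pos₁ pos₂ n₁ n₂ => ?_⟩
  obtain ⟨ε, hε, U, hU, hunique, htorus, hdeformed, hclose⟩ :=
    hdeform L₁ L₂ h₁ h₂ p₁ p₂ fun x y => add_pos (pos₁ x) (pos₂ y)
  exact ⟨ε, hε, U, hU, hunique, htorus,
    fun t ht₀ ht => hdeformed t (abs_pos.1 ht₀) ht n₁ n₂, hclose⟩
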